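/- **Proposition 2.** Consider the two-player game with inputs $x,y\in\{0,1\}$, uniformly and independently distributed, outputs $a,b\in\{0,1\}$, and winning predicate $V(a,b|x,y)\in\{0,1\}$, where $V=1$ exactly when: $a\oplus b=0$ for $(x,y)=(0,0)$; $a\oplus b=1$ for $(x,y)\in\{(1,0),(0,1)\}$; $(a,b)=(0,1)$ for $(x,y)=(1,1)$. Quantum strategies consist of a density matrix $\rho$ on $\mathbb C^m\otimes\mathbb C^n$ ($m,n$ arbitrary) and two-outcome POVMs $\{A^x_a\}_a$, $\{B^y_b\}_b$ on the two factors, with $P(a,b|x,y)=\operatorname{Tr}(\rho\,A^x_a\otimes B^y_b)$. For such a strategy put $P(a|x)=\operatorname{Tr}(\rho\,A^x_a\otimes 1)$, $\hat\sigma^B_{a|x}=\operatorname{tr}_A[(A^x_a\otimes 1)\rho]/P(a|x)$ (the state to which Alice steers Bob), and $$\xi_B^{(x,a)}=\max_{\sigma}\ \sum_{y,b}\tfrac12 V(a,b|x,y)\operatorname{Tr}(\sigma B^y_b),$$ the maximum being over all density matrices $\sigma$ of Bob; the maximizers are the *maximally certain states* for $(x,a)$. Define $P(b|y)$, $\hat\sigma^A_{b|y}$,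 $\xi_A^{(y,b)}$ and the maximally certain states for $(y,b)$ in the same way with the parties exchanged. Let $$\eta=\Big(\tfrac{43+9\sqrt{29}}2\Big)^{1/3},\qquad \alpha^*=2\arctan\sqrt{\tfrac{\eta^2+2\eta-5}{3\eta}},$$ $$\omega_q=\tfrac1{108}\Big(35+(15740-972\sqrt{29})^{1/3}+2^{2/3}(3935+243\sqrt{29})^{1/3}\Big).$$ Then: 1. The classical (local hidden variable) value of the game is $\tfrac34$. Its quantum value, the maximum of the winning probability over all quantum strategies, is $\omega_q\approx0.7822$ (that is, $|\omega_q-0.7822|<5\cdot10^{-5}$). 2. Let $\theta=\alpha^*$ or $\theta=-\alpha^*$. For two qubits let each party measure, on inputs $0$ and $1$, the observables $\begin{pmatrix}0&1\\1&0\end{pmatrix}$ and $\begin{pmatrix}0&e^{i\theta}\\e^{-i\theta}&0\end{pmatrix}$ respectively, output $a$ (or $b$) corresponding to the eigenvalue $(-1)^a$ (or $(-1)^b$). Then $\omega_q$ is an eigenvalue of the Bell operator $\sum_{x,y}\frac14\sum_{a,b}V(a,b|x,y)\,\Pi^x_a\otimes\Pi^y_b$ of the corresponding projectors. For every unit eigenvector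 $|\psi\rangle$ for this eigenvalue, the qubit strategy with these measurements and the state $|\psi\rangle$ is optimal, and it is the unique optimal strategy up to local isometries: for every quantum strategy of value $\omega_q$ there are isometries $W_A:\mathbb C^m\to\mathbb C^2\otimes\mathbb C^k$, $W_B:\mathbb C^n\to\mathbb C^2\otimes\mathbb C^l$ and a density matrix $\sigma$ on $\mathbb C^k\otimes\mathbb C^l$ with, up to the order of the tensor factors, $$(W_A\otimes W_B)(A^x_a\otimes B^y_b)\,\rho\,(W_A\otimes W_B)^\dagger=(\Pi^x_a\otimes\Pi^y_b)|\psi\rangle\langle\psi|\otimes\sigma\qquad\text{for all }x,y,a,b.$$ 3. For the qubit strategies of part 2, $\xi_B^{(0,0)}=\xi_B^{(0,1)}=\xi_A^{(0,0)}=\xi_A^{(0,1)}=\frac12(1+\sin\frac{\alpha^*}2)<1$ and $\xi_B^{(1,0)}=\xi_A^{(1,1)}=\frac12(1+\cos\frac{\alpha^*}2)<1$ (non-trivial uncertainty relations), while $\xi_B^{(1,1)}=\xi_A^{(1,0)}=\frac12$ (the trivial relations $P(b{=}0|y{=}0)\le1$ and $P(a{=}1|x{=}0)\le1$, in which a single probability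 appears with weight $\frac12$). For $(x,a)=(1,0)$ Alice steers Bob, and for $(y,b)=(1,1)$ Bob steers Alice, to a maximally certain state (these outcomes having positive probability). 4. For every optimal quantum strategy, in particular for those of part 2: for each $(x,a)\in\{(0,0),(0,1),(1,1)\}$ one has $P(a|x)>0$, and $\hat\sigma^B_{a|x}$ is not a maximally certain state, its value in the uncertainty expression being strictly less than $\xi_B^{(x,a)}$; likewise, for each $(y,b)\in\{(0,0),(0,1),(1,0)\}$ one has $P(b|y)>0$ and $\hat\sigma^A_{b|y}$ is not a maximally certain state, its value being strictly less than $\xi_A^{(y,b)}$. Consequently the quantum value lies strictly below the uncertainty bounds: $$\omega_q<\sum_{x,a}\tfrac12P(a|x)\,\xi_B^{(x,a)}\quad\text{and}\quad\omega_q<\sum_{y,b}\tfrac12P(b|y)\,\xi_A^{(y,b)}.$$ -/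

import Mathlib

namespace NonlocalGame

open Matrix
open scoped Kronecker ComplexOrder

noncomputable section

/-! ### The game -/

/-- The winning predicate `V(a,b|x,y)`: on inputs `(0,0)` the outputs must satisfy `a ⊕ b = 0`,
on `(1,0)` and `(0,1)` they must satisfy `a ⊕ b = 1`, on `(1,1)` only `(a,b) = (0,1)` wins.
Addition in `Fin 2` is addition modulo two. -/
def V (a b x y : Fin 2) : ℝ :=
  if x = 0 ∧ y = 0 then (if a + b = 0 then 1 else 0)
  else if x = 1 ∧ y = 1 then (if a = 0 ∧ b = 1 then 1 else 0)
  else (if a + b = 1 then 1 else 0)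

/-- A box; `P a b x y` is the conditional probability `P(a,b|x,y)`. -/
abbrev Box := Fin 2 → Fin 2 → Fin 2 → Fin 2 → ℝ

/-- The winning probability of a box for uniformly distributed inputs. -/
def gameValue (P : Box) : ℝ :=
  ∑ x, ∑ y, (1 / 4 : ℝ) * ∑ a, ∑ b, V a b x y * P a b x y

/-- Classical (local hidden variable) boxes: mixtures of products of local response functions. -/
def IsClassicalBox (P : Box) : Prop :=
  ∃ (k : ℕ) (q : Fin k → ℝ) (pA pB : Fin k → Fin 2 → Fin 2 → ℝ),
    (∀ i, 0 ≤ q i) ∧ ∑ i, q i = 1 ∧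
    (∀ i x a, 0 ≤ pA i x a) ∧ (∀ i x, ∑ a, pA i x a = 1) ∧
    (∀ i y b, 0 ≤ pB i y b) ∧ (∀ i y, ∑ b, pB i y b = 1) ∧
    ∀ a b x y, P a b x y = ∑ i, q i * pA i x a * pB i y b

/-! ### Quantum strategies -/

/-- Density matrices: positive semidefinite of trace one. -/
def IsDensity {ι : Type*} [Fintype ι] (σ : Matrix ι ι ℂ) : Prop :=
  σ.PosSemidef ∧ σ.trace = 1

/-- A quantum strategy with local Hilbert spaces `ℂ^ι` (Alice) and `ℂ^κ` (Bob): a shared, possibly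
mixed, state and a two-outcome POVM for each of the two inputs of each party. -/
structure Strategy (ι κ : Type*) [Fintype ι] [Fintype κ] [DecidableEq ι] [DecidableEq κ] where
  ρ : Matrix (ι × κ) (ι × κ) ℂ
  /-- `A x a` is Alice's measurement operator for input `x` and output `a`. -/
  A : Fin 2 → Fin 2 → Matrix ι ι ℂ
  /-- `B y b` is Bob's measurement operator for input `y` and output `b`. -/
  B : Fin 2 → Fin 2 → Matrix κ κ ℂ
  density : IsDensity ρ
  A_pos : ∀ x a, (A x a).PosSemidef
  A_sum : ∀ x, ∑ a, A x a = 1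
  B_pos : ∀ y b, (B y b).PosSemidef
  B_sum : ∀ y, ∑ b, B y b = 1

/-- Partial trace over Alice's system. -/
def traceA {ι κ : Type*} [Fintype ι] (X : Matrix (ι × κ) (ι × κ) ℂ) : Matrix κ κ ℂ :=
  Matrix.of fun j j' => ∑ i, X (i, j) (i, j')

/-- Partial trace over Bob's system. -/
def traceB {ι κ : Type*} [Fintype κ] (X : Matrix (ι × κ) (ι × κ) ℂ) : Matrix ι ι ℂ :=
  Matrix.of fun i i' => ∑ j, X (i, j) (i', j)

namespace Strategy

variable {ι κ : Type*} [Fintype ι] [Fintype κ] [DecidableEq ι] [DecidableEq κ]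

/-- `P(a,b|x,y) = Tr (ρ (A x a ⊗ B y b))` (the trace is real). -/
def box (S : Strategy ι κ) : Box :=
  fun a b x y => (S.ρ * (S.A x a ⊗ₖ S.B y b)).trace.re

/-- The winning probability of a strategy. -/
def value (S : Strategy ι κ) : ℝ := gameValue S.box

/-! #### Alice steering Bob -/

/-- Bob's unnormalised conditional state `tr_A [(A x a ⊗ 1) ρ]`. -/
def assemblageBob (S : Strategy ι κ) (x a : Fin 2) : Matrix κ κ ℂ :=
  traceA ((S.A x a ⊗ₖ (1 : Matrix κ κ ℂ)) * S.ρ)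

/-- `P(a|x)`, Alice's local probability. -/
def probAlice (S : Strategy ι κ) (x a : Fin 2) : ℝ := (S.assemblageBob x a).trace.re

/-- The state to which Alice steers Bob's system with input `x` and output `a`
(meaningful when `P(a|x) ≠ 0`). -/
def steeredBob (S : Strategy ι κ) (x a : Fin 2) : Matrix κ κ ℂ :=
  ((S.probAlice x a : ℂ)⁻¹) • S.assemblageBob x a

/-- The uncertainty expression `∑_{y,b} π_B(y) V(a,b|x,y) P(b|y)_σ` for Bob's measurements in the
state `σ`. -/
def uncertBob (S : Strategy ι κ) (x a : Fin 2) (σ : Matrix κ κ ℂ) : ℝ :=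
  ∑ y, ∑ b, (1 / 2 : ℝ) * V a b x y * (σ * S.B y b).trace.re

/-- `ξ_B^{(x,a)}`, the maximum of the uncertainty expression over all states of Bob's system. -/
def xiBob (S : Strategy ι κ) (x a : Fin 2) : ℝ :=
  sSup {v | ∃ σ : Matrix κ κ ℂ, IsDensity σ ∧ S.uncertBob x a σ = v}

/-- The maximally certain states of Bob's system for `(x,a)`. -/
def IsMaxCertainBob (S : Strategy ι κ) (x a : Fin 2) (σ : Matrix κ κ ℂ) : Prop :=
  IsDensity σ ∧ ∀ τ : Matrix κ κ ℂ, IsDensity τ → S.uncertBob x a τ ≤ S.uncertBob x a σ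

/-- The bound that the uncertainty relations of Bob's system put on the game value:
`∑_{x,a} π_A(x) P(a|x) ξ_B^{(x,a)}`. -/
def upBoundBob (S : Strategy ι κ) : ℝ :=
  ∑ x, ∑ a, (1 / 2 : ℝ) * S.probAlice x a * S.xiBob x a

/-! #### Bob steering Alice -/

/-- Alice's unnormalised conditional state `tr_B [(1 ⊗ B y b) ρ]`. -/
def assemblageAlice (S : Strategy ι κ) (y b : Fin 2) : Matrix ι ι ℂ :=
  traceB (((1 : Matrix ι ι ℂ) ⊗ₖ S.B y b) * S.ρ)

/-- `P(b|y)`, Bob's local probability. -/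
def probBob (S : Strategy ι κ) (y b : Fin 2) : ℝ := (S.assemblageAlice y b).trace.re

/-- The state to which Bob steers Alice's system with input `y` and output `b`
(meaningful when `P(b|y) ≠ 0`). -/
def steeredAlice (S : Strategy ι κ) (y b : Fin 2) : Matrix ι ι ℂ :=
  ((S.probBob y b : ℂ)⁻¹) • S.assemblageAlice y b

/-- The uncertainty expression `∑_{x,a} π_A(x) V(a,b|x,y) P(a|x)_σ` for Alice's measurements in the
state `σ`. -/
def uncertAlice (S : Strategy ι κ) (y b : Fin 2) (σ : Matrix ι ι ℂ) : ℝ :=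
  ∑ x, ∑ a, (1 / 2 : ℝ) * V a b x y * (σ * S.A x a).trace.re

/-- `ξ_A^{(y,b)}`, the maximum of the uncertainty expression over all states of Alice's system. -/
def xiAlice (S : Strategy ι κ) (y b : Fin 2) : ℝ :=
  sSup {v | ∃ σ : Matrix ι ι ℂ, IsDensity σ ∧ S.uncertAlice y b σ = v}

/-- The maximally certain states of Alice's system for `(y,b)`. -/
def IsMaxCertainAlice (S : Strategy ι κ) (y b : Fin 2) (σ : Matrix ι ι ℂ) : Prop :=
  IsDensity σ ∧ ∀ τ : Matrix ι ι ℂ, IsDensity τ → S.uncertAlice y b τ ≤ S.uncertAlice y b σ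

/-- `∑_{y,b} π_B(y) P(b|y) ξ_A^{(y,b)}`. -/
def upBoundAlice (S : Strategy ι κ) : ℝ :=
  ∑ y, ∑ b, (1 / 2 : ℝ) * S.probBob y b * S.xiAlice y b

/-! #### Equality up to local isometries -/

/-- `S` is the reference strategy `R` up to local isometries: there are isometries
`W_A : ℂ^ι → ℂ^ι' ⊗ ℂ^k` and `W_B : ℂ^κ → ℂ^κ' ⊗ ℂ^l` and an ancilla state `σ` such that, for all
inputs and outputs,
`(W_A ⊗ W_B) (A x a ⊗ B y b) ρ (W_A ⊗ W_B)ᴴ = (A' x a ⊗ B' y b) ρ' ⊗ σ`, where the primed objects are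
those of `R`. Summing over `a` and `b` gives `(W_A ⊗ W_B) ρ (W_A ⊗ W_B)ᴴ = ρ' ⊗ σ`. The `submatrix`
only reorders the tensor factors. -/
def IsLocallyIsometricTo {ι' κ' : Type*} [Fintype ι'] [Fintype κ'] [DecidableEq ι']
    [DecidableEq κ'] (S : Strategy ι κ) (R : Strategy ι' κ') : Prop :=
  ∃ (k l : ℕ) (WA : Matrix (ι' × Fin k) ι ℂ) (WB : Matrix (κ' × Fin l) κ ℂ)
    (σ : Matrix (Fin k × Fin l) (Fin k × Fin l) ℂ),
    WAᴴ * WA = 1 ∧ WBᴴ * WB = 1 ∧ IsDensity σ ∧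
    ∀ x y a b : Fin 2,
      (WA ⊗ₖ WB) * ((S.A x a ⊗ₖ S.B y b) * S.ρ) * (WA ⊗ₖ WB)ᴴ =
        (((R.A x a ⊗ₖ R.B y b) * R.ρ) ⊗ₖ σ).submatrix
          (Equiv.prodProdProdComm ι' (Fin k) κ' (Fin l))
          (Equiv.prodProdProdComm ι' (Fin k) κ' (Fin l))

end Strategy

/-! ### Qubit strategies -/

/-- The qubit observable with rows `(0, e^{iθ})` and `(e^{-iθ}, 0)`. -/
def observable (θ : ℝ) : Matrix (Fin 2) (Fin 2) ℂ :=
  !![0, Complex.exp (Complex.I * θ); Complex.exp (-(Complex.I * θ)), 0]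

/-- The spectral projector `(1 + (-1)^a M) / 2` of `M = observable θ` for the eigenvalue
`(-1)^a`. -/
def proj (θ : ℝ) (a : Fin 2) : Matrix (Fin 2) (Fin 2) ℂ :=
  (1 / 2 : ℂ) • (1 + (-1 : ℂ) ^ (a : ℕ) • observable θ)

/-- The angle of input `x`: zero for `x = 0`, and `θ` for `x = 1`. -/
def angle (θ : ℝ) (x : Fin 2) : ℝ := if x = 0 then 0 else θ

theorem proj_eq_conjTranspose_mul_self (θ : ℝ) (a : Fin 2) :
    proj θ a = (proj θ a)ᴴ * proj θ a := by
  have h : Complex.exp (Complex.I * θ) * Complex.exp (-(Complex.I * θ)) = 1 := by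
    rw [← Complex.exp_add]; simp
  have h1 : (starRingEnd ℂ) (Complex.exp (Complex.I * θ)) = Complex.exp (-(Complex.I * θ)) := by
    rw [← Complex.exp_conj]; simp
  have h2 : (starRingEnd ℂ) (Complex.exp (-(Complex.I * θ))) = Complex.exp (Complex.I * θ) := by
    rw [← Complex.exp_conj]; simp
  have h3 : (starRingEnd ℂ) 2 = 2 := Complex.conj_ofNat 2
  fin_cases a <;> ext i j <;> fin_cases i <;> fin_cases j <;>
    simp [proj, observable, Matrix.mul_apply, Fin.sum_univ_two, h1, h2,
      h3] <;>
    first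
    | ring1
    | linear_combination (-1 / 4 : ℂ) * h

theorem proj_posSemidef (θ : ℝ) (a : Fin 2) : (proj θ a).PosSemidef := by
  rw [proj_eq_conjTranspose_mul_self]
  exact Matrix.posSemidef_conjTranspose_mul_self _

theorem proj_sum (θ : ℝ) : ∑ a, proj θ a = 1 := by
  ext i j
  fin_cases i <;> fin_cases j <;> simp [proj, observable, Fin.sum_univ_two] <;> norm_num

theorem isDensity_pure {ι : Type*} [Fintype ι] (ψ : ι → ℂ) (hψ : ∑ i, ‖ψ i‖ ^ 2 = 1) :
    IsDensity (Matrix.vecMulVec ψ (star ψ)) := by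
  refine ⟨Matrix.posSemidef_vecMulVec_self_star ψ, ?_⟩
  have h : ∀ i, ψ i * star (ψ i) = ((‖ψ i‖ ^ 2 : ℝ) : ℂ) := fun i => by
    push_cast
    exact Complex.mul_conj' (ψ i)
  simp only [Matrix.trace, Matrix.diag_apply, Matrix.vecMulVec_apply, Pi.star_apply, h]
  rw [← Complex.ofReal_sum, hψ, Complex.ofReal_one]

/-- The two-qubit strategy with the pure state `ψ`, Alice measuring `observable 0` and
`observable α`, and Bob measuring `observable 0` and `observable β`. -/
def qubitStrategy (α β : ℝ) (ψ : Fin 2 × Fin 2 → ℂ) (hψ : ∑ p, ‖ψ p‖ ^ 2 = 1) :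
    Strategy (Fin 2) (Fin 2) where
  ρ := Matrix.vecMulVec ψ (star ψ)
  A x a := proj (angle α x) a
  B y b := proj (angle β y) b
  density := isDensity_pure ψ hψ
  A_pos _ a := proj_posSemidef _ a
  A_sum _ := proj_sum _
  B_pos _ b := proj_posSemidef _ b
  B_sum _ := proj_sum _

/-- The Bell operator `∑_{x,y} π_{AB}(x,y) ∑_{a,b} V(a,b|x,y) Π^x_a ⊗ Π^y_b`. -/
def bellOperator (α β : ℝ) : Matrix (Fin 2 × Fin 2) (Fin 2 × Fin 2) ℂ :=
  ∑ x, ∑ y, (1 / 4 : ℂ) • ∑ a, ∑ b,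
    (V a b x y : ℂ) • (proj (angle α x) a ⊗ₖ proj (angle β y) b)

/-! ### The explicit constants -/

/-- `η = ((43 + 9 √29) / 2)^{1/3}`. -/
def eta : ℝ := ((43 + 9 * Real.sqrt 29) / 2) ^ (1 / 3 : ℝ)

/-- `2 arctan √((η² + 2η - 5) / (3η))`. -/
def alphaOpt : ℝ := 2 * Real.arctan (Real.sqrt ((eta ^ 2 + 2 * eta - 5) / (3 * eta)))

/-- `(35 + (15740 - 972 √29)^{1/3} + 2^{2/3} (3935 + 243 √29)^{1/3}) / 108`. -/
def omegaQ : ℝ :=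
  (1 / 108) * (35 + (15740 - 972 * Real.sqrt 29) ^ (1 / 3 : ℝ)
    + 2 ^ (2 / 3 : ℝ) * (3935 + 243 * Real.sqrt 29) ^ (1 / 3 : ℝ))

end

end NonlocalGame

open NonlocalGame

namespace NonlocalGame

open Matrix
open scoped Kronecker ComplexOrder

noncomputable section

/-! ### The algebraic constants -/

/-! Put `τ = tan²(α*/2)`, the real root of `τ³ - 2τ² + 3τ - 3`. The numbers `ω_q`, `cos α*`, `cos
(α*/2)` and all optimal correlations lie in `ℚ(τ)`, so the arithmetic consists of identities modulo
this cubic and of inequalities on `1.39264 < τ < 1.39265`.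

Upper bound. With the sign of Bob's second observable reversed, the winning probability is `(7 +
⟨𝓑⟩)/16`, where `𝓑 = 2a₀b₀ - 2a₁b₀ + 2a₀b₁ + a₁b₁ + a₁ + b₁`. For commuting pairs of involutions,
`bellMax - 𝓑` is a positive definite quadratic form in five operators
(`IsInvolutionPair.sum_of_squares`, `IsInvolutionPair.sq_nullVec_le`). POVMs reduce to involutions
by dilating a contraction `a` to `(a, √(1-a²); √(1-a²), -a)`; a mixed state `ρ` is treated as the
vector `√ρ` of the Hilbert–Schmidt space.

Uniqueness. At equality the five operators annihilate the state
(`IsContractionPair.optimalRelations`). It follows that the observables square to one on the state,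
preserve the supports of the marginals, and have a fixed anticommutator. Such a pair of involutions
is a multiple of the qubit pair, which yields local isometries (`exists_isometry_observable`). The
transported state is an `ω_q`-eigenstate of the qubit Bell operator tensored with an ancilla; that
eigenspace of the qubit operator is a line (`eigenvector_unique`), so the state is a product
(`exists_ancilla`).

Steering. The same relations determine all correlations by linear equations
(`OptimalRelations.values`). Each uncertainty expression is affine in the expectation of a single
observable, so a maximally certain state has zero variance for it; the correlations give positive
variance for three input–output pairs and exactly the maximum for the fourth. Exchanging the parties
and flipping the outputs is a symmetry of the game, which gives the statements about Bob steering
Alice. -/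

/-- The square of `tan (α* / 2)`. -/
def tanSq : ℝ := (eta ^ 2 + 2 * eta - 5) / (3 * eta)

theorem eta_pos : 0 < eta := by unfold eta; positivity

theorem eta_cube : eta ^ 3 = (43 + 9 * Real.sqrt 29) / 2 := by
  have h : (0 : ℝ) ≤ (43 + 9 * Real.sqrt 29) / 2 := by positivity
  unfold eta
  rw [← Real.rpow_natCast, ← Real.rpow_mul h]
  norm_num

/-- This is Cardano's formula: `τ = 2/3 + (η - 5/η)/3`, and `η³` is a root of `u² - 43u - 125`. -/
theorem tanSq_cubic : tanSq ^ 3 - 2 * tanSq ^ 2 + 3 * tanSq - 3 = 0 := by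
  have h0 : eta ≠ 0 := eta_pos.ne'
  have hs : Real.sqrt 29 ^ 2 = 29 := Real.sq_sqrt (by norm_num)
  have h6 : eta ^ 6 - 43 * eta ^ 3 - 125 = 0 := by
    have : eta ^ 6 = (eta ^ 3) ^ 2 := by ring
    rw [this, eta_cube]
    linear_combination (81 / 4) * hs
  unfold tanSq
  field_simp
  linear_combination h6

theorem tanSq_gt : 1.39264 < tanSq := by
  by_contra h
  push Not at h
  -- For a bound `c`, the cubic at `τ` minus the cubic at `c` is `τ - c` times a positive quadratic
  -- whose vertex `1 - c/2` is close to `0.3`.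
  nlinarith [tanSq_cubic, mul_nonneg (sub_nonneg.2 h) (sq_nonneg (tanSq - 0.3))]

theorem tanSq_lt : tanSq < 1.39265 := by
  by_contra h
  push Not at h
  nlinarith [tanSq_cubic, mul_nonneg (sub_nonneg.2 h) (sq_nonneg (tanSq - 0.3))]

theorem tanSq_pos : 0 < tanSq := lt_trans (by norm_num) tanSq_gt

/-- The two radicals are Cardano's for `w³ - 1812w - 31480`. The polynomial `28 - 18τ + 24τ²` is
also a root, and this cubic has only one root in `[49, ∞)`. -/
theorem omegaQ_eq : omegaQ = 7 / 12 - tanSq / 6 + 2 * tanSq ^ 2 / 9 := by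
  have hs : Real.sqrt 29 ^ 2 = 29 := Real.sq_sqrt (by norm_num)
  have hs0 : 0 ≤ Real.sqrt 29 := Real.sqrt_nonneg _
  have hs1 : Real.sqrt 29 < 6 := by
    rw [Real.sqrt_lt' (by norm_num)]; norm_num
  set s := (15740 - 972 * Real.sqrt 29) ^ (1 / 3 : ℝ) with hsdef
  set t := (2 : ℝ) ^ (2 / 3 : ℝ) * (3935 + 243 * Real.sqrt 29) ^ (1 / 3 : ℝ) with htdef
  have p1 : (0 : ℝ) ≤ 15740 - 972 * Real.sqrt 29 := by linarith
  have p2 : (0 : ℝ) ≤ 3935 + 243 * Real.sqrt 29 := by positivity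
  have s3 : s ^ 3 = 15740 - 972 * Real.sqrt 29 := by
    rw [hsdef, ← Real.rpow_natCast, ← Real.rpow_mul p1]; norm_num
  have t3 : t ^ 3 = 15740 + 972 * Real.sqrt 29 := by
    rw [htdef, mul_pow, ← Real.rpow_natCast, ← Real.rpow_mul (by norm_num : (0 : ℝ) ≤ 2),
      ← Real.rpow_natCast, ← Real.rpow_mul p2]
    norm_num
    ring
  have s0 : 0 ≤ s := by positivity
  have t0 : 0 ≤ t := by positivity
  -- `15740² - 29 · 972² = 604³`.
  have st : s * t = 604 := by
    have : (s * t) ^ 3 = 604 ^ 3 := by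
      rw [mul_pow, s3, t3]; linear_combination (-972 ^ 2) * hs
    exact (pow_left_inj₀ (by positivity) (by norm_num) (by norm_num)).1 this
  have hw : (s + t) ^ 3 - 1812 * (s + t) - 31480 = 0 := by
    linear_combination s3 + t3 + (3 * (s + t)) * st
  -- By the inequality of the means, `(s + t)² ≥ 4 · 604 > 49²`.
  have hlow : 49 ≤ s + t := by
    have hg : 49 ^ 2 ≤ (s + t) ^ 2 := by nlinarith [sq_nonneg (s - t)]
    nlinarith
  set w := 28 - 18 * tanSq + 24 * tanSq ^ 2 with hwdef
  have hw' : w ^ 3 - 1812 * w - 31480 = 0 := by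
    rw [hwdef]
    linear_combination (13824 * tanSq ^ 3 - 3456 * tanSq ^ 2 + 23328 * tanSq + 20088) * tanSq_cubic
  have hw49 : 49 ≤ w := by
    rw [hwdef]; nlinarith [tanSq_gt]
  have : s + t = w := by
    -- The second factor is positive when both roots are at least `49`, because `3 · 49² > 1812`.
    have hf : (s + t - w) * ((s + t) ^ 2 + (s + t) * w + w ^ 2 - 1812) = 0 := by
      linear_combination hw - hw'
    rcases mul_eq_zero.1 hf with h | h
    · linarith
    · nlinarith
  unfold omegaQ
  rw [← hsdef, ← htdef]
  linarith

theorem omegaQ_approx : |omegaQ - 0.7822| < 0.00005 := by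
  rw [omegaQ_eq, abs_lt]
  constructor <;> nlinarith [tanSq_gt, tanSq_lt]

theorem alphaOpt_half : alphaOpt / 2 = Real.arctan (Real.sqrt tanSq) := by
  unfold alphaOpt tanSq; ring

/-- `1 + τ` is a square in `ℚ(τ)`; this is what puts `cos (α*/2)` into that field. -/
theorem sqrt_one_add_tanSq : Real.sqrt (1 + tanSq) = 1 - tanSq + tanSq ^ 2 := by
  rw [Real.sqrt_eq_iff_mul_self_eq_of_pos (by nlinarith [tanSq_gt])]
  linear_combination tanSq * tanSq_cubic

theorem cos_alphaOpt_half : Real.cos (alphaOpt / 2) = 1 / (1 - tanSq + tanSq ^ 2) := by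
  rw [alphaOpt_half, Real.cos_arctan, Real.sq_sqrt tanSq_pos.le, sqrt_one_add_tanSq]

theorem cos_alphaOpt : Real.cos alphaOpt = 1 / 3 - 2 * tanSq / 3 + 2 * tanSq ^ 2 / 9 := by
  have h : alphaOpt = 2 * (alphaOpt / 2) := by ring
  rw [h, Real.cos_two_mul, alphaOpt_half, Real.cos_sq_arctan, Real.sq_sqrt tanSq_pos.le]
  have := tanSq_pos
  field_simp
  linear_combination (-6 : ℝ) * tanSq_cubic

theorem alphaOpt_half_mem : 0 < alphaOpt / 2 ∧ alphaOpt / 2 < Real.pi / 2 := by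
  rw [alphaOpt_half]
  exact ⟨Real.arctan_pos.2 (Real.sqrt_pos.2 tanSq_pos), Real.arctan_lt_pi_div_two _⟩

theorem sin_alphaOpt_half_pos : 0 < Real.sin (alphaOpt / 2) :=
  Real.sin_pos_of_pos_of_lt_pi alphaOpt_half_mem.1 (by linarith [alphaOpt_half_mem.2, Real.pi_pos])

theorem cos_alphaOpt_half_pos : 0 < Real.cos (alphaOpt / 2) :=
  Real.cos_pos_of_mem_Ioo ⟨by linarith [alphaOpt_half_mem.1, Real.pi_pos], alphaOpt_half_mem.2⟩

theorem sin_alphaOpt_half_lt : Real.sin (alphaOpt / 2) < 1 := by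
  nlinarith [Real.sin_sq_add_cos_sq (alphaOpt / 2), cos_alphaOpt_half_pos, sin_alphaOpt_half_pos]

theorem cos_alphaOpt_half_lt : Real.cos (alphaOpt / 2) < 1 := by
  nlinarith [Real.sin_sq_add_cos_sq (alphaOpt / 2), cos_alphaOpt_half_pos, sin_alphaOpt_half_pos]

theorem sin_alphaOpt_pos : 0 < Real.sin alphaOpt :=
  Real.sin_pos_of_pos_of_lt_pi (by linarith [alphaOpt_half_mem.1])
    (by linarith [alphaOpt_half_mem.2])

end

end NonlocalGame

namespace NonlocalGame

open Matrix
open scoped Kronecker ComplexOrder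

noncomputable section

local notation "τ" => tanSq

/-! ### A sum of squares certificate -/

section Certificate

variable {E : Type*} [AddCommGroup E] [Module ℝ E]

/-- Two pairs of symmetric involutions, those of different pairs commuting. -/
structure IsInvolutionPair (β : LinearMap.BilinForm ℝ E) (a b : Fin 2 → Module.End ℝ E) :
    Prop where
  symm_a : ∀ i x y, β (a i x) y = β x (a i y)
  symm_b : ∀ i x y, β (b i x) y = β x (b i y)
  sq_a : ∀ i x, a i (a i x) = x
  sq_b : ∀ i x, b i (b i x) = x
  comm : ∀ i j x, b j (a i x) = a i (b j x)

/-- The Bell expression of the game, shifted and scaled to `16 ω - 7`; the sign of `b 1` is opposite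
to that of Bob's observable for input `1`. -/
def bellVec (a b : Fin 2 → Module.End ℝ E) (ψ : E) : E :=
  (2 : ℝ) • a 0 (b 0 ψ) - (2 : ℝ) • a 1 (b 0 ψ) + (2 : ℝ) • a 0 (b 1 ψ) + a 1 (b 1 ψ) + a 1 ψ + b 1 ψ

/-- The maximum of the shifted and scaled Bell expression. -/
def bellMax : ℝ := 7 / 3 - 8 / 3 * τ + 32 / 9 * τ ^ 2

/-- The expressions that annihilate the optimal states. -/
def nullVec (a b : Fin 2 → Module.End ℝ E) (ψ : E) : Fin 5 → E :=
  ![(-7 / 15 + 8 / 15 * τ - 26 / 45 * τ ^ 2) • ψ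
      + (7 / 5 - 3 / 5 * τ + 2 / 5 * τ ^ 2) • (a 0 ψ - b 0 ψ)
      + (2 / 5 - 3 / 5 * τ + 1 / 15 * τ ^ 2) • (a 1 ψ + b 1 ψ) + a 0 (b 0 ψ),
    (7 / 15 - 8 / 15 * τ - 4 / 45 * τ ^ 2) • ψ
      + (8 / 5 - 2 / 5 * τ + 4 / 15 * τ ^ 2) • (a 0 ψ - b 0 ψ)
      + (3 / 5 - 2 / 5 * τ - 2 / 5 * τ ^ 2) • (a 1 ψ + b 1 ψ) + a 1 (b 1 ψ),
    (-14 / 15 + 16 / 15 * τ - 52 / 45 * τ ^ 2) • ψ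
      + (-11 / 5 + 4 / 5 * τ - 8 / 15 * τ ^ 2) • (a 0 ψ - b 0 ψ)
      + (-1 / 5 + 4 / 5 * τ + 2 / 15 * τ ^ 2) • (a 1 ψ + b 1 ψ) + (a 0 (b 1 ψ) - a 1 (b 0 ψ)),
    (τ ^ 2 - τ) • (a 0 ψ + b 0 ψ) + (a 1 ψ - b 1 ψ),
    (-1 + τ - 1 / 3 * τ ^ 2) • (a 0 ψ + b 0 ψ) + (a 0 (b 1 ψ) + a 1 (b 0 ψ))]

variable {β : LinearMap.BilinForm ℝ E} {a b : Fin 2 → Module.End ℝ E}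

/-- The exchange `a₀ ↔ -b₀`, `a₁ ↔ b₁` preserves the Bell expression, fixes the first three null
expressions and negates the last two. Hence the Gram matrix splits into a `3 × 3` and a `2 × 2`
block. -/
theorem IsInvolutionPair.sum_of_squares (h : IsInvolutionPair β a b) (hβ : ∀ x y, β x y = β y x)
    (ψ : E) :
    bellMax * β ψ ψ - β ψ (bellVec a b ψ) =
      (2 / 3 + 1 / 6 * τ - 1 / 3 * τ ^ 2) * β (nullVec a b ψ 0) (nullVec a b ψ 0)
      + (-1 / 12 + 1 / 6 * τ) * β (nullVec a b ψ 1) (nullVec a b ψ 1)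
      + 1 / 6 * β (nullVec a b ψ 2) (nullVec a b ψ 2)
      + 2 * (1 / 12 + 13 / 36 * τ - 11 / 36 * τ ^ 2) * β (nullVec a b ψ 0) (nullVec a b ψ 2)
      + 2 * (-5 / 24 + 1 / 24 * τ + 1 / 8 * τ ^ 2) * β (nullVec a b ψ 1) (nullVec a b ψ 2)
      + (1 / 6 - 1 / 3 * τ + 7 / 18 * τ ^ 2) * β (nullVec a b ψ 3) (nullVec a b ψ 3)
      - 1 / 3 * β (nullVec a b ψ 3) (nullVec a b ψ 4)
      + 1 / 6 * β (nullVec a b ψ 4) (nullVec a b ψ 4) := by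
  obtain ⟨sa, sb, qa, qb, cm⟩ := h
  -- Symmetry of the operators and of `β` identifies the expectation of a word with that of its
  -- reverse; these rewrites select one representative of each.
  have ha : ∀ x, β ψ (a 1 (a 0 x)) = β x (a 0 (a 1 ψ)) := fun x => by
    rw [← sa, ← sa, hβ]
  have r0 : β ψ (a 1 (a 0 ψ)) = β ψ (a 0 (a 1 ψ)) := ha ψ
  have r1 : ∀ j, β ψ (a 1 (a 0 (b j ψ))) = β ψ (a 0 (a 1 (b j ψ))) := fun j => by
    rw [ha, sb, cm, cm]
  have r2 : β ψ (b 1 (b 0 ψ)) = β ψ (b 0 (b 1 ψ)) := by rw [← sb, ← sb, hβ]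
  have r3 : ∀ i, β ψ (a i (b 1 (b 0 ψ))) = β ψ (a i (b 0 (b 1 ψ))) := fun i => by
    rw [← sa, ← sb, ← sb, hβ, cm, cm]
  have r4 : β ψ (a 1 (a 0 (b 0 (b 1 ψ)))) = β ψ (a 0 (a 1 (b 1 (b 0 ψ)))) := by
    rw [ha, sb, sb, cm, cm, cm, cm]
  simp only [nullVec, bellVec, bellMax, Matrix.cons_val, map_add, map_sub, map_smul,
    LinearMap.add_apply, LinearMap.sub_apply, LinearMap.smul_apply, smul_eq_mul, sa, sb, cm, qa, qb,
    r0, r1, r2, r3, r4]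
  -- For each word in the operators, the difference of the two sides has a coefficient divisible by
  -- the cubic; the brackets are the quotients.
  linear_combination -(
      ((-4088/2025) + (4982/6075) * τ + (-2903/6075) * τ ^ 2 + (5953/18225) * τ ^ 3) * β ψ ψ
      + ((-163/675) + (11/75) * τ + (16/75) * τ ^ 2 + (-1112/6075) * τ ^ 3) * β ψ (b 0 ψ)
      + ((118/675) + (-269/675) * τ + (-242/2025) * τ ^ 2 + (1412/6075) * τ ^ 3) * β ψ (b 1 ψ)
      + ((163/675) + (-11/75) * τ + (-16/75) * τ ^ 2 + (1112/6075) * τ ^ 3) * β ψ (a 0 ψ)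
      + ((118/675) + (-269/675) * τ + (-242/2025) * τ ^ 2 + (1412/6075) * τ ^ 3) * β ψ (a 1 ψ)
      + ((73/225) + (-254/225) * τ + (68/675) * τ ^ 2 + (-68/2025) * τ ^ 3) * β ψ (b 0 (b 1 ψ))
      + ((934/675) + (-1546/2025) * τ + (-74/225) * τ ^ 2 + (469/675) * τ ^ 3) * β ψ (a 0 (b 0 ψ))
      + ((-173/225) + (-194/2025) * τ + (-68/675) * τ ^ 2 + (68/2025) * τ ^ 3) * β ψ (a 0 (b 1 ψ))
      + ((-73/225) + (254/225) * τ + (-68/675) * τ ^ 2 + (68/2025) * τ ^ 3) * β ψ (a 0 (a 1 ψ))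
      + ((173/225) + (194/2025) * τ + (68/675) * τ ^ 2 + (-68/2025) * τ ^ 3) * β ψ (a 1 (b 0 ψ))
      + ((-274/675) + (-148/675) * τ + (-83/675) * τ ^ 2 + (-82/2025) * τ ^ 3) * β ψ (a 1 (b 1 ψ))
      + ((-4/9) + (7/135) * τ) * β ψ (a 0 (b 0 (b 1 ψ)))
      + ((-4/9) + (7/135) * τ) * β ψ (a 0 (a 1 (b 0 ψ)))
      + ((-1/45) + (-37/135) * τ) * β ψ (a 0 (a 1 (b 1 ψ)))
      + ((1/45) + (37/135) * τ) * β ψ (a 1 (b 0 (b 1 ψ)))) * tanSq_cubic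

/-- The mixed terms are absorbed by the squares of `N₀ - N₂`, `N₁ + N₂` and `N₃ - (3/4)N₄`, and
every diagonal coefficient keeps at least `1/100`. It is this positive margin that makes all null
expressions vanish at equality. -/
theorem IsInvolutionPair.sq_nullVec_le (h : IsInvolutionPair β a b)
    (hβ : ∀ x y, β x y = β y x) (hpos : ∀ x, 0 ≤ β x x) (ψ : E) :
    (1 / 100) * ∑ i, β (nullVec a b ψ i) (nullVec a b ψ i) ≤
      bellMax * β ψ ψ - β ψ (bellVec a b ψ) := by
  rw [h.sum_of_squares hβ, Fin.sum_univ_five]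
  have t1 := tanSq_gt
  have t2 := tanSq_lt
  have sq : ∀ (c : ℝ) (x y : E), 0 ≤ β x x + 2 * c * β x y + c ^ 2 * β y y := fun c x y => by
    have := hpos (x + c • y)
    simp only [map_add, map_smul, LinearMap.add_apply, LinearMap.smul_apply, smul_eq_mul,
      hβ y x] at this
    linarith
  have g02 : 0 ≤ -(1 / 12 + 13 / 36 * τ - 11 / 36 * τ ^ 2) := by nlinarith
  have g12 : 0 ≤ -5 / 24 + 1 / 24 * τ + 1 / 8 * τ ^ 2 := by nlinarith
  have e02 := mul_nonneg g02 (sq (-1) (nullVec a b ψ 0) (nullVec a b ψ 2))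
  have e12 := mul_nonneg g12 (sq 1 (nullVec a b ψ 1) (nullVec a b ψ 2))
  have e34 := sq (-3 / 4) (nullVec a b ψ 3) (nullVec a b ψ 4)
  have p0 := mul_nonneg (by nlinarith :
    0 ≤ (2 / 3 + 1 / 6 * τ - 1 / 3 * τ ^ 2) + (1 / 12 + 13 / 36 * τ - 11 / 36 * τ ^ 2) - 1 / 100)
    (hpos (nullVec a b ψ 0))
  have p1 := mul_nonneg (by nlinarith :
    0 ≤ (-1 / 12 + 1 / 6 * τ) - (-5 / 24 + 1 / 24 * τ + 1 / 8 * τ ^ 2) - 1 / 100)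
    (hpos (nullVec a b ψ 1))
  have p2 := mul_nonneg (by nlinarith :
    0 ≤ 1 / 6 + (1 / 12 + 13 / 36 * τ - 11 / 36 * τ ^ 2)
      - (-5 / 24 + 1 / 24 * τ + 1 / 8 * τ ^ 2) - 1 / 100)
    (hpos (nullVec a b ψ 2))
  -- `2/9` is the weight of `e34`, for which its mixed term becomes `-1/3`.
  have p3 := mul_nonneg (by nlinarith :
    0 ≤ (1 / 6 - 1 / 3 * τ + 7 / 18 * τ ^ 2) - 2 / 9 - 1 / 100)
    (hpos (nullVec a b ψ 3))
  have p4 := hpos (nullVec a b ψ 4)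
  linarith

/-! ### Dilation of contractions -/

/-- Two pairs of symmetric contractions `a`, `b` together with complements `s = √(1 - a²)` and
`t = √(1 - b²)`; what belongs to different pairs commutes. -/
structure IsContractionPair (β : LinearMap.BilinForm ℝ E) (a b s t : Fin 2 → Module.End ℝ E) :
    Prop where
  symm_a : ∀ i x y, β (a i x) y = β x (a i y)
  symm_b : ∀ i x y, β (b i x) y = β x (b i y)
  symm_s : ∀ i x y, β (s i x) y = β x (s i y)
  symm_t : ∀ i x y, β (t i x) y = β x (t i y)
  sq_a : ∀ i x, a i (a i x) + s i (s i x) = x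
  sq_b : ∀ i x, b i (b i x) + t i (t i x) = x
  comm_as : ∀ i x, s i (a i x) = a i (s i x)
  comm_bt : ∀ i x, t i (b i x) = b i (t i x)
  comm_ab : ∀ i j x, b j (a i x) = a i (b j x)
  comm_at : ∀ i j x, t j (a i x) = a i (t j x)
  comm_sb : ∀ i j x, b j (s i x) = s i (b j x)
  comm_st : ∀ i j x, t j (s i x) = s i (t j x)

/-- The matrix `(a, s; s, -a)` acting on pairs. -/
def dilate {F : Type*} [AddCommGroup F] [Module ℝ F] (a s : Module.End ℝ F) :
    Module.End ℝ (F × F) :=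
  LinearMap.prod (a ∘ₗ LinearMap.fst ℝ F F + s ∘ₗ LinearMap.snd ℝ F F)
    (s ∘ₗ LinearMap.fst ℝ F F - a ∘ₗ LinearMap.snd ℝ F F)

theorem dilate_apply {F : Type*} [AddCommGroup F] [Module ℝ F] (a s : Module.End ℝ F)
    (z : F × F) : dilate a s z = (a z.1 + s z.2, s z.1 - a z.2) := rfl

/-- The direct sum of two copies of a bilinear form. -/
def doubleForm {F : Type*} [AddCommGroup F] [Module ℝ F] (β : LinearMap.BilinForm ℝ F) :
    LinearMap.BilinForm ℝ (F × F) :=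
  β.compl₁₂ (LinearMap.fst ℝ F F) (LinearMap.fst ℝ F F)
    + β.compl₁₂ (LinearMap.snd ℝ F F) (LinearMap.snd ℝ F F)

theorem doubleForm_apply {F : Type*} [AddCommGroup F] [Module ℝ F] (β : LinearMap.BilinForm ℝ F)
    (z w : F × F) : doubleForm β z w = β z.1 w.1 + β z.2 w.2 := rfl

/-- `(a, s; s, -a)` squares to `a² + s²` because `a` and `s` commute. Alice's ancilla is the outer
pair and Bob's the inner one, so the dilations of different parties still commute. -/
theorem IsContractionPair.isInvolutionPair_dilate {s t : Fin 2 → Module.End ℝ E}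
    (h : IsContractionPair β a b s t) :
    IsInvolutionPair (doubleForm (doubleForm β))
      (fun i => dilate ((a i).prodMap (a i)) ((s i).prodMap (s i)))
      (fun i => (dilate (b i) (t i)).prodMap (dilate (b i) (t i))) where
  symm_a i x y := by
    simp only [doubleForm_apply, dilate_apply, LinearMap.prodMap_apply, map_add, map_sub,
      LinearMap.add_apply, LinearMap.sub_apply, Prod.fst_add, Prod.snd_add, Prod.fst_sub,
      Prod.snd_sub, h.symm_a, h.symm_s]
    ring
  symm_b i x y := by
    simp only [doubleForm_apply, dilate_apply, LinearMap.prodMap_apply, map_add, map_sub,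
      LinearMap.add_apply, LinearMap.sub_apply, h.symm_b, h.symm_t]
    ring
  sq_a i x := by
    have e1 := h.sq_a i x.1.1
    have e2 := h.sq_a i x.1.2
    have e3 := h.sq_a i x.2.1
    have e4 := h.sq_a i x.2.2
    ext <;> simp only [dilate_apply, LinearMap.prodMap_apply, map_add, map_sub, Prod.fst_add,
      Prod.snd_add, Prod.fst_sub, Prod.snd_sub, h.comm_as]
    · refine Eq.trans ?_ e1; abel
    · refine Eq.trans ?_ e2; abel
    · refine Eq.trans ?_ e3; abel
    · refine Eq.trans ?_ e4; abel
  sq_b i x := by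
    have e1 := h.sq_b i x.1.1
    have e2 := h.sq_b i x.1.2
    have e3 := h.sq_b i x.2.1
    have e4 := h.sq_b i x.2.2
    ext <;> simp only [dilate_apply, LinearMap.prodMap_apply, map_add, map_sub, h.comm_bt]
    · refine Eq.trans ?_ e1; abel
    · refine Eq.trans ?_ e2; abel
    · refine Eq.trans ?_ e3; abel
    · refine Eq.trans ?_ e4; abel
  comm i j x := by
    ext <;> simp only [dilate_apply, LinearMap.prodMap_apply, map_add, map_sub, Prod.fst_add,
      Prod.snd_add, Prod.fst_sub, Prod.snd_sub, h.comm_ab, h.comm_at, h.comm_sb, h.comm_st]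

/-- With both ancillas in their first state, the compression of a product of one dilation per party
is the product of the original contractions, so the Bell value is unchanged. -/
theorem bellVec_dilate {s t : Fin 2 → Module.End ℝ E} (ψ : E) :
    (bellVec (fun i => dilate ((a i).prodMap (a i)) ((s i).prodMap (s i)))
      (fun i => (dilate (b i) (t i)).prodMap (dilate (b i) (t i))) ((ψ, 0), 0)).1.1 =
      bellVec a b ψ := by
  simp [bellVec, dilate_apply]

theorem IsContractionPair.le_bellMax {s t : Fin 2 → Module.End ℝ E}
    (h : IsContractionPair β a b s t) (hβ : ∀ x y, β x y = β y x) (hpos : ∀ x, 0 ≤ β x x)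
    (ψ : E) : β ψ (bellVec a b ψ) ≤ bellMax * β ψ ψ := by
  have hpos' : ∀ x, 0 ≤ doubleForm (doubleForm β) x x := fun x => by
    simp only [doubleForm_apply]
    linarith [hpos x.1.1, hpos x.1.2, hpos x.2.1, hpos x.2.2]
  have key := h.isInvolutionPair_dilate.sq_nullVec_le
    (fun x y => by simp only [doubleForm_apply, hβ x.1.1, hβ x.1.2, hβ x.2.1, hβ x.2.2])
    hpos' ((ψ, 0), 0)
  have h0 := le_trans (mul_nonneg (by norm_num) (Finset.sum_nonneg fun i _ => hpos' _)) key
  simp only [doubleForm_apply, bellVec_dilate, map_zero, LinearMap.zero_apply, Prod.fst_zero,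
    Prod.snd_zero, add_zero] at h0
  linarith

/-! ### The case of equality -/

/-- The relations that hold in an optimal strategy. -/
structure OptimalRelations (a b : Fin 2 → Module.End ℝ E) (ψ : E) : Prop where
  sq_a : ∀ i, a i (a i ψ) = ψ
  sq_b : ∀ i, b i (b i ψ) = ψ
  null : ∀ i, nullVec a b ψ i = 0

/-- In the dilation all four components of each null expression vanish. The first component gives
the relations for the original operators. The others would make `s 0 ψ` and `t 0 ψ` eigenvectors of
the contractions `b 0` and `a 0` with eigenvalue of modulus above one, so they vanish and the
observables square to one on `ψ`. -/
theorem IsContractionPair.optimalRelations {s t : Fin 2 → Module.End ℝ E}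
    (h : IsContractionPair β a b s t) (hβ : ∀ x y, β x y = β y x) (hpos : ∀ x, 0 ≤ β x x)
    (hdef : ∀ x, β x x = 0 → x = 0) {ψ : E} (hψ : β ψ (bellVec a b ψ) = bellMax * β ψ ψ) :
    OptimalRelations a b ψ := by
  have hpos' : ∀ x, 0 ≤ doubleForm (doubleForm β) x x := fun x => by
    simp only [doubleForm_apply]
    linarith [hpos x.1.1, hpos x.1.2, hpos x.2.1, hpos x.2.2]
  have hdef' : ∀ x, doubleForm (doubleForm β) x x = 0 → x = 0 := fun x hx => by
    simp only [doubleForm_apply] at hx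
    have h1 := hpos x.1.1
    have h2 := hpos x.1.2
    have h3 := hpos x.2.1
    have h4 := hpos x.2.2
    ext
    · exact hdef _ (by linarith)
    · exact hdef _ (by linarith)
    · exact hdef _ (by linarith)
    · exact hdef _ (by linarith)
  have key := h.isInvolutionPair_dilate.sq_nullVec_le
    (fun x y => by simp only [doubleForm_apply, hβ x.1.1, hβ x.1.2, hβ x.2.1, hβ x.2.2])
    hpos' ((ψ, 0), 0)
  have hzero : doubleForm (doubleForm β) ((ψ, 0), 0) (bellVec
      (fun i => dilate ((a i).prodMap (a i)) ((s i).prodMap (s i)))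
      (fun i => (dilate (b i) (t i)).prodMap (dilate (b i) (t i))) ((ψ, 0), 0)) =
      bellMax * doubleForm (doubleForm β) ((ψ, 0), 0) ((ψ, 0), 0) := by
    simp only [doubleForm_apply, bellVec_dilate, map_zero, LinearMap.zero_apply, Prod.fst_zero,
      Prod.snd_zero, add_zero, hψ]
  rw [hzero, sub_self] at key
  have hnull : ∀ i, nullVec (fun i => dilate ((a i).prodMap (a i)) ((s i).prodMap (s i)))
      (fun i => (dilate (b i) (t i)).prodMap (dilate (b i) (t i))) ((ψ, 0), 0) i = 0 := by
    intro i
    refine hdef' _ (le_antisymm ?_ (hpos' _))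
    refine le_trans (Finset.single_le_sum (f := fun i => doubleForm (doubleForm β)
      (nullVec _ _ _ i) (nullVec _ _ _ i)) (fun i _ => hpos' _) (Finset.mem_univ i)) ?_
    linarith
  have n0 := hnull 0
  have n1 := hnull 1
  have n2 := hnull 2
  have n3 := hnull 3
  have n4 := hnull 4
  simp only [nullVec, Matrix.cons_val, dilate_apply, LinearMap.prodMap_apply, map_zero, add_zero,
    sub_zero, Prod.mk_zero_zero, zero_sub, zero_add, Prod.ext_iff, Prod.fst_add, Prod.snd_add,
    Prod.fst_sub, Prod.snd_sub, Prod.smul_fst, Prod.smul_snd, Prod.fst_zero, Prod.snd_zero,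
    smul_zero] at n0 n1 n2 n3 n4
  have t1 := tanSq_gt
  have t2 := tanSq_lt
  set k₁ := 7 / 5 - 3 / 5 * τ + 2 / 5 * τ ^ 2 with hk₁
  set k₂ := 2 / 5 - 3 / 5 * τ + 1 / 15 * τ ^ 2 with hk₂
  set d := τ ^ 2 - τ with hd
  -- This is the modulus of those eigenvalues: the fourth null expression gives `s 1 ψ = -d • s 0
  -- ψ`, and inserting it into the first gives `b 0 (s 0 ψ) = -(k₁ - k₂ d) • s 0 ψ`.
  have hκ : 1 < k₁ - k₂ * d := by
    have : 0 ≤ (-k₂) * d := mul_nonneg (by rw [hk₂]; nlinarith) (by rw [hd]; nlinarith)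
    have : 1 < k₁ := by rw [hk₁]; nlinarith
    linarith
  have eigen : ∀ {f g : Module.End ℝ E} {x : E} {κ : ℝ}, f (f x) + g (g x) = x → 1 < κ ^ 2 →
      f x = κ • x → g x = 0 → x = 0 := by
    intro f g x κ h1 h2 h3 h4
    rw [h4, h3, map_smul, h3, map_zero, add_zero, smul_smul, ← sub_eq_zero] at h1
    have : (κ ^ 2 - 1) • x = 0 := by rw [← h1]; module
    exact (smul_eq_zero.1 this).resolve_left (by linarith)
  have hs0 : s 0 ψ = 0 := by
    refine eigen (κ := -(k₁ - k₂ * d)) (h.sq_b 0 (s 0 ψ)) (by nlinarith) ?_ ?_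
    · rw [h.comm_sb, ← sub_eq_zero]
      linear_combination (norm := module) n0.2.1 - k₂ • n3.2.1
    · rw [h.comm_st, n0.2.2]
  have ht0 : t 0 ψ = 0 := by
    refine eigen (κ := k₁ - k₂ * d) (h.sq_a 0 (t 0 ψ)) (by nlinarith) ?_ ?_
    · rw [← sub_eq_zero]
      linear_combination (norm := module) n0.1.2 + k₂ • n3.1.2
    · rw [n0.2.2]
  have hs1 : s 1 ψ = 0 := by simpa [hs0] using n3.2.1
  have ht1 : t 1 ψ = 0 := by simpa [ht0] using n3.1.2
  refine ⟨fun i => ?_, fun i => ?_, fun i => ?_⟩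
  · have e := h.sq_a i ψ
    fin_cases i <;> simpa [hs0, hs1] using e
  · have e := h.sq_b i ψ
    fin_cases i <;> simpa [ht0, ht1] using e
  · fin_cases i
    · exact n0.1.1
    · exact n1.1.1
    · exact n2.1.1
    · exact n3.1.1
    · exact n4.1.1

/-- The symmetry of the game under exchange of the parties; it transfers to Bob whatever is derived
for Alice. -/
theorem OptimalRelations.swap {ψ : E} (h : OptimalRelations a b ψ)
    (hab : ∀ i j x, b j (a i x) = a i (b j x)) :
    OptimalRelations ![-b 0, b 1] ![-a 0, a 1] ψ := by
  refine ⟨fun i => ?_, fun i => ?_, fun i => ?_⟩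
  · fin_cases i <;> simp [h.sq_b]
  · fin_cases i <;> simp [h.sq_a]
  · have e := h.null
    have e0 := e 0
    have e1 := e 1
    have e2 := e 2
    have e3 := e 3
    have e4 := e 4
    simp only [nullVec, Matrix.cons_val] at e0 e1 e2 e3 e4
    fin_cases i <;>
      simp only [nullVec, Matrix.cons_val, LinearMap.neg_apply, map_neg, neg_neg, hab, Fin.zero_eta,
        Fin.mk_one, Fin.reduceFinMk]
    · linear_combination (norm := module) e0
    · linear_combination (norm := module) e1
    · linear_combination (norm := module) e2
    · linear_combination (norm := module) -e3
    · linear_combination (norm := module) -e4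

/-- The difference of the two sides is a combination of null expressions. Thus an optimal state is
an exact eigenvector, not only a maximiser of the expectation. -/
theorem OptimalRelations.bellVec_eq {ψ : E} (h : OptimalRelations a b ψ) :
    bellVec a b ψ = bellMax • ψ := by
  have e : bellVec a b ψ - bellMax • ψ =
      (2 : ℝ) • nullVec a b ψ 0 + nullVec a b ψ 1 + (2 : ℝ) • nullVec a b ψ 2 := by
    simp only [nullVec, Matrix.cons_val, bellVec, bellMax]
    module
  rw [← sub_eq_zero, e, h.null, h.null, h.null]
  simp

/-- Applying `a 0` and `a 1` to the fourth null expression produces the anticommutator together with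
products of one operator of each party. The first three null expressions eliminate these products,
and the remaining terms collapse modulo the cubic. -/
theorem OptimalRelations.anticomm {ψ : E} (h : OptimalRelations a b ψ) :
    a 0 (a 1 ψ) + a 1 (a 0 ψ) = (2 * Real.cos alphaOpt) • ψ := by
  have hd : τ ^ 2 - τ ≠ 0 := by nlinarith [tanSq_gt]
  have e : (τ ^ 2 - τ) • (a 0 (a 1 ψ) + a 1 (a 0 ψ) - (2 * Real.cos alphaOpt) • ψ) =
      (τ ^ 2 - τ) • a 0 (nullVec a b ψ 3) + a 1 (nullVec a b ψ 3) + nullVec a b ψ 1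
        + (τ ^ 2 - τ) • nullVec a b ψ 2 - (τ ^ 2 - τ) ^ 2 • nullVec a b ψ 0 := by
    simp only [nullVec, Matrix.cons_val, map_add, map_sub, map_smul, h.sq_a, cos_alphaOpt]
    match_scalars <;> grind [tanSq_cubic]
  rw [h.null, h.null, h.null, h.null] at e
  simp only [map_zero, smul_zero, add_zero, sub_zero, smul_eq_zero, hd, false_or] at e
  exact sub_eq_zero.1 e

/-- What commutes with `b` and annihilates an optimal `ψ` annihilates `a ψ`. -/
theorem OptimalRelations.map_eq_zero {ψ : E} (h : OptimalRelations a b ψ)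
    (hab : ∀ i j x, b j (a i x) = a i (b j x)) {q : Module.End ℝ E}
    (hq : ∀ j x, q (b j x) = b j (q x)) (hψ : q ψ = 0) (i : Fin 2) : q (a i ψ) = 0 := by
  have t1 := tanSq_gt
  have t2 := tanSq_lt
  have e0 := congrArg q (h.null 0)
  have e3 := congrArg q (h.null 3)
  have ee : b 0 (b 0 (q (a 0 ψ))) = q (a 0 ψ) := by
    rw [← hq, ← hq, hab, hab, h.sq_b]
  simp only [nullVec, Matrix.cons_val, ← hab, map_add, map_sub, map_smul, hq, hψ, map_zero, sub_zero,
    add_zero, zero_add, smul_zero] at e0 e3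
  set k₁ := 7 / 5 - 3 / 5 * τ + 2 / 5 * τ ^ 2 with hk₁
  set k₂ := 2 / 5 - 3 / 5 * τ + 1 / 15 * τ ^ 2 with hk₂
  set d := τ ^ 2 - τ with hd
  have hκ : 1 < k₁ - k₂ * d := by
    have : 0 ≤ (-k₂) * d := mul_nonneg (by rw [hk₂]; nlinarith) (by rw [hd]; nlinarith)
    have : 1 < k₁ := by rw [hk₁]; nlinarith
    linarith
  -- The same eigenvalue argument: `b 0` scales `q (a 0 ψ)` by a number of modulus above one, while
  -- its square fixes that vector.
  have e4 : b 0 (q (a 0 ψ)) = (-(k₁ - k₂ * d)) • q (a 0 ψ) := by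
    rw [← sub_eq_zero]
    linear_combination (norm := module) e0 - k₂ • e3
  have e5 : q (a 0 ψ) = 0 := by
    rw [e4, map_smul, e4, smul_smul, ← sub_eq_zero] at ee
    have : ((k₁ - k₂ * d) ^ 2 - 1) • q (a 0 ψ) = 0 := by rw [← ee]; module
    exact (smul_eq_zero.1 this).resolve_left (by nlinarith)
  fin_cases i
  · exact e5
  · simpa [e5] using e3

end Certificate

end

end NonlocalGame

namespace NonlocalGame

open Matrix
open scoped Kronecker ComplexOrder

noncomputable section

local notation "τ" => tanSq

/-! ### Correlations of optimal states -/

section Values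

/-- Pairing the null relations with `ψ`, `a₀ψ`, `b₀ψ`, `a₁ψ`, `a₀b₀ψ` gives a linear system over
`ℚ(τ)`. Here `N = ⟨ψ, ψ⟩`, `xij = ⟨aᵢbⱼ⟩`, `p = ⟨a₀a₁⟩`, `q = ⟨b₀b₁⟩`, `y = ⟨a₀a₁b₀⟩`, `z =
⟨a₀b₀b₁⟩`; the last four are fixed by the anticommutators. -/
theorem optimal_values_of_linear_system {N xa0 xa1 xb0 xb1 x00 x01 x10 x11 p q y z : ℝ}
    (hp : p + p = 2 * (1 / 3 - 2 * τ / 3 + 2 * τ ^ 2 / 9) * N)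
    (hq : q + q = -(2 * (1 / 3 - 2 * τ / 3 + 2 * τ ^ 2 / 9)) * N)
    (hz : z + z = -(2 * (1 / 3 - 2 * τ / 3 + 2 * τ ^ 2 / 9)) * xa0)
    (hy : y + y = 2 * (1 / 3 - 2 * τ / 3 + 2 * τ ^ 2 / 9) * xb0)
    (n3 : (τ ^ 2 - τ) * (xa0 + xb0) + (xa1 - xb1) = 0)
    (f5 : (-7 / 15 + 8 / 15 * τ - 26 / 45 * τ ^ 2) * x00
      + (7 / 5 - 3 / 5 * τ + 2 / 5 * τ ^ 2) * (xb0 - xa0)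
      + (2 / 5 - 3 / 5 * τ + 1 / 15 * τ ^ 2) * (y + z) + N = 0)
    (n0 : (-7 / 15 + 8 / 15 * τ - 26 / 45 * τ ^ 2) * N
      + (7 / 5 - 3 / 5 * τ + 2 / 5 * τ ^ 2) * (xa0 - xb0)
      + (2 / 5 - 3 / 5 * τ + 1 / 15 * τ ^ 2) * (xa1 + xb1) + x00 = 0)
    (f1 : (τ ^ 2 - τ) * (N + x00) + (p - x01) = 0)
    (f2 : (τ ^ 2 - τ) * (x00 + N) + (x10 - q) = 0)
    (n4 : (-1 + τ - 1 / 3 * τ ^ 2) * (xa0 + xb0) + (x01 + x10) = 0)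
    (n1 : (7 / 15 - 8 / 15 * τ - 4 / 45 * τ ^ 2) * N
      + (8 / 5 - 2 / 5 * τ + 4 / 15 * τ ^ 2) * (xa0 - xb0)
      + (3 / 5 - 2 / 5 * τ - 2 / 5 * τ ^ 2) * (xa1 + xb1) + x11 = 0)
    (f3 : (τ ^ 2 - τ) * (p + x10) + (N - x11) = 0) :
    xa0 = (-1 / 3 + 2 / 3 * τ - 2 / 9 * τ ^ 2) * N ∧
    xa1 = (65 / 87 - 52 / 87 * τ + 64 / 261 * τ ^ 2) * N ∧
    xb0 = (1 / 3 - 2 / 3 * τ + 2 / 9 * τ ^ 2) * N ∧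
    xb1 = (65 / 87 - 52 / 87 * τ + 64 / 261 * τ ^ 2) * N ∧
    x00 = (103 / 261 - 152 / 261 * τ + 428 / 783 * τ ^ 2) * N ∧
    x01 = (59 / 261 - 82 / 261 * τ + 382 / 783 * τ ^ 2) * N ∧
    x10 = -(59 / 261 - 82 / 261 * τ + 382 / 783 * τ ^ 2) * N ∧
    x11 = (-223 / 261 + 248 / 261 * τ + 16 / 783 * τ ^ 2) * N := by
  have hcub := tanSq_cubic
  have hneg : -1 + τ - 1 / 3 * τ ^ 2 ≠ 0 := by
    have := sq_nonneg (τ - 3 / 2)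
    apply ne_of_lt
    linarith
  obtain rfl : p = (1 / 3 - 2 * τ / 3 + 2 * τ ^ 2 / 9) * N := by linear_combination hp / 2
  obtain rfl : q = -(1 / 3 - 2 * τ / 3 + 2 * τ ^ 2 / 9) * N := by linear_combination hq / 2
  obtain rfl : y = (1 / 3 - 2 * τ / 3 + 2 * τ ^ 2 / 9) * xb0 := by linear_combination hy / 2
  obtain rfl : z = -(1 / 3 - 2 * τ / 3 + 2 * τ ^ 2 / 9) * xa0 := by linear_combination hz / 2
  clear hp hq hy hz
  obtain rfl : x10 = -x01 := by linear_combination f2 - f1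
  have hb0 : xb0 = -xa0 := by
    have : (-1 + τ - 1 / 3 * τ ^ 2) * (xa0 + xb0) = 0 := by linear_combination n4
    linear_combination (mul_eq_zero.1 this).resolve_left hneg
  subst hb0
  obtain rfl : xb1 = xa1 := by linear_combination -n3
  have h01 : x01 = (τ ^ 2 - τ) * (N + x00) + (1 / 3 - 2 * τ / 3 + 2 * τ ^ 2 / 9) * N := by
    linear_combination -f1
  have h11 : x11 = N + (τ ^ 2 - τ) * ((1 / 3 - 2 * τ / 3 + 2 * τ ^ 2 / 9) * N - x01) := by
    linear_combination -f3
  have ha0 : xa0 = (-1 / 3 + 2 / 3 * τ - 2 / 9 * τ ^ 2) * N := by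
    subst h11 h01
    -- Three unknowns remain: `xa0`, `xb1`, `x00`. The multipliers here and below are the rows of
    -- the inverse matrix modulo the cubic.
    linear_combination (norm := skip) (-1 / 2 + 1 / 6 * τ - 1 / 12 * τ ^ 2) * n0
      + (1 / 4 - 1 / 6 * τ + 1 / 12 * τ ^ 2) * n1 + (3 / 4 - 5 / 6 * τ - 1 / 12 * τ ^ 2) * f5
    clear n0 n1 f5 n3 n4 f1 f2 f3
    grind
  have h00 : x00 = (103 / 261 - 152 / 261 * τ + 428 / 783 * τ ^ 2) * N := by
    subst h11 h01
    linear_combination (norm := skip) (1 - 1 / 6 * τ + 1 / 3 * τ ^ 2) * n0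
      + (-1 / 2 + 1 / 6 * τ - 1 / 6 * τ ^ 2) * n1 + (19 / 58 - 5 / 174 * τ + 37 / 174 * τ ^ 2) * f5
    clear n0 n1 f5 n3 n4 f1 f2 f3
    grind
  have ha1 : xb1 = (65 / 87 - 52 / 87 * τ + 64 / 261 * τ ^ 2) * N := by
    subst h11 h01
    linear_combination (norm := skip) (-1 + 2 / 3 * τ - 7 / 12 * τ ^ 2) * n0
      + (-1 / 4 + 1 / 6 * τ - 1 / 12 * τ ^ 2) * n1
      + (-193 / 116 + 52 / 87 * τ - 95 / 348 * τ ^ 2) * f5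
    clear n0 n1 f5 n3 n4 f1 f2 f3
    grind
  have e01 : x01 = (59 / 261 - 82 / 261 * τ + 382 / 783 * τ ^ 2) * N := by
    rw [h01, h00]
    clear n0 n1 f5 n3 n4 f1 f2 f3 h01 h11
    grind
  have e11 : x11 = (-223 / 261 + 248 / 261 * τ + 16 / 783 * τ ^ 2) * N := by
    rw [h11, e01]
    clear n0 n1 f5 n3 n4 f1 f2 f3 h01 h11
    grind
  refine ⟨ha0, ha1, ?_, ha1, h00, e01, ?_, e11⟩
  · rw [ha0]; ring
  · rw [e01]; ring


variable {E : Type*} [AddCommGroup E] [Module ℝ E] {β : LinearMap.BilinForm ℝ E}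
  {a b : Fin 2 → Module.End ℝ E}

/-- The correlations of an optimal strategy. -/
structure OptimalValues (β : LinearMap.BilinForm ℝ E) (a b : Fin 2 → Module.End ℝ E) (ψ : E) :
    Prop where
  a0 : β ψ (a 0 ψ) = (-1 / 3 + 2 / 3 * τ - 2 / 9 * τ ^ 2) * β ψ ψ
  a1 : β ψ (a 1 ψ) = (65 / 87 - 52 / 87 * τ + 64 / 261 * τ ^ 2) * β ψ ψ
  b0 : β ψ (b 0 ψ) = (1 / 3 - 2 / 3 * τ + 2 / 9 * τ ^ 2) * β ψ ψ
  b1 : β ψ (b 1 ψ) = (65 / 87 - 52 / 87 * τ + 64 / 261 * τ ^ 2) * β ψ ψ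
  a0b0 : β ψ (a 0 (b 0 ψ)) = (103 / 261 - 152 / 261 * τ + 428 / 783 * τ ^ 2) * β ψ ψ
  a0b1 : β ψ (a 0 (b 1 ψ)) = (59 / 261 - 82 / 261 * τ + 382 / 783 * τ ^ 2) * β ψ ψ
  a1b0 : β ψ (a 1 (b 0 ψ)) = -(59 / 261 - 82 / 261 * τ + 382 / 783 * τ ^ 2) * β ψ ψ
  a1b1 : β ψ (a 1 (b 1 ψ)) = (-223 / 261 + 248 / 261 * τ + 16 / 783 * τ ^ 2) * β ψ ψ

theorem OptimalRelations.values {ψ : E} (h : OptimalRelations a b ψ)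
    (hβ : ∀ x y, β x y = β y x) (sa : ∀ i x y, β (a i x) y = β x (a i y))
    (sb : ∀ i x y, β (b i x) y = β x (b i y)) (hab : ∀ i j x, b j (a i x) = a i (b j x)) :
    OptimalValues β a b ψ := by
  have ca : ∀ x, β x (a 0 (a 1 ψ)) + β x (a 1 (a 0 ψ)) = 2 * Real.cos alphaOpt * β x ψ := fun x => by
    rw [← map_add, h.anticomm, map_smul, smul_eq_mul]
  have cb : ∀ x, β x (b 0 (b 1 ψ)) + β x (b 1 (b 0 ψ)) = -(2 * Real.cos alphaOpt) * β x ψ :=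
    fun x => by
      have := congrArg (β x) (h.swap hab).anticomm
      simp only [Matrix.cons_val, LinearMap.neg_apply, map_neg, map_add, map_smul,
        smul_eq_mul] at this
      linarith
  have ca0 := ca ψ
  have cb0 := cb ψ
  have ca1 := ca (b 0 ψ)
  have cb1 := cb (a 0 ψ)
  have n0 := congrArg (β ψ) (h.null 0)
  have n1 := congrArg (β ψ) (h.null 1)
  have n3 := congrArg (β ψ) (h.null 3)
  have n4 := congrArg (β ψ) (h.null 4)
  have f1 := congrArg (β (a 0 ψ)) (h.null 3)
  have f2 := congrArg (β (b 0 ψ)) (h.null 3)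
  have f3 := congrArg (β (a 1 ψ)) (h.null 3)
  have f5 := congrArg (β (a 0 (b 0 ψ))) (h.null 0)
  have r0 : β ψ (a 1 (a 0 ψ)) = β ψ (a 0 (a 1 ψ)) := by rw [← sa, ← sa, hβ]
  have r1 : β ψ (b 1 (b 0 ψ)) = β ψ (b 0 (b 1 ψ)) := by rw [← sb, ← sb, hβ]
  have r2 : β ψ (a 1 (a 0 (b 0 ψ))) = β ψ (a 0 (a 1 (b 0 ψ))) := by
    rw [← sa, ← sa, hβ, sb, hab, hab]
  have r3 : β ψ (a 0 (b 1 (b 0 ψ))) = β ψ (a 0 (b 0 (b 1 ψ))) := by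
    rw [← sa, ← sb, ← sb, hβ, hab, hab]
  have q0 : ∀ x, β ψ (a 0 (a 0 x)) = β ψ x := fun x => by rw [← sa, ← sa, h.sq_a]
  have q1 : ∀ x, β ψ (a 1 (a 1 x)) = β ψ x := fun x => by rw [← sa, ← sa, h.sq_a]
  simp only [nullVec, Matrix.cons_val, map_add, map_sub, map_smul, map_zero, smul_eq_mul, sa, sb,
    hab, q0, q1, r0, r1, r2, r3, h.sq_b, cos_alphaOpt] at ca0 cb0 ca1 cb1 n0 n1 n3 n4 f1 f2 f3 f5
  obtain ⟨h1, h2, h3, h4, h5, h6, h7, h8⟩ :=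
    optimal_values_of_linear_system ca0 cb0 cb1 ca1 n3 f5 n0 f1 f2 n4 n1 f3
  exact ⟨h1, h2, h3, h4, h5, h6, h7, h8⟩

end Values

end

end NonlocalGame

namespace NonlocalGame

open Matrix
open scoped Kronecker ComplexOrder

noncomputable section

/-! ### Functions of Hermitian matrices -/

section FunctionalCalculus

variable {n : Type*} [Fintype n] [DecidableEq n]

theorem continuousOn_spectrum (A : Matrix n n ℂ) (f : ℝ → ℝ) : ContinuousOn f (spectrum ℝ A) :=
  (Matrix.finite_real_spectrum (A := A)).continuousOn f

open scoped MatrixOrder in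
theorem spectrum_nonneg {A : Matrix n n ℂ} (hA : A.PosSemidef) {x : ℝ} (hx : x ∈ spectrum ℝ A) :
    0 ≤ x :=
  spectrum_nonneg_of_nonneg (Matrix.nonneg_iff_posSemidef.2 hA) hx

/-- The projection onto the range of a Hermitian matrix. -/
theorem exists_supportProjection {ρ : Matrix n n ℂ} (h : ρ.IsHermitian) :
    ∃ Q P : Matrix n n ℂ, Q.IsHermitian ∧ Q * Q = Q ∧ Q * ρ = ρ ∧ Q = ρ * P := by
  have hs : IsSelfAdjoint ρ := h
  have hc := continuousOn_spectrum ρ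
  -- As `0⁻¹ = 0`, the function `x * x⁻¹` is the indicator of `x ≠ 0`, and `P` is the
  -- pseudo-inverse.
  refine ⟨cfc (fun x : ℝ => x * x⁻¹) ρ, cfc (fun x : ℝ => x⁻¹) ρ, cfc_predicate _ ρ, ?_, ?_, ?_⟩
  · rw [← cfc_mul _ _ ρ (hc _) (hc _)]
    congr 1; ext x
    by_cases hx : x = 0 <;> simp [hx]
  · nth_rewrite 2 [← cfc_id' ℝ ρ]
    rw [← cfc_mul _ _ ρ (hc _) (hc _)]
    nth_rewrite 2 [← cfc_id' ℝ ρ]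
    congr 1; ext x
    by_cases hx : x = 0 <;> simp [hx]
  · rw [cfc_mul _ _ ρ (hc _) (hc _), cfc_id' ℝ ρ]

theorem exists_hermitian_sqrt {ρ : Matrix n n ℂ} (h : ρ.PosSemidef) :
    ∃ R : Matrix n n ℂ, R.IsHermitian ∧ R * R = ρ := by
  have hs : IsSelfAdjoint ρ := h.1
  have hc := continuousOn_spectrum ρ
  refine ⟨cfc Real.sqrt ρ, cfc_predicate _ ρ, ?_⟩
  rw [← cfc_mul _ _ ρ (hc _) (hc _)]
  nth_rewrite 2 [← cfc_id' ℝ ρ]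
  exact cfc_congr fun x hx => Real.mul_self_sqrt (spectrum_nonneg h hx)

/-- The square root of `1 - a²` for the observable `a = A - B` of a two-outcome measurement. -/
theorem exists_complement {A B : Matrix n n ℂ} (hA : A.PosSemidef) (hB : B.PosSemidef)
    (hAB : A + B = 1) :
    ∃ s : Matrix n n ℂ, s.IsHermitian ∧ (A - B) * (A - B) + s * s = 1 ∧
      s * (A - B) = (A - B) * s := by
  have hs : IsSelfAdjoint A := hA.1
  have hc := continuousOn_spectrum A
  have hB' : B = 1 - A := by rw [← hAB]; abel
  have hid : A - B = cfc (fun x : ℝ => 2 * x - 1) A := by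
    rw [cfc_sub _ _ A (hc _) (hc _), cfc_const_mul _ _ A (hc _), cfc_id' ℝ A, cfc_const_one ℝ A, hB']
    module
  -- Positivity of `B = 1 - A` confines the spectrum of `A` to `[0, 1]`, where `1 - (2x - 1)²` is
  -- nonnegative.
  have hle : ∀ x ∈ spectrum ℝ A, x ≤ 1 := fun x hx => by
    have : 1 - x ∈ spectrum ℝ B := by
      rw [hB', ← map_one (algebraMap ℝ (Matrix n n ℂ)), ← spectrum.singleton_sub_eq]
      exact ⟨1, rfl, x, hx, rfl⟩
    linarith [spectrum_nonneg hB this]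
  refine ⟨cfc (fun x : ℝ => Real.sqrt (1 - (2 * x - 1) ^ 2)) A, cfc_predicate _ A, ?_, ?_⟩
  · rw [hid, ← cfc_mul _ _ A (hc _) (hc _), ← cfc_mul _ _ A (hc _) (hc _),
      ← cfc_add _ _ _ (hc _) (hc _), ← cfc_const_one ℝ A]
    refine cfc_congr fun x hx => ?_
    have h0 := spectrum_nonneg hA hx
    have h1 := hle x hx
    rw [Real.mul_self_sqrt (by nlinarith)]
    ring
  · rw [hid]
    exact cfc_commute_cfc _ _ _

end FunctionalCalculus

/-! ### The trace form -/

section TraceForm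

variable {n m : Type*} [Fintype n] [Fintype m]

/-- The real part of the Hilbert–Schmidt inner product. -/
def traceForm (n m : Type*) [Fintype n] [Fintype m] : LinearMap.BilinForm ℝ (Matrix n m ℂ) :=
  LinearMap.mk₂ ℝ (fun X Y => (Xᴴ * Y).trace.re)
    (fun X X' Y => by simp [Matrix.add_mul])
    (fun c X Y => by simp)
    (fun X Y Y' => by simp [Matrix.mul_add])
    (fun c X Y => by simp)

theorem traceForm_apply (X Y : Matrix n m ℂ) : traceForm n m X Y = (Xᴴ * Y).trace.re := rfl

theorem traceForm_symm (X Y : Matrix n m ℂ) : traceForm n m X Y = traceForm n m Y X := by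
  have : Xᴴ * Y = (Yᴴ * X)ᴴ := by simp
  rw [traceForm_apply, traceForm_apply, this, Matrix.trace_conjTranspose]
  simp

theorem trace_conjTranspose_mul_self_nonneg (X : Matrix n m ℂ) : 0 ≤ (Xᴴ * X).trace :=
  (Matrix.posSemidef_conjTranspose_mul_self X).trace_nonneg

theorem traceForm_self_nonneg (X : Matrix n m ℂ) : 0 ≤ traceForm n m X X :=
  (Complex.le_def.1 (trace_conjTranspose_mul_self_nonneg X)).1

theorem eq_zero_of_traceForm_self {X : Matrix n m ℂ} (h : traceForm n m X X = 0) : X = 0 := by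
  rw [← Matrix.trace_conjTranspose_mul_self_eq_zero_iff]
  apply Complex.ext h
  exact (Complex.le_def.1 (trace_conjTranspose_mul_self_nonneg X)).2.symm

theorem traceForm_mul_left {M : Matrix n n ℂ} (hM : M.IsHermitian) (X Y : Matrix n m ℂ) :
    traceForm n m (M * X) Y = traceForm n m X (M * Y) := by
  rw [traceForm_apply, traceForm_apply, Matrix.conjTranspose_mul, hM.eq, Matrix.mul_assoc]

end TraceForm

end

end NonlocalGame

namespace NonlocalGame

open Matrix
open scoped Kronecker ComplexOrder

noncomputable section

local notation "τ" => tanSq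

namespace Strategy

variable {ι κ : Type*} [Fintype ι] [Fintype κ] [DecidableEq ι] [DecidableEq κ] (S : Strategy ι κ)

/-! ### Observables and correlations of a strategy -/

/-- Alice's observable for input `x`. -/
def obsA (x : Fin 2) : Matrix ι ι ℂ := S.A x 0 - S.A x 1

/-- Bob's observable for input `y`, with the sign reversed for `y = 1`. -/
def obsB : Fin 2 → Matrix κ κ ℂ := ![S.B 0 0 - S.B 0 1, S.B 1 1 - S.B 1 0]

theorem A_zero (x : Fin 2) : S.A x 0 = (1 / 2 : ℂ) • (1 + S.obsA x) := by
  rw [← S.A_sum x, Fin.sum_univ_two, obsA]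
  module

theorem A_one (x : Fin 2) : S.A x 1 = (1 / 2 : ℂ) • (1 - S.obsA x) := by
  rw [← S.A_sum x, Fin.sum_univ_two, obsA]
  module

theorem B_zero_zero : S.B 0 0 = (1 / 2 : ℂ) • (1 + S.obsB 0) := by
  rw [← S.B_sum 0, Fin.sum_univ_two, obsB, Matrix.cons_val_zero]
  module

theorem B_zero_one : S.B 0 1 = (1 / 2 : ℂ) • (1 - S.obsB 0) := by
  rw [← S.B_sum 0, Fin.sum_univ_two, obsB, Matrix.cons_val_zero]
  module

theorem B_one_zero : S.B 1 0 = (1 / 2 : ℂ) • (1 - S.obsB 1) := by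
  have h : S.obsB 1 = S.B 1 1 - S.B 1 0 := rfl
  rw [← S.B_sum 1, Fin.sum_univ_two, h]
  module

theorem B_one_one : S.B 1 1 = (1 / 2 : ℂ) • (1 + S.obsB 1) := by
  have h : S.obsB 1 = S.B 1 1 - S.B 1 0 := rfl
  rw [← S.B_sum 1, Fin.sum_univ_two, h]
  module

theorem obsA_isHermitian (x : Fin 2) : (S.obsA x).IsHermitian :=
  (S.A_pos x 0).1.sub (S.A_pos x 1).1

theorem obsB_isHermitian (y : Fin 2) : (S.obsB y).IsHermitian := by
  fin_cases y
  · exact (S.B_pos 0 0).1.sub (S.B_pos 0 1).1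
  · exact (S.B_pos 1 1).1.sub (S.B_pos 1 0).1

theorem exists_complement_obsA (x : Fin 2) : ∃ s : Matrix ι ι ℂ, s.IsHermitian ∧
    S.obsA x * S.obsA x + s * s = 1 ∧ s * S.obsA x = S.obsA x * s :=
  exists_complement (S.A_pos x 0) (S.A_pos x 1) (by rw [← S.A_sum x, Fin.sum_univ_two])

theorem exists_complement_obsB (y : Fin 2) : ∃ s : Matrix κ κ ℂ, s.IsHermitian ∧
    S.obsB y * S.obsB y + s * s = 1 ∧ s * S.obsB y = S.obsB y * s := by
  fin_cases y
  · exact exists_complement (S.B_pos 0 0) (S.B_pos 0 1) (by rw [← S.B_sum 0, Fin.sum_univ_two])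
  · exact exists_complement (S.B_pos 1 1) (S.B_pos 1 0)
      (by rw [← S.B_sum 1, Fin.sum_univ_two, add_comm])

/-- Left multiplication by an operator of Alice. -/
def actA (κ : Type*) [Fintype κ] [DecidableEq κ] (M : Matrix ι ι ℂ) :
    Module.End ℝ (Matrix (ι × κ) (ι × κ) ℂ) :=
  LinearMap.mulLeft ℝ (M ⊗ₖ (1 : Matrix κ κ ℂ))

/-- Left multiplication by an operator of Bob. -/
def actB (ι : Type*) [Fintype ι] [DecidableEq ι] (M : Matrix κ κ ℂ) :
    Module.End ℝ (Matrix (ι × κ) (ι × κ) ℂ) :=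
  LinearMap.mulLeft ℝ ((1 : Matrix ι ι ℂ) ⊗ₖ M)

theorem actA_apply (M : Matrix ι ι ℂ) (X : Matrix (ι × κ) (ι × κ) ℂ) :
    actA κ M X = (M ⊗ₖ (1 : Matrix κ κ ℂ)) * X := rfl

theorem actB_apply (M : Matrix κ κ ℂ) (X : Matrix (ι × κ) (ι × κ) ℂ) :
    actB ι M X = ((1 : Matrix ι ι ℂ) ⊗ₖ M) * X := rfl

theorem actA_actA (M N : Matrix ι ι ℂ) (X : Matrix (ι × κ) (ι × κ) ℂ) :
    actA κ M (actA κ N X) = actA κ (M * N) X := by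
  rw [actA_apply, actA_apply, actA_apply, ← Matrix.mul_assoc, ← Matrix.mul_kronecker_mul, mul_one]

theorem actB_actB (M N : Matrix κ κ ℂ) (X : Matrix (ι × κ) (ι × κ) ℂ) :
    actB ι M (actB ι N X) = actB ι (M * N) X := by
  rw [actB_apply, actB_apply, actB_apply, ← Matrix.mul_assoc, ← Matrix.mul_kronecker_mul, mul_one]

theorem actA_actB (M : Matrix ι ι ℂ) (N : Matrix κ κ ℂ) (X : Matrix (ι × κ) (ι × κ) ℂ) :
    actA κ M (actB ι N X) = (M ⊗ₖ N) * X := by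
  rw [actA_apply, actB_apply, ← Matrix.mul_assoc, ← Matrix.mul_kronecker_mul, mul_one, one_mul]

theorem actB_actA (M : Matrix ι ι ℂ) (N : Matrix κ κ ℂ) (X : Matrix (ι × κ) (ι × κ) ℂ) :
    actB ι N (actA κ M X) = actA κ M (actB ι N X) := by
  rw [actA_actB, actA_apply, actB_apply, ← Matrix.mul_assoc, ← Matrix.mul_kronecker_mul, mul_one,
    one_mul]

theorem actA_mul (M : Matrix ι ι ℂ) (X Y : Matrix (ι × κ) (ι × κ) ℂ) :
    actA κ M (X * Y) = actA κ M X * Y := by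
  rw [actA_apply, actA_apply, Matrix.mul_assoc]

theorem actB_mul (M : Matrix κ κ ℂ) (X Y : Matrix (ι × κ) (ι × κ) ℂ) :
    actB ι M (X * Y) = actB ι M X * Y := by
  rw [actB_apply, actB_apply, Matrix.mul_assoc]

theorem traceForm_actA {M : Matrix ι ι ℂ} (hM : M.IsHermitian) (X Y : Matrix (ι × κ) (ι × κ) ℂ) :
    traceForm _ _ (actA κ M X) Y = traceForm _ _ X (actA κ M Y) :=
  traceForm_mul_left (by rw [IsHermitian, conjTranspose_kronecker, hM.eq, conjTranspose_one]) X Y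

theorem traceForm_actB {M : Matrix κ κ ℂ} (hM : M.IsHermitian) (X Y : Matrix (ι × κ) (ι × κ) ℂ) :
    traceForm _ _ (actB ι M X) Y = traceForm _ _ X (actB ι M Y) :=
  traceForm_mul_left (by rw [IsHermitian, conjTranspose_kronecker, hM.eq, conjTranspose_one]) X Y

theorem actA_one_apply (X : Matrix (ι × κ) (ι × κ) ℂ) : actA κ (1 : Matrix ι ι ℂ) X = X := by
  rw [actA_apply, one_kronecker_one, one_mul]

theorem actB_one_apply (X : Matrix (ι × κ) (ι × κ) ℂ) : actB ι (1 : Matrix κ κ ℂ) X = X := by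
  rw [actB_apply, one_kronecker_one, one_mul]

theorem actA_add_apply (M N : Matrix ι ι ℂ) (X : Matrix (ι × κ) (ι × κ) ℂ) :
    actA κ (M + N) X = actA κ M X + actA κ N X := by
  simp only [actA_apply, add_kronecker, add_mul]

theorem actB_add_apply (M N : Matrix κ κ ℂ) (X : Matrix (ι × κ) (ι × κ) ℂ) :
    actB ι (M + N) X = actB ι M X + actB ι N X := by
  simp only [actB_apply, kronecker_add, add_mul]

theorem exists_isContractionPair : ∃ s t : Fin 2 → Module.End ℝ (Matrix (ι × κ) (ι × κ) ℂ),
    IsContractionPair (traceForm _ _) (fun x => actA κ (S.obsA x)) (fun y => actB ι (S.obsB y))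
      s t := by
  choose s hs hs1 hs2 using S.exists_complement_obsA
  choose t ht ht1 ht2 using S.exists_complement_obsB
  exact ⟨fun x => actA κ (s x), fun y => actB ι (t y),
    { symm_a := fun i => traceForm_actA (S.obsA_isHermitian i)
      symm_b := fun i => traceForm_actB (S.obsB_isHermitian i)
      symm_s := fun i => traceForm_actA (hs i)
      symm_t := fun i => traceForm_actB (ht i)
      sq_a := fun i x => by rw [actA_actA, actA_actA, ← actA_add_apply, hs1, actA_one_apply]
      sq_b := fun i x => by rw [actB_actB, actB_actB, ← actB_add_apply, ht1, actB_one_apply]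
      comm_as := fun i x => by rw [actA_actA, actA_actA, hs2]
      comm_bt := fun i x => by rw [actB_actB, actB_actB, ht2]
      comm_ab := fun i j x => actB_actA _ _ _
      comm_at := fun i j x => actB_actA _ _ _
      comm_sb := fun i j x => actB_actA _ _ _
      comm_st := fun i j x => actB_actA _ _ _ }⟩

/-- The expectation value of the product of an operator of Alice with one of Bob. -/
def corr (M : Matrix ι ι ℂ) (N : Matrix κ κ ℂ) : ℝ := (S.ρ * (M ⊗ₖ N)).trace.re

theorem corr_one_one : S.corr 1 1 = 1 := by
  rw [corr, one_kronecker_one, mul_one, S.density.2, Complex.one_re]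

/-- `R = √ρ` serves as a purification: as a vector for the trace form, with operators acting by left
multiplication, it reproduces the expectations in `ρ`. -/
theorem corr_eq_traceForm {R : Matrix (ι × κ) (ι × κ) ℂ} (hR : R.IsHermitian) (hρ : R * R = S.ρ)
    (M : Matrix ι ι ℂ) (N : Matrix κ κ ℂ) :
    S.corr M N = traceForm _ _ R (actA κ M (actB ι N R)) := by
  rw [corr, actA_actB, traceForm_apply, hR.eq, ← hρ, Matrix.mul_assoc, Matrix.trace_mul_comm,
    Matrix.mul_assoc]

theorem corr_add_left (M M' : Matrix ι ι ℂ) (N : Matrix κ κ ℂ) :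
    S.corr (M + M') N = S.corr M N + S.corr M' N := by
  simp [corr, add_kronecker, mul_add]

theorem corr_sub_left (M M' : Matrix ι ι ℂ) (N : Matrix κ κ ℂ) :
    S.corr (M - M') N = S.corr M N - S.corr M' N := by
  exact eq_sub_of_add_eq (by rw [← corr_add_left, sub_add_cancel])

theorem corr_add_right (M : Matrix ι ι ℂ) (N N' : Matrix κ κ ℂ) :
    S.corr M (N + N') = S.corr M N + S.corr M N' := by
  simp [corr, kronecker_add, mul_add]

theorem corr_sub_right (M : Matrix ι ι ℂ) (N N' : Matrix κ κ ℂ) :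
    S.corr M (N - N') = S.corr M N - S.corr M N' := by
  exact eq_sub_of_add_eq (by rw [← corr_add_right, sub_add_cancel])

theorem corr_half_left (M : Matrix ι ι ℂ) (N : Matrix κ κ ℂ) :
    S.corr ((1 / 2 : ℂ) • M) N = 1 / 2 * S.corr M N := by
  have : (1 / 2 : ℂ) = ((1 / 2 : ℝ) : ℂ) := by push_cast; rfl
  rw [this]
  simp only [corr, smul_kronecker, Matrix.mul_smul, Matrix.trace_smul, smul_eq_mul,
    Complex.re_ofReal_mul]

theorem corr_half_right (M : Matrix ι ι ℂ) (N : Matrix κ κ ℂ) :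
    S.corr M ((1 / 2 : ℂ) • N) = 1 / 2 * S.corr M N := by
  have : (1 / 2 : ℂ) = ((1 / 2 : ℝ) : ℂ) := by push_cast; rfl
  rw [this]
  simp only [corr, kronecker_smul, Matrix.mul_smul, Matrix.trace_smul, smul_eq_mul,
    Complex.re_ofReal_mul]

theorem box_eq_corr (a b x y : Fin 2) : S.box a b x y = S.corr (S.A x a) (S.B y b) := rfl

theorem value_eq_corr : S.value = (7 + (2 * S.corr (S.obsA 0) (S.obsB 0)
    - 2 * S.corr (S.obsA 1) (S.obsB 0) + 2 * S.corr (S.obsA 0) (S.obsB 1)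
    + S.corr (S.obsA 1) (S.obsB 1) + S.corr (S.obsA 1) 1 + S.corr 1 (S.obsB 1))) / 16 := by
  simp only [value, gameValue, Fin.sum_univ_two, V, box_eq_corr, A_zero, A_one, B_zero_zero,
    B_zero_one, B_one_zero, B_one_one, corr_half_left, corr_half_right, corr_add_left,
    corr_sub_left, corr_add_right, corr_sub_right, corr_one_one]
  norm_num [show (1 + 1 : Fin 2) = 0 from rfl]
  ring

theorem value_eq_traceForm {R : Matrix (ι × κ) (ι × κ) ℂ} (hR : R.IsHermitian)
    (hρ : R * R = S.ρ) :
    S.value = (7 + traceForm _ _ R (bellVec (fun x => actA κ (S.obsA x))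
      (fun y => actB ι (S.obsB y)) R)) / 16 := by
  rw [value_eq_corr]
  simp only [S.corr_eq_traceForm hR hρ, bellVec, map_add, map_sub, map_smul, smul_eq_mul,
    actA_one_apply, actB_one_apply]

theorem traceForm_sqrt {R : Matrix (ι × κ) (ι × κ) ℂ} (hR : R.IsHermitian) (hρ : R * R = S.ρ) :
    traceForm _ _ R R = 1 := by
  rw [traceForm_apply, hR.eq, hρ, S.density.2, Complex.one_re]

theorem omegaQ_eq_bellMax : omegaQ = (7 + bellMax) / 16 := by
  rw [omegaQ_eq, bellMax]; ring

theorem value_le : S.value ≤ omegaQ := by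
  obtain ⟨R, hR, hρ⟩ := exists_hermitian_sqrt S.density.1
  obtain ⟨s, t, h⟩ := S.exists_isContractionPair
  have := h.le_bellMax traceForm_symm traceForm_self_nonneg R
  rw [S.traceForm_sqrt hR hρ] at this
  rw [S.value_eq_traceForm hR hρ, omegaQ_eq_bellMax]
  linarith

theorem exists_optimalRelations (hS : S.value = omegaQ) :
    ∃ R : Matrix (ι × κ) (ι × κ) ℂ, R.IsHermitian ∧ R * R = S.ρ ∧
      OptimalRelations (fun x => actA κ (S.obsA x)) (fun y => actB ι (S.obsB y)) R := by
  obtain ⟨R, hR, hρ⟩ := exists_hermitian_sqrt S.density.1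
  obtain ⟨s, t, h⟩ := S.exists_isContractionPair
  refine ⟨R, hR, hρ, h.optimalRelations traceForm_symm traceForm_self_nonneg
    (fun x => eq_zero_of_traceForm_self) ?_⟩
  rw [S.value_eq_traceForm hR hρ, omegaQ_eq_bellMax] at hS
  rw [S.traceForm_sqrt hR hρ]
  linarith

/-- The relations satisfied by the state of an optimal strategy. -/
theorem optimalRelations (hS : S.value = omegaQ) :
    OptimalRelations (fun x => actA κ (S.obsA x)) (fun y => actB ι (S.obsB y)) S.ρ := by
  obtain ⟨R, hR, hρ, h⟩ := S.exists_optimalRelations hS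
  rw [← hρ]
  refine ⟨fun i => ?_, fun i => ?_, fun i => ?_⟩
  · rw [actA_mul, actA_mul, h.sq_a]
  · rw [actB_mul, actB_mul, h.sq_b]
  · have : nullVec (fun x => actA κ (S.obsA x)) (fun y => actB ι (S.obsB y)) (R * R) i =
        nullVec (fun x => actA κ (S.obsA x)) (fun y => actB ι (S.obsB y)) R i * R := by
      fin_cases i <;>
        simp only [nullVec, Matrix.cons_val, actA_mul, actB_mul, Matrix.add_mul, Matrix.sub_mul,
          Matrix.smul_mul, Fin.zero_eta, Fin.mk_one, Fin.reduceFinMk]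
    rw [this, h.null, Matrix.zero_mul]

theorem corr_optimal (hS : S.value = omegaQ) :
    S.corr (S.obsA 0) 1 = -1 / 3 + 2 / 3 * τ - 2 / 9 * τ ^ 2 ∧
    S.corr (S.obsA 1) 1 = 65 / 87 - 52 / 87 * τ + 64 / 261 * τ ^ 2 ∧
    S.corr 1 (S.obsB 0) = 1 / 3 - 2 / 3 * τ + 2 / 9 * τ ^ 2 ∧
    S.corr 1 (S.obsB 1) = 65 / 87 - 52 / 87 * τ + 64 / 261 * τ ^ 2 ∧
    S.corr (S.obsA 0) (S.obsB 0) = 103 / 261 - 152 / 261 * τ + 428 / 783 * τ ^ 2 ∧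
    S.corr (S.obsA 0) (S.obsB 1) = 59 / 261 - 82 / 261 * τ + 382 / 783 * τ ^ 2 ∧
    S.corr (S.obsA 1) (S.obsB 0) = -(59 / 261 - 82 / 261 * τ + 382 / 783 * τ ^ 2) ∧
    S.corr (S.obsA 1) (S.obsB 1) = -223 / 261 + 248 / 261 * τ + 16 / 783 * τ ^ 2 := by
  obtain ⟨R, hR, hρ, h⟩ := S.exists_optimalRelations hS
  obtain ⟨h1, h2, h3, h4, h5, h6, h7, h8⟩ := h.values traceForm_symm
    (fun i => traceForm_actA (S.obsA_isHermitian i))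
    (fun i => traceForm_actB (S.obsB_isHermitian i)) (fun i j x => actB_actA _ _ _)
  rw [S.traceForm_sqrt hR hρ, mul_one] at h1 h2 h3 h4 h5 h6 h7 h8
  simp only [S.corr_eq_traceForm hR hρ, actA_one_apply, actB_one_apply]
  exact ⟨h1, h2, h3, h4, h5, h6, h7, h8⟩

end Strategy

end

end NonlocalGame

namespace NonlocalGame

open Matrix
open scoped Kronecker ComplexOrder

noncomputable section

/-! ### Isometries intertwining the measurements -/

section Isometry

variable {m : ℕ}

/-- The operator `∑ i, e_i ⊗ (F i ⊕ G i)`. -/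
def blockIsometry (F G : Fin 2 → Matrix (Fin m) (Fin m) ℂ) :
    Matrix (Fin 2 × Fin (m + m)) (Fin m) ℂ :=
  Matrix.of fun p j => Sum.elim (fun r => F p.1 r j) (fun r => G p.1 r j) (finSumFinEquiv.symm p.2)

theorem blockIsometry_mul (F G : Fin 2 → Matrix (Fin m) (Fin m) ℂ) (M : Matrix (Fin m) (Fin m) ℂ) :
    blockIsometry F G * M = blockIsometry (fun i => F i * M) (fun i => G i * M) := by
  ext ⟨i, r⟩ j
  obtain ⟨r, rfl⟩ := finSumFinEquiv.surjective r
  cases r <;> simp [blockIsometry, Matrix.mul_apply, -finSumFinEquiv_apply_left,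
    -finSumFinEquiv_apply_right]

theorem kronecker_one_mul_blockIsometry (O : Matrix (Fin 2) (Fin 2) ℂ)
    (F G : Fin 2 → Matrix (Fin m) (Fin m) ℂ) :
    (O ⊗ₖ (1 : Matrix (Fin (m + m)) (Fin (m + m)) ℂ)) * blockIsometry F G =
      blockIsometry (fun i => ∑ j, O i j • F j) (fun i => ∑ j, O i j • G j) := by
  ext ⟨i, r⟩ j
  rw [Matrix.mul_apply, Fintype.sum_prod_type]
  simp only [kroneckerMap_apply, Matrix.one_apply, mul_ite, mul_one, mul_zero, ite_mul, zero_mul,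
    Finset.sum_ite_eq, Finset.mem_univ, if_true]
  obtain ⟨r, rfl⟩ := finSumFinEquiv.surjective r
  cases r <;> simp [blockIsometry, Matrix.sum_apply, -finSumFinEquiv_apply_left,
    -finSumFinEquiv_apply_right]

theorem conjTranspose_blockIsometry_mul_self (F G : Fin 2 → Matrix (Fin m) (Fin m) ℂ) :
    (blockIsometry F G)ᴴ * blockIsometry F G = ∑ i, ((F i)ᴴ * F i + (G i)ᴴ * G i) := by
  ext j j'
  rw [Matrix.mul_apply, Fintype.sum_prod_type]
  simp only [Matrix.sum_apply, Matrix.add_apply, Matrix.mul_apply]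
  refine Finset.sum_congr rfl fun i _ => ?_
  rw [← finSumFinEquiv.sum_comp, Fintype.sum_sum_type]
  simp [blockIsometry, -finSumFinEquiv_apply_left,
    -finSumFinEquiv_apply_right]

/-- A pair of Hermitian involutions with anticommutator `2 cos θ` is a multiple of the pair
`observable 0`, `observable θ`. -/
theorem exists_isometry_observable {θ : ℝ} (hθ : Real.sin θ ≠ 0)
    {X Y Q : Matrix (Fin m) (Fin m) ℂ} (hX : X.IsHermitian) (hY : Y.IsHermitian)
    (hQ : Q.IsHermitian) (hQQ : Q * Q = Q) (hXQ : X * Q = X) (hQX : Q * X = X)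
    (hYQ : Y * Q = Y) (hQY : Q * Y = Y) (hXX : X * X = Q) (hYY : Y * Y = Q)
    (hXY : X * Y + Y * X = (2 * Real.cos θ : ℂ) • Q) :
    ∃ (k : ℕ) (W : Matrix (Fin 2 × Fin k) (Fin m) ℂ), Wᴴ * W = 1 ∧
      W * X = (observable 0 ⊗ₖ (1 : Matrix (Fin k) (Fin k) ℂ)) * (W * Q) ∧
      W * Y = (observable θ ⊗ₖ (1 : Matrix (Fin k) (Fin k) ℂ)) * (W * Q) := by
  set s : ℂ := (Real.sin θ : ℂ) with hs
  set c : ℂ := (Real.cos θ : ℂ) with hc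
  have hs0 : s ≠ 0 := by rw [hs]; exact_mod_cast hθ
  have hsc : s ^ 2 + c ^ 2 = 1 := by
    rw [hs, hc]; exact_mod_cast Real.sin_sq_add_cos_sq θ
  have hstar_s : star s = s := Complex.conj_ofReal _
  have hstar_c : star c = c := Complex.conj_ofReal _
  have hYX : Y * X = (2 * c) • Q - X * Y := by rw [← hXY]; abel
  have hXYX : X * Y * X = (2 * c) • X - Y := by
    rw [Matrix.mul_assoc, hYX, Matrix.mul_sub, Matrix.mul_smul, hXQ, ← Matrix.mul_assoc, hXX, hQY]
  have hXYXY : (X * Y) * (X * Y) = (2 * c) • (X * Y) - Q := by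
    rw [← Matrix.mul_assoc, hXYX, Matrix.sub_mul, Matrix.smul_mul, hYY]
  -- In the qubit model, `observable 0 * observable θ = cos θ - i sin θ σ_z`; solving for the last
  -- factor defines the counterpart of `σ_z`.
  set Z : Matrix (Fin m) (Fin m) ℂ := (-Complex.I / s) • (c • Q - X * Y) with hZ
  have hXYZ : X * Y = c • Q - (Complex.I * s) • Z := by
    rw [hZ, smul_smul]
    have : Complex.I * s * (-Complex.I / s) = 1 := by
      field_simp; rw [Complex.I_sq]; ring
    rw [this]; module
  have hZH : Zᴴ = Z := by
    rw [hZ, conjTranspose_smul, conjTranspose_sub, conjTranspose_smul, conjTranspose_mul, hX.eq,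
      hY.eq, hQ.eq, hYX, star_div₀, star_neg, hstar_s, hstar_c,
      show star Complex.I = -Complex.I from Complex.conj_I]
    module
  have hZZ : Z * Z = Q := by
    rw [hZ, Matrix.smul_mul, Matrix.mul_smul, smul_smul, Matrix.sub_mul, Matrix.mul_sub,
      Matrix.mul_sub, hXYXY, Matrix.smul_mul, Matrix.mul_smul, Matrix.mul_smul, hQQ,
      Matrix.smul_mul, ← Matrix.mul_assoc Q, hQX, Matrix.mul_assoc X, hYQ]
    have : -Complex.I / s * (-Complex.I / s) = -(s ^ 2)⁻¹ := by
      field_simp; rw [Complex.I_sq]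
    rw [this]
    have h2 : (s ^ 2)⁻¹ * (1 - c ^ 2) = 1 := by
      rw [← hsc, add_sub_cancel_right, inv_mul_cancel₀ (pow_ne_zero 2 hs0), hsc]
    calc _ = ((s ^ 2)⁻¹ * (1 - c ^ 2)) • Q := by module
      _ = Q := by rw [h2, one_smul]
  have hQZ : Q * Z = Z := by
    rw [hZ, Matrix.mul_smul, Matrix.mul_sub, Matrix.mul_smul, hQQ, ← Matrix.mul_assoc, hQX]
  have hZQ : Z * Q = Z := by
    rw [hZ, Matrix.smul_mul, Matrix.sub_mul, Matrix.smul_mul, hQQ, Matrix.mul_assoc, hYQ]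
  have hXZX : X * Z * X = -Z := by
    rw [hZ, Matrix.mul_smul, Matrix.smul_mul, Matrix.mul_sub, Matrix.sub_mul, Matrix.mul_smul, hXQ,
      Matrix.smul_mul, hXX, ← Matrix.mul_assoc, hXX, hQY, hYX]
    module
  -- The counterpart of the projection onto the first basis vector.
  set P : Matrix (Fin m) (Fin m) ℂ := (1 / 2 : ℂ) • (Q + Z) with hP
  have hPQ : P * Q = P := by rw [hP, Matrix.smul_mul, Matrix.add_mul, hQQ, hZQ]
  have hPZ : P * Z = P := by
    rw [hP, Matrix.smul_mul, Matrix.add_mul, hQZ, hZZ, add_comm]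
  have hPH : Pᴴ = P := by
    rw [hP, conjTranspose_smul, conjTranspose_add, hQ.eq, hZH]
    congr 1
    simp
  have hPP : P * P = P := by
    nth_rewrite 2 [hP]
    rw [Matrix.mul_smul, Matrix.mul_add, hPQ, hPZ]
    module
  have hPXY : P * (X * Y) = (c - Complex.I * s) • P := by
    rw [hXYZ, Matrix.mul_sub, Matrix.mul_smul, Matrix.mul_smul, hPQ, hPZ]
    module
  have hYXZ : Y * X = c • Q + (Complex.I * s) • Z := by
    rw [hYX, hXYZ]; module
  have hPY : P * Y = (c + Complex.I * s) • (P * X) := by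
    have : Y = Y * X * X := by rw [Matrix.mul_assoc, hXX, hYQ]
    rw [this, hYXZ, ← Matrix.mul_assoc, Matrix.mul_add, Matrix.mul_smul, Matrix.mul_smul, hPQ, hPZ,
      ← add_smul, Matrix.smul_mul]
  have hexp : Complex.exp (Complex.I * θ) = c + Complex.I * s := by
    rw [mul_comm, Complex.exp_mul_I, hc, hs, Complex.ofReal_cos, Complex.ofReal_sin, mul_comm]
  have hexp' : Complex.exp (-(Complex.I * θ)) = c - Complex.I * s := by
    rw [show -(Complex.I * (θ : ℂ)) = (-θ : ℂ) * Complex.I by ring, Complex.exp_mul_I, hc, hs,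
      Complex.ofReal_cos, Complex.ofReal_sin, Complex.cos_neg, Complex.sin_neg]
    ring
  -- On the range of `Q` the isometry is `v ↦ e₀ ⊗ Pv + e₁ ⊗ PXv`. The block `1 - Q` keeps it
  -- isometric off the support; it needs its own room, hence the ancilla of dimension `m + m`.
  refine ⟨m + m, blockIsometry ![P, P * X] ![1 - Q, 0], ?_, ?_, ?_⟩
  · rw [conjTranspose_blockIsometry_mul_self, Fin.sum_univ_two]
    simp only [Matrix.cons_val, conjTranspose_mul, conjTranspose_sub, conjTranspose_one,
      conjTranspose_zero, hPH, hX.eq, hQ.eq, hPP, Matrix.mul_zero, add_zero]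
    have h1 : X * P * (P * X) = (1 / 2 : ℂ) • (Q - Z) := by
      rw [Matrix.mul_assoc, ← Matrix.mul_assoc P, hPP, ← Matrix.mul_assoc, hP, Matrix.mul_smul,
        Matrix.smul_mul, Matrix.mul_add, Matrix.add_mul, hXQ, hXX, hXZX]
      module
    rw [h1, hP, Matrix.sub_mul, Matrix.mul_sub, Matrix.mul_sub, hQQ, Matrix.one_mul, Matrix.one_mul,
      Matrix.mul_one]
    module
  · rw [blockIsometry_mul, blockIsometry_mul, kronecker_one_mul_blockIsometry]
    congr 1
    · funext i
      fin_cases i <;> simp [Fin.sum_univ_two, observable, Matrix.mul_assoc, hXX, hXQ, hPQ]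
    · funext i
      fin_cases i <;> simp [Fin.sum_univ_two, observable, Matrix.sub_mul, hQX, hQQ]
  · rw [blockIsometry_mul, blockIsometry_mul, kronecker_one_mul_blockIsometry]
    congr 1
    · funext i
      fin_cases i <;>
        simp [Fin.sum_univ_two, observable, Matrix.mul_assoc, hXQ, hPQ, hPXY, hPY, hexp, hexp']
    · funext i
      fin_cases i <;> simp [Fin.sum_univ_two, observable, Matrix.sub_mul, hQY, hQQ]

end Isometry

end

end NonlocalGame

namespace NonlocalGame

open Matrix
open scoped Kronecker ComplexOrder

noncomputable section

/-! ### Partial traces -/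

section PartialTrace

variable {ι κ : Type*} [Fintype ι] [Fintype κ] [DecidableEq ι] [DecidableEq κ]

theorem traceB_kronecker_one_mul (M : Matrix ι ι ℂ) (X : Matrix (ι × κ) (ι × κ) ℂ) :
    traceB ((M ⊗ₖ (1 : Matrix κ κ ℂ)) * X) = M * traceB X := by
  ext i i'
  simp only [traceB, Matrix.of_apply, Matrix.mul_apply, Fintype.sum_prod_type, kroneckerMap_apply,
    Matrix.one_apply, mul_ite, mul_one, mul_zero, ite_mul, zero_mul, Finset.sum_ite_eq,
    Finset.mem_univ, if_true, Finset.mul_sum]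
  rw [Finset.sum_comm]

theorem traceA_one_kronecker_mul (M : Matrix κ κ ℂ) (X : Matrix (ι × κ) (ι × κ) ℂ) :
    traceA (((1 : Matrix ι ι ℂ) ⊗ₖ M) * X) = M * traceA X := by
  ext i i'
  simp only [traceA, Matrix.of_apply, Matrix.mul_apply, Fintype.sum_prod_type, kroneckerMap_apply,
    Matrix.one_apply, ite_mul, one_mul, zero_mul, Finset.sum_ite_irrel,
    Finset.sum_const_zero, Finset.sum_ite_eq, Finset.mem_univ, if_true, Finset.mul_sum]
  rw [Finset.sum_comm]

theorem trace_traceB (X : Matrix (ι × κ) (ι × κ) ℂ) : (traceB X).trace = X.trace := by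
  simp [traceB, Matrix.trace, Fintype.sum_prod_type]

theorem trace_traceA (X : Matrix (ι × κ) (ι × κ) ℂ) : (traceA X).trace = X.trace := by
  simp only [traceA, Matrix.trace, Matrix.diag_apply, Matrix.of_apply, Fintype.sum_prod_type]
  rw [Finset.sum_comm]

theorem traceB_isHermitian {X : Matrix (ι × κ) (ι × κ) ℂ} (h : X.IsHermitian) :
    (traceB X).IsHermitian := by
  ext i i'
  simp [traceB, Matrix.conjTranspose_apply, ← h.apply (i, _) (i', _)]

theorem traceA_isHermitian {X : Matrix (ι × κ) (ι × κ) ℂ} (h : X.IsHermitian) :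
    (traceA X).IsHermitian := by
  ext i i'
  simp [traceA, Matrix.conjTranspose_apply, ← h.apply (_, i) (_, i')]

theorem mul_eq_zero_of_trace_eq_zero {n : Type*} [Fintype n] [DecidableEq n] {M ρ : Matrix n n ℂ}
    (hM : M.IsHermitian) (hMM : M * M = M) (hρ : ρ.PosSemidef) (h : (M * ρ).trace = 0) :
    M * ρ = 0 := by
  obtain ⟨R, hR, rfl⟩ := exists_hermitian_sqrt hρ
  have : M * R = 0 := by
    rw [← Matrix.trace_conjTranspose_mul_self_eq_zero_iff, conjTranspose_mul, hM.eq, hR.eq,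
      Matrix.mul_assoc, Matrix.trace_mul_comm, ← Matrix.mul_assoc M, hMM, Matrix.mul_assoc, h]
  rw [← Matrix.mul_assoc, this, Matrix.zero_mul]

/-- The support projection of Alice's marginal. -/
theorem exists_supportA {ρ : Matrix (ι × κ) (ι × κ) ℂ} (hρ : ρ.PosSemidef) :
    ∃ Q : Matrix ι ι ℂ, Q.IsHermitian ∧ Q * Q = Q ∧ ((1 - Q) ⊗ₖ (1 : Matrix κ κ ℂ)) * ρ = 0 ∧
      ∀ M : Matrix ι ι ℂ, (M ⊗ₖ (1 : Matrix κ κ ℂ)) * ρ = 0 → M * Q = 0 := by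
  obtain ⟨Q, P, hQ, hQQ, hQρ, hP⟩ := exists_supportProjection (traceB_isHermitian hρ.1)
  have hQQ' : (1 - Q) * (1 - Q) = 1 - Q := by
    rw [Matrix.mul_sub, Matrix.mul_one, Matrix.sub_mul, Matrix.one_mul, hQQ, sub_self, sub_zero]
  refine ⟨Q, hQ, hQQ, mul_eq_zero_of_trace_eq_zero ?_ ?_ hρ ?_, fun M hM => ?_⟩
  · rw [IsHermitian, conjTranspose_kronecker, conjTranspose_sub, hQ.eq, conjTranspose_one,
      conjTranspose_one]
  · rw [← Matrix.mul_kronecker_mul, hQQ', Matrix.one_mul]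
  · rw [← trace_traceB, traceB_kronecker_one_mul, Matrix.sub_mul, Matrix.one_mul, hQρ, sub_self,
      Matrix.trace_zero]
  -- Such an `M` annihilates the marginal, and `Q` is the marginal times `P`. This turns relations
  -- on the state into operator identities on the support.
  · have := traceB_kronecker_one_mul M ρ
    rw [hM] at this
    rw [hP, ← Matrix.mul_assoc, ← this]
    ext i j
    simp [traceB, Matrix.mul_apply]

/-- The support projection of Bob's marginal. -/
theorem exists_supportB {ρ : Matrix (ι × κ) (ι × κ) ℂ} (hρ : ρ.PosSemidef) :
    ∃ Q : Matrix κ κ ℂ, Q.IsHermitian ∧ Q * Q = Q ∧ ((1 : Matrix ι ι ℂ) ⊗ₖ (1 - Q)) * ρ = 0 ∧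
      ∀ M : Matrix κ κ ℂ, ((1 : Matrix ι ι ℂ) ⊗ₖ M) * ρ = 0 → M * Q = 0 := by
  obtain ⟨Q, P, hQ, hQQ, hQρ, hP⟩ := exists_supportProjection (traceA_isHermitian hρ.1)
  have hQQ' : (1 - Q) * (1 - Q) = 1 - Q := by
    rw [Matrix.mul_sub, Matrix.mul_one, Matrix.sub_mul, Matrix.one_mul, hQQ, sub_self, sub_zero]
  refine ⟨Q, hQ, hQQ, mul_eq_zero_of_trace_eq_zero ?_ ?_ hρ ?_, fun M hM => ?_⟩
  · rw [IsHermitian, conjTranspose_kronecker, conjTranspose_sub, hQ.eq, conjTranspose_one,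
      conjTranspose_one]
  · rw [← Matrix.mul_kronecker_mul, hQQ', Matrix.one_mul]
  · rw [← trace_traceA, traceA_one_kronecker_mul, Matrix.sub_mul, Matrix.one_mul, hQρ, sub_self,
      Matrix.trace_zero]
  · have := traceA_one_kronecker_mul M ρ
    rw [hM] at this
    rw [hP, ← Matrix.mul_assoc, ← this]
    ext i j
    simp [traceA, Matrix.mul_apply]

end PartialTrace

/-! ### Self-testing of the measurements -/

/-- A pair of observables that restricts to the support of the state as a pair of involutions with
anticommutator `2 cos θ` is intertwined with the qubit measurements. -/
theorem exists_isometry_proj {m : ℕ} {θ : ℝ} (hθ : Real.sin θ ≠ 0)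
    {M : Fin 2 → Fin 2 → Matrix (Fin m) (Fin m) ℂ} (hM : ∀ x a, (M x a).IsHermitian)
    (hsum : ∀ x, ∑ a, M x a = 1) {Q : Matrix (Fin m) (Fin m) ℂ} (hQ : Q.IsHermitian)
    (hQQ : Q * Q = Q) (hinv : ∀ x, (1 - Q) * (M x 0 - M x 1) * Q = 0)
    (hsq : ∀ x, ((M x 0 - M x 1) * (M x 0 - M x 1) - 1) * Q = 0)
    (hanti : ((M 0 0 - M 0 1) * (M 1 0 - M 1 1) + (M 1 0 - M 1 1) * (M 0 0 - M 0 1)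
      - (2 * Real.cos θ : ℂ) • 1) * Q = 0) :
    ∃ (k : ℕ) (W : Matrix (Fin 2 × Fin k) (Fin m) ℂ), Wᴴ * W = 1 ∧
      ∀ x a, W * (M x a * Q) =
        (proj (angle θ x) a ⊗ₖ (1 : Matrix (Fin k) (Fin k) ℂ)) * (W * Q) := by
  obtain ⟨D, hD⟩ : ∃ D : Fin 2 → Matrix (Fin m) (Fin m) ℂ, ∀ x, M x 0 - M x 1 = D x :=
    ⟨fun x => M x 0 - M x 1, fun _ => rfl⟩
  have hDH : ∀ x, (D x).IsHermitian := fun x => hD x ▸ (hM x 0).sub (hM x 1)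
  simp only [hD] at hinv hsq hanti
  have hQDQ : ∀ x, D x * Q = Q * (D x * Q) := fun x => by
    have := hinv x
    rw [Matrix.mul_assoc, Matrix.sub_mul, Matrix.one_mul, sub_eq_zero] at this
    exact this
  -- A Hermitian operator that preserves the range of `Q` commutes with `Q`.
  have hcomm : ∀ x, Q * D x = D x * Q := fun x => by
    have := congrArg conjTranspose (hQDQ x)
    simp only [conjTranspose_mul, hQ.eq, (hDH x).eq] at this
    rw [this, Matrix.mul_assoc, ← hQDQ]
  have hQD : ∀ x, Q * (D x * Q) = D x * Q := fun x => (hQDQ x).symm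
  have hprod : ∀ x y, D x * Q * (D y * Q) = D x * D y * Q := fun x y => by
    rw [Matrix.mul_assoc, hQD, Matrix.mul_assoc]
  obtain ⟨k, W, hW, hW0, hW1⟩ := exists_isometry_observable hθ (X := D 0 * Q) (Y := D 1 * Q) (Q := Q)
    (by rw [IsHermitian, conjTranspose_mul, hQ.eq, (hDH 0).eq, hcomm])
    (by rw [IsHermitian, conjTranspose_mul, hQ.eq, (hDH 1).eq, hcomm]) hQ hQQ
    (by rw [Matrix.mul_assoc, hQQ]) (hQD 0) (by rw [Matrix.mul_assoc, hQQ]) (hQD 1)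
    (by rw [hprod, ← sub_eq_zero, ← hsq 0, Matrix.sub_mul, Matrix.one_mul])
    (by rw [hprod, ← sub_eq_zero, ← hsq 1, Matrix.sub_mul, Matrix.one_mul])
    (by rw [hprod, hprod, ← sub_eq_zero, ← hanti, Matrix.sub_mul, Matrix.add_mul, Matrix.smul_mul,
      Matrix.one_mul])
  refine ⟨k, W, hW, fun x a => ?_⟩
  have hWx : W * (D x * Q) =
      (observable (angle θ x) ⊗ₖ (1 : Matrix (Fin k) (Fin k) ℂ)) * (W * Q) := by
    fin_cases x
    · exact hW0
    · exact hW1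
  have hMx : M x a = (1 / 2 : ℂ) • (1 + (-1 : ℂ) ^ (a : ℕ) • D x) := by
    rw [← hsum x, Fin.sum_univ_two, ← hD]
    fin_cases a
    · simp only [Fin.zero_eta, Fin.coe_ofNat_eq_mod, Nat.zero_mod, pow_zero]
      module
    · simp only [Fin.mk_one, Fin.coe_ofNat_eq_mod, Nat.one_mod, pow_one]
      module
  rw [hMx, proj, smul_kronecker, add_kronecker, smul_kronecker, one_kronecker_one, Matrix.smul_mul,
    Matrix.smul_mul, Matrix.mul_smul, Matrix.add_mul, Matrix.add_mul, Matrix.mul_add,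
    Matrix.one_mul, Matrix.one_mul, Matrix.smul_mul, Matrix.smul_mul, Matrix.mul_smul, hWx]

/-- A state supported on the product of a one-dimensional eigenspace with an ancilla is a product
state. -/
theorem exists_ancilla {n r : Type*} [Fintype n] [Fintype r] [DecidableEq n] [DecidableEq r]
    {T : Matrix n n ℂ} {ω : ℂ} {ψ : n → ℂ} (hψ : ∑ i, ‖ψ i‖ ^ 2 = 1)
    (huniq : ∀ φ : n → ℂ, T.mulVec φ = ω • φ → ∃ z : ℂ, φ = z • ψ)
    {X : Matrix (n × r) (n × r) ℂ} (hX : IsDensity X)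
    (hT : (T ⊗ₖ (1 : Matrix r r ℂ)) * X = ω • X) :
    ∃ σ : Matrix r r ℂ, IsDensity σ ∧ X = Matrix.vecMulVec ψ (star ψ) ⊗ₖ σ := by
  have hψ' : ∑ i, star (ψ i) * ψ i = 1 := by
    have := (isDensity_pure ψ hψ).2
    simp only [Matrix.trace, Matrix.diag_apply, Matrix.vecMulVec_apply, Pi.star_apply] at this
    rw [← this]
    exact Finset.sum_congr rfl fun i _ => mul_comm _ _
  -- The isometry `v ↦ ψ ⊗ v`; the claim amounts to `U Uᴴ X = X`.
  set U : Matrix (n × r) r ℂ := Matrix.of fun p s => ψ p.1 * (1 : Matrix r r ℂ) p.2 s with hU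
  have hUX : U * (Uᴴ * X) = X := by
    ext ⟨p, s⟩ q
    -- With the ancilla index fixed, every column of `X` is an eigenvector of `T`, hence a multiple
    -- of `ψ`.
    obtain ⟨z, hz⟩ := huniq (fun p => X (p, s) q) (by
      ext p
      have := congrFun (congrFun hT (p, s)) q
      rw [Matrix.mul_apply, Fintype.sum_prod_type] at this
      simpa [Matrix.mulVec, dotProduct, Matrix.one_apply] using this)
    have hz' : ∀ p, X (p, s) q = z * ψ p := fun p => congrFun hz p
    have h1 : (Uᴴ * X) s q = z := by
      rw [Matrix.mul_apply, Fintype.sum_prod_type]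
      simp only [hU, conjTranspose_apply, Matrix.of_apply, Matrix.one_apply, mul_ite, mul_one,
        mul_zero, apply_ite star, star_zero, ite_mul, zero_mul, Finset.sum_ite_eq',
        Finset.mem_univ, if_true, hz']
      calc _ = z * ∑ i, star (ψ i) * ψ i := by
            rw [Finset.mul_sum]
            exact Finset.sum_congr rfl fun i _ => by ring
        _ = z := by rw [hψ', mul_one]
    have h2 : ∀ t, U (p, s) t = if s = t then ψ p else 0 := fun t => by
      simp [hU, Matrix.one_apply]
    rw [Matrix.mul_apply]
    simp only [h2, ite_mul, zero_mul, Finset.sum_ite_eq, Finset.mem_univ, if_true]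
    rw [h1, hz', mul_comm]
  have hXU : X * U * Uᴴ = X := by
    have := congrArg conjTranspose hUX
    simpa [hX.1.1.eq, Matrix.mul_assoc] using this
  refine ⟨Uᴴ * X * U, ⟨hX.1.conjTranspose_mul_mul_same U, ?_⟩, ?_⟩
  · rw [Matrix.trace_mul_comm, hUX, hX.2]
  · have : X = U * (Uᴴ * X * U) * Uᴴ := by
      rw [Matrix.mul_assoc Uᴴ, Matrix.mul_assoc U, Matrix.mul_assoc Uᴴ, hXU, hUX]
    nth_rewrite 1 [this]
    generalize Uᴴ * X * U = σ
    ext ⟨p, s⟩ ⟨p', s'⟩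
    simp only [Matrix.mul_apply, hU, conjTranspose_apply, Matrix.of_apply, Matrix.one_apply, mul_ite,
      mul_one, mul_zero, apply_ite star, star_zero, ite_mul, zero_mul, Finset.sum_ite_eq,
      Finset.mem_univ, if_true, kroneckerMap_apply, vecMulVec_apply, Pi.star_apply]
    ring

end

end NonlocalGame

namespace NonlocalGame

open Matrix
open scoped Kronecker ComplexOrder

noncomputable section

local notation "τ" => tanSq

/-! ### The Bell operator of the qubit measurements -/

section BellOperator

theorem bellOperator_mulVec (θ : ℝ) (ψ : Fin 2 × Fin 2 → ℂ) :
    let e := Complex.exp (Complex.I * θ)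
    let e' := Complex.exp (-(Complex.I * θ))
    16 * (bellOperator θ θ).mulVec ψ (0, 0) =
      7 * ψ (0, 0) + (2 - 4 * e - e ^ 2) * ψ (1, 1) + e * (ψ (1, 0) - ψ (0, 1)) ∧
    16 * (bellOperator θ θ).mulVec ψ (0, 1) =
      7 * ψ (0, 1) + (2 - 2 * e - 2 * e' - e * e') * ψ (1, 0) + e * ψ (1, 1) - e' * ψ (0, 0) ∧
    16 * (bellOperator θ θ).mulVec ψ (1, 0) =
      7 * ψ (1, 0) + (2 - 2 * e - 2 * e' - e * e') * ψ (0, 1) + e' * ψ (0, 0) - e * ψ (1, 1) ∧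
    16 * (bellOperator θ θ).mulVec ψ (1, 1) =
      7 * ψ (1, 1) + (2 - 4 * e' - e' ^ 2) * ψ (0, 0) + e' * (ψ (0, 1) - ψ (1, 0)) := by
  intro e e'
  have h11 : (1 + 1 : Fin 2) = 0 := rfl
  refine ⟨?_, ?_, ?_, ?_⟩ <;>
  · simp [bellOperator, V, proj, angle, observable, Matrix.mulVec, dotProduct,
      Fintype.sum_prod_type, Fin.sum_univ_two, kroneckerMap_apply, h11, e, e']
    ring

theorem bellMax_add_ne_zero : bellMax + (1 - 4 * Real.cos alphaOpt) ≠ 0 := by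
  rw [bellMax, cos_alphaOpt]
  have := tanSq_gt
  apply ne_of_gt
  nlinarith [tanSq_lt]

theorem bellMax_sub_ne_zero : bellMax - (1 - 4 * Real.cos alphaOpt) ≠ 0 := by
  rw [bellMax, cos_alphaOpt]
  have := tanSq_gt
  apply ne_of_gt
  nlinarith [tanSq_lt]

theorem bellMax_mul_sub_ne_zero :
    (bellMax + (1 - 4 * Real.cos alphaOpt)) * bellMax - 2 ≠ 0 := by
  rw [bellMax, cos_alphaOpt]
  have h1 := tanSq_gt
  have h2 := tanSq_lt
  have h3 : 5 < 7 / 3 - 8 / 3 * τ + 32 / 9 * τ ^ 2 := by nlinarith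
  have h4 : 5 < 7 / 3 - 8 / 3 * τ + 32 / 9 * τ ^ 2
      + (1 - 4 * (1 / 3 - 2 * τ / 3 + 2 * τ ^ 2 / 9)) := by nlinarith
  apply ne_of_gt
  nlinarith

/-- The condition for the reduced system in `eigen_system_iff` to be singular, that is, for
`bellMax` to be an eigenvalue. -/
theorem bellMax_characteristic :
    let L := bellMax + (1 - 4 * Real.cos alphaOpt)
    let c := Real.cos alphaOpt
    (L * bellMax - 2) ^ 2 = L ^ 2 * (25 - 8 * c - 8 * c ^ 2) - 2 * L * (8 * c ^ 2 - 8 * c - 6) + 4 := by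
  simp only [bellMax, cos_alphaOpt]
  grind [tanSq_cubic]

/-- The eigenvector of the Bell operator for the eigenvalue `omegaQ`, up to normalisation. -/
def optVec (θ : ℝ) (p : Fin 2 × Fin 2) : ℂ :=
  let e := Complex.exp (Complex.I * θ)
  let e' := Complex.exp (-(Complex.I * θ))
  let L : ℂ := (bellMax + (1 - 4 * Real.cos alphaOpt) : ℝ)
  let r : ℂ := (L * (2 - 4 * e - e ^ 2) - 2 * e ^ 2) / (L * bellMax - 2)
  ![![r, (e - e' * r) / L], ![-((e - e' * r) / L), 1]] p.1 p.2

theorem exp_add_exp_neg (θ : ℝ) : Complex.exp (Complex.I * θ) + Complex.exp (-(Complex.I * θ)) =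
    2 * (Real.cos θ : ℂ) := by
  rw [Complex.ofReal_cos, Complex.two_cos]
  congr 2 <;> ring

/-- The unknowns `x, y, z, w` are the amplitudes at `00, 01, 10, 11`. Eliminating `y` and `z` leaves
`D x = u w` and `D w = u' x`, with `u'` obtained from `u` by exchanging `e` and `e'`; the two are
compatible because `u u' = D²`. -/
theorem eigen_system_iff {e e' l c L D x y z w : ℂ} (hee : e * e' = 1) (hsum : e + e' = 2 * c)
    (hL : L = l + (1 - 4 * c)) (hD : D = L * l - 2) (hL0 : L ≠ 0) (hD0 : D ≠ 0)
    (hM0 : l - (1 - 4 * c) ≠ 0)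
    (hch : D ^ 2 = L ^ 2 * (25 - 8 * c - 8 * c ^ 2) - 2 * L * (8 * c ^ 2 - 8 * c - 6) + 4) :
    (l * x = (2 - 4 * e - e ^ 2) * w + e * (z - y) ∧
      l * y = (2 - 2 * e - 2 * e' - e * e') * z + e * w - e' * x ∧
      l * z = (2 - 2 * e - 2 * e' - e * e') * y + e' * x - e * w ∧
      l * w = (2 - 4 * e' - e' ^ 2) * x + e' * (y - z)) ↔
    (x = w * ((L * (2 - 4 * e - e ^ 2) - 2 * e ^ 2) / D) ∧
      y = w * ((e - e' * ((L * (2 - 4 * e - e ^ 2) - 2 * e ^ 2) / D)) / L) ∧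
      z = w * -((e - e' * ((L * (2 - 4 * e - e ^ 2) - 2 * e ^ 2) / D)) / L)) := by
  constructor
  · rintro ⟨h1, h2, h3, -⟩
    have hz : z = -y := by
      -- The coefficient `2 - 2e - 2e' - ee'` equals `1 - 4c`, so the sum of the middle equations
      -- isolates `y + z`.
      have : (l - (1 - 4 * c)) * (y + z) = 0 := by
        linear_combination h2 + h3 - (y + z) * hee - 2 * (y + z) * hsum
      linear_combination (mul_eq_zero.1 this).resolve_left hM0
    subst hz
    have hy : L * y = e * w - e' * x := by
      rw [hL]
      linear_combination h2 + y * hee + 2 * y * hsum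
    have hx : D * x = (L * (2 - 4 * e - e ^ 2) - 2 * e ^ 2) * w := by
      rw [hD]
      linear_combination L * h1 - 2 * e * hy + 2 * x * hee
    have hx' : x = w * ((L * (2 - 4 * e - e ^ 2) - 2 * e ^ 2) / D) := by
      field_simp
      linear_combination hx
    have hy' : y = w * ((e - e' * ((L * (2 - 4 * e - e ^ 2) - 2 * e ^ 2) / D)) / L) := by
      rw [mul_div_assoc', eq_div_iff hL0, mul_comm y, hy, hx']
      ring
    exact ⟨hx', hy', by rw [mul_neg, ← hy']⟩
  · rintro ⟨hx, hy, hz⟩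
    have hz' : z = -y := by rw [hz, hy]; ring
    subst hz'
    have hx' : D * x = (L * (2 - 4 * e - e ^ 2) - 2 * e ^ 2) * w := by
      rw [hx]; field_simp
    have hy' : L * y = e * w - e' * x := by
      rw [hy, hx]
      field_simp
    have hprod : (L * (2 - 4 * e' - e' ^ 2) - 2 * e' ^ 2) * (L * (2 - 4 * e - e ^ 2) - 2 * e ^ 2) =
        D ^ 2 := by
      obtain rfl : c = (e + e') / 2 := by rw [hsum]; ring
      rw [hch]
      linear_combination (L ^ 2 * (e * e' + 21 + 4 * (e + e'))
        + 2 * L * (4 * (e + e') + 2 * (e * e' + 3)) + 4 * (e * e' + 1)) * hee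
    have hw : D * w = (L * (2 - 4 * e' - e' ^ 2) - 2 * e' ^ 2) * x := by
      apply mul_left_cancel₀ hD0
      linear_combination -w * hprod - (L * (2 - 4 * e' - e' ^ 2) - 2 * e' ^ 2) * hx'
    refine ⟨?_, ?_, ?_, ?_⟩
    · apply mul_left_cancel₀ hL0
      rw [hD] at hx'
      linear_combination hx' + 2 * e * hy' - 2 * x * hee
    · rw [hL] at hy'
      linear_combination hy' - y * hee - 2 * y * hsum
    · rw [hL] at hy'
      linear_combination -hy' + y * hee + 2 * y * hsum
    · apply mul_left_cancel₀ hL0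
      rw [hD] at hw
      linear_combination hw - 2 * e' * hy' - 2 * w * hee

/-- The angle enters the solvability conditions only through its cosine, so both signs are covered.
-/
theorem eigenvector_iff {θ : ℝ} (hθ : Real.cos θ = Real.cos alphaOpt) (ψ : Fin 2 × Fin 2 → ℂ) :
    (bellOperator θ θ).mulVec ψ = (omegaQ : ℂ) • ψ ↔ ψ = ψ (1, 1) • optVec θ := by
  obtain ⟨h00, h01, h10, h11⟩ := bellOperator_mulVec θ ψ
  have hee : Complex.exp (Complex.I * θ) * Complex.exp (-(Complex.I * θ)) = 1 := by
    rw [← Complex.exp_add]; simp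
  have hsum := exp_add_exp_neg θ
  have hω : (omegaQ : ℂ) = (7 + (bellMax : ℂ)) / 16 := by
    rw [Strategy.omegaQ_eq_bellMax]; push_cast; ring
  have hL0 : ((bellMax + (1 - 4 * Real.cos alphaOpt) : ℝ) : ℂ) ≠ 0 := by
    exact_mod_cast bellMax_add_ne_zero
  have hM0 : ((bellMax - (1 - 4 * Real.cos alphaOpt) : ℝ) : ℂ) ≠ 0 := by
    exact_mod_cast bellMax_sub_ne_zero
  have hD0 : ((bellMax + (1 - 4 * Real.cos alphaOpt) : ℝ) : ℂ) * bellMax - 2 ≠ 0 := by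
    exact_mod_cast bellMax_mul_sub_ne_zero
  have hch : (((bellMax + (1 - 4 * Real.cos alphaOpt) : ℝ) : ℂ) * bellMax - 2) ^ 2 =
      ((bellMax + (1 - 4 * Real.cos alphaOpt) : ℝ) : ℂ) ^ 2
        * (25 - 8 * (Real.cos alphaOpt : ℂ) - 8 * (Real.cos alphaOpt : ℂ) ^ 2)
      - 2 * ((bellMax + (1 - 4 * Real.cos alphaOpt) : ℝ) : ℂ)
        * (8 * (Real.cos alphaOpt : ℂ) ^ 2 - 8 * (Real.cos alphaOpt : ℂ) - 6) + 4 := by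
    exact_mod_cast bellMax_characteristic
  rw [hθ] at hsum
  have key := eigen_system_iff (x := ψ (0, 0)) (y := ψ (0, 1)) (z := ψ (1, 0)) (w := ψ (1, 1)) hee hsum
    (L := ((bellMax + (1 - 4 * Real.cos alphaOpt) : ℝ) : ℂ)) (l := bellMax) (by push_cast; ring) rfl
    hL0 hD0 (by simpa using hM0) hch
  have hcomp : ∀ p, (bellOperator θ θ).mulVec ψ p = ((omegaQ : ℂ) • ψ) p ↔
      16 * (bellOperator θ θ).mulVec ψ p = 7 * ψ p + bellMax * ψ p := fun p => by
    rw [Pi.smul_apply, smul_eq_mul, hω]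
    constructor
    · intro h; rw [h]; ring
    · intro h; linear_combination h / 16
  constructor
  · intro h
    have e : ∀ p, 16 * (bellOperator θ θ).mulVec ψ p = 7 * ψ p + bellMax * ψ p := fun p => (hcomp p).1 (congrFun h p)
    obtain ⟨e1, e2, e3⟩ := key.1 ⟨by linear_combination h00 - e (0, 0),
      by linear_combination h01 - e (0, 1), by linear_combination h10 - e (1, 0),
      by linear_combination h11 - e (1, 1)⟩
    ext ⟨i, j⟩
    fin_cases i <;> fin_cases j
    · exact e1
    · exact e2
    · exact e3
    · exact (mul_one _).symm
  · intro h
    obtain ⟨e1, e2, e3, e4⟩ := key.2 ⟨congrFun h (0, 0), congrFun h (0, 1), congrFun h (1, 0)⟩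
    ext ⟨i, j⟩
    rw [hcomp]
    fin_cases i <;> fin_cases j <;> simp only [Fin.zero_eta, Fin.mk_one]
    · exact h00.trans (by linear_combination -e1)
    · exact h01.trans (by linear_combination -e2)
    · exact h10.trans (by linear_combination -e3)
    · exact h11.trans (by linear_combination -e4)

theorem eigenvector_unique {θ : ℝ} (hθ : Real.cos θ = Real.cos alphaOpt) {ψ : Fin 2 × Fin 2 → ℂ}
    (hψ : ∑ p, ‖ψ p‖ ^ 2 = 1) (h : (bellOperator θ θ).mulVec ψ = (omegaQ : ℂ) • ψ)
    (φ : Fin 2 × Fin 2 → ℂ) (hφ : (bellOperator θ θ).mulVec φ = (omegaQ : ℂ) • φ) :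
    ∃ z : ℂ, φ = z • ψ := by
  rw [eigenvector_iff hθ] at h hφ
  have h0 : ψ (1, 1) ≠ 0 := by
    intro h0
    rw [h0, zero_smul] at h
    simp [h] at hψ
  refine ⟨φ (1, 1) / ψ (1, 1), ?_⟩
  rw [h, smul_smul, Pi.smul_apply, smul_eq_mul]
  nth_rewrite 1 [hφ]
  congr 1
  have : optVec θ (1, 1) = 1 := rfl
  rw [this]
  field_simp

theorem exists_eigenvector {θ : ℝ} (hθ : Real.cos θ = Real.cos alphaOpt) :
    ∃ ψ : Fin 2 × Fin 2 → ℂ, ∑ p, ‖ψ p‖ ^ 2 = 1 ∧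
      (bellOperator θ θ).mulVec ψ = (omegaQ : ℂ) • ψ := by
  have h1 : optVec θ (1, 1) = 1 := rfl
  set N := ∑ p, ‖optVec θ p‖ ^ 2 with hN
  have hpos : 0 < N :=
    Finset.sum_pos' (fun p _ => by positivity) ⟨(1, 1), Finset.mem_univ _, by rw [h1]; simp⟩
  refine ⟨((Real.sqrt N)⁻¹ : ℂ) • optVec θ, ?_, ?_⟩
  · simp only [Pi.smul_apply, norm_smul, mul_pow, ← Finset.mul_sum, ← hN]
    rw [norm_inv, Complex.norm_real, Real.norm_of_nonneg (Real.sqrt_nonneg _), inv_pow,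
      Real.sq_sqrt hpos.le, inv_mul_cancel₀ hpos.ne']
  · rw [eigenvector_iff hθ, Pi.smul_apply, h1, smul_eq_mul, mul_one]

end BellOperator

end

end NonlocalGame

namespace NonlocalGame

open Matrix
open scoped Kronecker ComplexOrder

noncomputable section

namespace Strategy

/-! ### Uniqueness of the optimal strategy -/

section Operators

variable {ι κ : Type*} [Fintype ι] [Fintype κ] [DecidableEq ι] [DecidableEq κ]

theorem actA_sub_apply (M N : Matrix ι ι ℂ) (X : Matrix (ι × κ) (ι × κ) ℂ) :
    actA κ (M - N) X = actA κ M X - actA κ N X :=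
  eq_sub_of_add_eq (by rw [← actA_add_apply, sub_add_cancel])

theorem actB_sub_apply (M N : Matrix κ κ ℂ) (X : Matrix (ι × κ) (ι × κ) ℂ) :
    actB ι (M - N) X = actB ι M X - actB ι N X :=
  eq_sub_of_add_eq (by rw [← actB_add_apply, sub_add_cancel])

theorem actA_smul_one_apply (r : ℝ) (X : Matrix (ι × κ) (ι × κ) ℂ) :
    actA κ ((r : ℂ) • (1 : Matrix ι ι ℂ)) X = r • X := by
  rw [actA_apply, smul_kronecker, one_kronecker_one, Matrix.smul_mul, Matrix.one_mul]
  exact Complex.coe_smul r X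

theorem actB_smul_one_apply (r : ℝ) (X : Matrix (ι × κ) (ι × κ) ℂ) :
    actB ι ((r : ℂ) • (1 : Matrix κ κ ℂ)) X = r • X := by
  rw [actB_apply, kronecker_smul, one_kronecker_one, Matrix.smul_mul, Matrix.one_mul]
  exact Complex.coe_smul r X

theorem actB_neg_apply (M : Matrix κ κ ℂ) (X : Matrix (ι × κ) (ι × κ) ℂ) :
    actB ι (-M) X = -actB ι M X := by
  rw [← zero_sub M, actB_sub_apply]
  simp [actB_apply]

theorem anticomm_obsB (S : Strategy ι κ) (hS : S.value = omegaQ) :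
    actB ι (S.obsB 0 * S.obsB 1) S.ρ + actB ι (S.obsB 1 * S.obsB 0) S.ρ =
      -((2 * Real.cos alphaOpt) • S.ρ) := by
  have := ((S.optimalRelations hS).swap fun i j X => actB_actA _ _ _).anticomm
  simp only [Matrix.cons_val_zero, Matrix.cons_val_one, LinearMap.neg_apply, map_neg] at this
  rw [actB_actB, actB_actB] at this
  rw [← this]
  abel

theorem bell_eq (S : Strategy ι κ) (hS : S.value = omegaQ) :
    ∑ x, ∑ y, (1 / 4 : ℂ) • ∑ a, ∑ b, (V a b x y : ℂ) • ((S.A x a ⊗ₖ S.B y b) * S.ρ) =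
      (omegaQ : ℂ) • S.ρ := by
  have h := (S.optimalRelations hS).bellVec_eq
  have hω : (omegaQ : ℂ) = (7 + (bellMax : ℂ)) / 16 := by
    rw [omegaQ_eq_bellMax]; push_cast; ring
  have hr : ∀ (r : ℝ) (X : Matrix (ι × κ) (ι × κ) ℂ), r • X = (r : ℂ) • X := fun r X =>
    (Complex.coe_smul r X).symm
  simp only [bellVec, hr] at h
  simp only [← actA_actB, hω]
  have hA : ∀ (M : Matrix ι ι ℂ) (X : Matrix (ι × κ) (ι × κ) ℂ),
      actA κ ((1 / 2 : ℂ) • M) X = (1 / 2 : ℂ) • actA κ M X := fun M X => by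
    simp only [actA_apply, smul_kronecker, Matrix.smul_mul]
  have hB : ∀ (M : Matrix κ κ ℂ) (X : Matrix (ι × κ) (ι × κ) ℂ),
      actB ι ((1 / 2 : ℂ) • M) X = (1 / 2 : ℂ) • actB ι M X := fun M X => by
    simp only [actB_apply, kronecker_smul, Matrix.smul_mul]
  have hA' : ∀ (M : Matrix ι ι ℂ) (X : Matrix (ι × κ) (ι × κ) ℂ),
      actA κ M ((1 / 2 : ℂ) • X) = (1 / 2 : ℂ) • actA κ M X := fun M X => by
    simp only [actA_apply, Matrix.mul_smul]
  simp only [Fin.sum_univ_two, A_zero, A_one, B_zero_zero, B_zero_one, B_one_zero, B_one_one, hA,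
    hB, hA', actA_add_apply, actA_sub_apply, actB_add_apply, actB_sub_apply, actA_one_apply,
    actB_one_apply, map_add, map_sub]
  simp only [V, show (1 + 1 : Fin 2) = 0 from rfl, one_ne_zero, zero_ne_one, add_zero, zero_add,
    and_self, and_true, and_false, false_and, true_and, if_true, if_false, Complex.ofReal_zero,
    Complex.ofReal_one]
  push_cast at h
  linear_combination (norm := module) (1 / 16 : ℂ) • h

end Operators

variable {m n : ℕ}

theorem exists_isometryA (S : Strategy (Fin m) (Fin n)) (hS : S.value = omegaQ) {θ : ℝ}
    (hθ : Real.cos θ = Real.cos alphaOpt) (hθ' : Real.sin θ ≠ 0) :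
    ∃ (Q : Matrix (Fin m) (Fin m) ℂ) (k : ℕ) (W : Matrix (Fin 2 × Fin k) (Fin m) ℂ),
      (Q ⊗ₖ (1 : Matrix (Fin n) (Fin n) ℂ)) * S.ρ = S.ρ ∧ Wᴴ * W = 1 ∧
      ∀ x a, W * (S.A x a * Q) =
        (proj (angle θ x) a ⊗ₖ (1 : Matrix (Fin k) (Fin k) ℂ)) * (W * Q) := by
  obtain ⟨Q, hQ, hQQ, hρ, hsup⟩ := exists_supportA S.density.1
  have h := S.optimalRelations hS
  obtain ⟨k, W, hW, hWA⟩ := exists_isometry_proj hθ' (M := S.A) (fun x a => (S.A_pos x a).1) S.A_sum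
    hQ hQQ (fun x => hsup _ (by
      have := h.map_eq_zero (fun i j X => actB_actA _ _ _) (q := actA (Fin n) (1 - Q))
        (fun j X => (actB_actA _ _ _).symm) hρ x
      rwa [actA_actA] at this))
    (fun x => hsup _ (by
      have := h.sq_a x
      rw [actA_actA] at this
      change actA (Fin n) (S.obsA x * S.obsA x - 1) S.ρ = 0
      rw [actA_sub_apply, this, actA_one_apply, sub_self]))
    (hsup _ (by
      have := h.anticomm
      rw [actA_actA, actA_actA] at this
      change actA (Fin n) (S.obsA 0 * S.obsA 1 + S.obsA 1 * S.obsA 0 - (2 * Real.cos θ : ℂ) • 1) S.ρ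
        = 0
      rw [actA_sub_apply, actA_add_apply, this, hθ, sub_eq_zero, ← actA_smul_one_apply]
      push_cast
      rfl))
  refine ⟨Q, k, W, ?_, hW, hWA⟩
  have : actA (Fin n) (1 - Q) S.ρ = 0 := hρ
  rw [actA_sub_apply, actA_one_apply, sub_eq_zero] at this
  exact this.symm

/-- Bob's actual observable for input `1` is `-obsB 1`; this sign turns the anticommutator `-2 cos
α*` back into `2 cos α*`, the value required by the qubit pair. -/
theorem exists_isometryB (S : Strategy (Fin m) (Fin n)) (hS : S.value = omegaQ) {θ : ℝ}
    (hθ : Real.cos θ = Real.cos alphaOpt) (hθ' : Real.sin θ ≠ 0) :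
    ∃ (Q : Matrix (Fin n) (Fin n) ℂ) (l : ℕ) (W : Matrix (Fin 2 × Fin l) (Fin n) ℂ),
      ((1 : Matrix (Fin m) (Fin m) ℂ) ⊗ₖ Q) * S.ρ = S.ρ ∧ Wᴴ * W = 1 ∧
      ∀ y b, W * (S.B y b * Q) =
        (proj (angle θ y) b ⊗ₖ (1 : Matrix (Fin l) (Fin l) ℂ)) * (W * Q) := by
  obtain ⟨Q, hQ, hQQ, hρ, hsup⟩ := exists_supportB S.density.1
  have h := S.optimalRelations hS
  have hsw := h.swap (fun i j X => actB_actA _ _ _)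
  have h0 : S.B 0 0 - S.B 0 1 = S.obsB 0 := rfl
  have h1 : S.B 1 0 - S.B 1 1 = -S.obsB 1 := (neg_sub _ _).symm
  have hq := hsw.map_eq_zero (fun i j X => by
      fin_cases i <;> fin_cases j <;> simp [actB_actA]) (q := actB (Fin m) (1 - Q))
        (fun j X => by fin_cases j <;> simp [actB_actA]) hρ
  have hq0 : actB (Fin m) ((1 - Q) * S.obsB 0) S.ρ = 0 := by
    have := hq 0
    simp only [Matrix.cons_val_zero, LinearMap.neg_apply, map_neg, neg_eq_zero] at this
    rwa [actB_actB] at this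
  have hq1 : actB (Fin m) ((1 - Q) * S.obsB 1) S.ρ = 0 := by
    have := hq 1
    simp only [Matrix.cons_val_one] at this
    rwa [← actB_actB]
  have hs : ∀ y, actB (Fin m) (S.obsB y * S.obsB y - 1) S.ρ = 0 := fun y => by
    have := h.sq_b y
    rw [actB_actB] at this
    rw [actB_sub_apply, this, actB_one_apply, sub_self]
  have ha := S.anticomm_obsB hS
  obtain ⟨l, W, hW, hWB⟩ := exists_isometry_proj hθ' (M := S.B) (fun x a => (S.B_pos x a).1) S.B_sum
    hQ hQQ (fun y => hsup _ (by
      fin_cases y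
      · exact hq0
      · simp only [Fin.mk_one, h1, Matrix.mul_neg]
        change actB (Fin m) (-((1 - Q) * S.obsB 1)) S.ρ = 0
        rw [actB_neg_apply, hq1, neg_zero]))
    (fun y => hsup _ (by
      fin_cases y
      · exact hs 0
      · simp only [Fin.mk_one, h1, neg_mul_neg]
        exact hs 1))
    (hsup _ (by
      rw [h0, h1, Matrix.mul_neg, Matrix.neg_mul, ← neg_add]
      change actB (Fin m) (-(S.obsB 0 * S.obsB 1 + S.obsB 1 * S.obsB 0) - (2 * Real.cos θ : ℂ) • 1)
        S.ρ = 0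
      rw [actB_sub_apply, actB_neg_apply, actB_add_apply, ha, neg_neg, hθ, sub_eq_zero,
        ← actB_smul_one_apply]
      push_cast
      rfl))
  refine ⟨Q, l, W, ?_, hW, hWB⟩
  have : actB (Fin m) (1 - Q) S.ρ = 0 := hρ
  rw [actB_sub_apply, actB_one_apply, sub_eq_zero] at this
  exact this.symm

theorem kronecker_one_kronecker_one {p q k l : Type*} [Fintype p] [Fintype q] [Fintype k]
    [Fintype l] [DecidableEq k] [DecidableEq l] (M : Matrix p p ℂ) (N : Matrix q q ℂ) :
    (M ⊗ₖ (1 : Matrix k k ℂ)) ⊗ₖ (N ⊗ₖ (1 : Matrix l l ℂ)) =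
      ((M ⊗ₖ N) ⊗ₖ (1 : Matrix (k × l) (k × l) ℂ)).submatrix (Equiv.prodProdProdComm p k q l)
        (Equiv.prodProdProdComm p k q l) := by
  rw [← one_kronecker_one (α := ℂ) (m := k) (n := l)]
  ext ⟨⟨i, s⟩, ⟨j, t⟩⟩ ⟨⟨i', s'⟩, ⟨j', t'⟩⟩
  simp only [kroneckerMap_apply, submatrix_apply, Equiv.prodProdProdComm_apply]
  ring

/-- Every optimal strategy is the optimal qubit strategy up to local isometries. -/
theorem isLocallyIsometricTo_qubitStrategy (S : Strategy (Fin m) (Fin n)) (hS : S.value = omegaQ)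
    {θ : ℝ} (hθ : Real.cos θ = Real.cos alphaOpt) (hθ' : Real.sin θ ≠ 0)
    {ψ : Fin 2 × Fin 2 → ℂ} (hψ : ∑ p, ‖ψ p‖ ^ 2 = 1)
    (hBell : (bellOperator θ θ).mulVec ψ = (omegaQ : ℂ) • ψ) :
    S.IsLocallyIsometricTo (qubitStrategy θ θ ψ hψ) := by
  obtain ⟨QA, k, WA, hQA, hWA, hA⟩ := S.exists_isometryA hS hθ hθ'
  obtain ⟨QB, l, WB, hQB, hWB, hB⟩ := S.exists_isometryB hS hθ hθ'
  set e := Equiv.prodProdProdComm (Fin 2) (Fin k) (Fin 2) (Fin l) with he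
  set W := WA ⊗ₖ WB with hW
  set X := (W * S.ρ * Wᴴ).submatrix e.symm e.symm with hX
  have hQ : (QA ⊗ₖ QB) * S.ρ = S.ρ := by
    rw [← actA_actB, actA_apply, actB_apply, hQB, hQA]
  have hWW : Wᴴ * W = 1 := by
    rw [hW, conjTranspose_kronecker, ← Matrix.mul_kronecker_mul, hWA, hWB, one_kronecker_one]
  have hXe : W * S.ρ * Wᴴ = X.submatrix e e := by
    rw [hX, submatrix_submatrix]; simp
  -- The isometries intertwine the measurements only on the supports, so `QA ⊗ QB` is inserted in
  -- front of `ρ`, which it fixes.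
  have hcomm : ∀ x y a b, W * ((S.A x a ⊗ₖ S.B y b) * S.ρ) * Wᴴ =
      (((proj (angle θ x) a ⊗ₖ proj (angle θ y) b) ⊗ₖ
        (1 : Matrix (Fin k × Fin l) (Fin k × Fin l) ℂ)) * X).submatrix e e := fun x y a b => by
    rw [← submatrix_mul_equiv _ X e e e, ← kronecker_one_kronecker_one, ← hXe]
    conv_lhs => rw [← hQ]
    rw [← Matrix.mul_assoc (S.A x a ⊗ₖ S.B y b), ← Matrix.mul_kronecker_mul, ← Matrix.mul_assoc W,
      hW, ← Matrix.mul_kronecker_mul, hA, hB, Matrix.mul_kronecker_mul, Matrix.mul_kronecker_mul,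
      Matrix.mul_assoc _ _ S.ρ, Matrix.mul_assoc _ _ S.ρ, hQ]
    simp only [Matrix.mul_assoc]
  have hXd : IsDensity X := by
    refine ⟨(S.density.1.mul_mul_conjTranspose_same W).submatrix _, ?_⟩
    have : X.trace = (W * S.ρ * Wᴴ).trace := by
      simp only [Matrix.trace, hX, diag_apply, submatrix_apply]
      exact Equiv.sum_comp e.symm fun i => (W * S.ρ * Wᴴ) i i
    rw [this, Matrix.trace_mul_comm, ← Matrix.mul_assoc, hWW, Matrix.one_mul, S.density.2]
  -- The eigenvalue equation of `bell_eq`, carried over by the intertwining relations.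
  have hT : (bellOperator θ θ ⊗ₖ (1 : Matrix (Fin k × Fin l) (Fin k × Fin l) ℂ)) * X =
      (omegaQ : ℂ) • X := by
    have h1 := congrArg (fun Y => (W * Y * Wᴴ).submatrix e.symm e.symm) (S.bell_eq hS)
    have hs : ∀ Y : Matrix ((Fin 2 × Fin 2) × Fin k × Fin l) ((Fin 2 × Fin 2) × Fin k × Fin l) ℂ,
        (Y.submatrix e e).submatrix e.symm e.symm = Y := fun Y => by
      rw [submatrix_submatrix]; simp
    have hk : ∀ (s : Fin 2 → Matrix (Fin 2 × Fin 2) (Fin 2 × Fin 2) ℂ),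
        (∑ i, s i) ⊗ₖ (1 : Matrix (Fin k × Fin l) (Fin k × Fin l) ℂ) = ∑ i, s i ⊗ₖ 1 := fun s => by
      rw [Fin.sum_univ_two, Fin.sum_univ_two, add_kronecker]
    have ha : ∀ Y Z : Matrix ((Fin 2 × Fin k) × Fin 2 × Fin l) ((Fin 2 × Fin k) × Fin 2 × Fin l) ℂ,
        (Y + Z).submatrix e.symm e.symm = Y.submatrix e.symm e.symm + Z.submatrix e.symm e.symm :=
      fun _ _ => rfl
    have hc : ∀ (c : ℂ)
        (Y : Matrix ((Fin 2 × Fin k) × Fin 2 × Fin l) ((Fin 2 × Fin k) × Fin 2 × Fin l) ℂ),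
        (c • Y).submatrix e.symm e.symm = c • Y.submatrix e.symm e.symm := fun _ _ => rfl
    rw [bellOperator]
    simp only [hk, smul_kronecker, Matrix.sum_mul, Matrix.smul_mul]
    simp only [Fin.sum_univ_two, Matrix.mul_add, Matrix.add_mul, Matrix.mul_smul, Matrix.smul_mul,
      hcomm, ha, hc, hs, ← hX] at h1
    simpa only [Fin.sum_univ_two] using h1
  obtain ⟨σ, hσ, hXσ⟩ := exists_ancilla hψ (eigenvector_unique hθ hψ hBell) hXd hT
  refine ⟨k, l, WA, WB, σ, hWA, hWB, hσ, fun x y a b => ?_⟩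
  rw [← hW, hcomm, hXσ, ← Matrix.mul_kronecker_mul, Matrix.one_mul]
  rfl

end Strategy

end

end NonlocalGame

namespace NonlocalGame

open Matrix
open scoped Kronecker ComplexOrder

noncomputable section

/-! ### The classical value -/

/-- The expression is affine in each of `p` and `q`, so the gap to `3` interpolates its values at
Alice's four deterministic answers: `2 - s`, `2 - 2r + s`, `2r`, `2s`. -/
theorem classical_bound {p q r s : ℝ} (hp : 0 ≤ p) (hp' : p ≤ 1) (hq : 0 ≤ q) (hq' : q ≤ 1)
    (hr : 0 ≤ r) (hr' : r ≤ 1) (hs : 0 ≤ s) (hs' : s ≤ 1) :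
    1 + s + 2 * p * (r - s) + q * (2 - 2 * r - s) ≤ 3 := by
  have h1 : 0 ≤ (1 - p) * (1 - q) * (2 - s) :=
    mul_nonneg (mul_nonneg (by linarith) (by linarith)) (by linarith)
  have h2 : 0 ≤ p * (1 - q) * (2 - 2 * r + s) :=
    mul_nonneg (mul_nonneg (by linarith) (by linarith)) (by linarith)
  have h3 : 0 ≤ (1 - p) * q * (2 * r) :=
    mul_nonneg (mul_nonneg (by linarith) (by linarith)) (by linarith)
  have h4 : 0 ≤ p * q * (2 * s) :=
    mul_nonneg (mul_nonneg (by linarith) (by linarith)) (by linarith)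
  linarith

theorem isGreatest_classical :
    IsGreatest {v : ℝ | ∃ P : Box, IsClassicalBox P ∧ gameValue P = v} (3 / 4) := by
  have h11 : (1 + 1 : Fin 2) = 0 := rfl
  constructor
  -- Alice always answers `0` and Bob answers his input; only the inputs `(1, 0)` lose.
  · refine ⟨fun a b x y => (if a = 0 then 1 else 0) * (if b = y then 1 else 0),
      ⟨1, fun _ => 1, fun _ _ a => if a = 0 then 1 else 0, fun _ y b => if b = y then 1 else 0,
        fun _ => zero_le_one, by simp, ?_, ?_, ?_, ?_, ?_⟩, ?_⟩
    · intro i x a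
      dsimp only
      split_ifs <;> norm_num
    · simp
    · intro i x a
      dsimp only
      split_ifs <;> norm_num
    · simp
    · simp
    · simp [gameValue, V, Fin.sum_univ_two]
      norm_num
  · rintro v ⟨P, ⟨k, q, pA, pB, hq, hq1, hA, hA1, hB, hB1, hP⟩, rfl⟩
    have hA' : ∀ i x, pA i x 1 = 1 - pA i x 0 := fun i x => by
      rw [← hA1 i x, Fin.sum_univ_two]; ring
    have hB' : ∀ i x, pB i x 1 = 1 - pB i x 0 := fun i x => by
      rw [← hB1 i x, Fin.sum_univ_two]; ring
    have hv : gameValue P = ∑ i, q i * ((1 + pB i 1 0 + 2 * pA i 0 0 * (pB i 0 0 - pB i 1 0)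
        + pA i 1 0 * (2 - 2 * pB i 0 0 - pB i 1 0)) / 4) := by
      simp only [gameValue, Fin.sum_univ_two, V, hP, h11, one_ne_zero, zero_ne_one, add_zero,
        zero_add, and_self, and_true, and_false, false_and, true_and, if_true, if_false, zero_mul,
        one_mul, ← Finset.sum_add_distrib, Finset.mul_sum, hA', hB']
      exact Finset.sum_congr rfl fun i _ => by ring
    have hA2 : ∀ i x, pA i x 0 ≤ 1 := fun i x => by linarith [hA' i x, hA i x 1]
    have hB2 : ∀ i x, pB i x 0 ≤ 1 := fun i x => by linarith [hB' i x, hB i x 1]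
    rw [hv]
    calc _ ≤ ∑ i, q i * (3 / 4) := Finset.sum_le_sum fun i _ => by
          have := classical_bound (hA i 0 0) (hA2 i 0) (hA i 1 0) (hA2 i 1) (hB i 0 0) (hB2 i 0)
            (hB i 1 0) (hB2 i 1)
          exact mul_le_mul_of_nonneg_left (by linarith) (hq i)
      _ = 3 / 4 := by rw [← Finset.sum_mul, hq1, one_mul]

/-! ### The quantum value -/

theorem qubitStrategy_value {α β ω : ℝ} {ψ : Fin 2 × Fin 2 → ℂ} (hψ : ∑ p, ‖ψ p‖ ^ 2 = 1)
    (h : (bellOperator α β).mulVec ψ = (ω : ℂ) • ψ) : (qubitStrategy α β ψ hψ).value = ω := by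
  have hρ : ((qubitStrategy α β ψ hψ).ρ * bellOperator α β).trace = ω := by
    rw [Matrix.trace_mul_comm]
    change (bellOperator α β * vecMulVec ψ (star ψ)).trace = _
    rw [Matrix.mul_vecMulVec, h, Matrix.smul_vecMulVec, Matrix.trace_smul, (isDensity_pure ψ hψ).2,
      smul_eq_mul, mul_one]
  have h4 : (1 / 4 : ℂ) = ((1 / 4 : ℝ) : ℂ) := by push_cast; rfl
  have := congrArg Complex.re hρ
  rw [Complex.ofReal_re] at this
  rw [← this, bellOperator, h4]
  simp only [Matrix.mul_sum, Matrix.mul_smul, Matrix.trace_sum, Matrix.trace_smul, smul_eq_mul,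
    Complex.re_sum, Complex.re_ofReal_mul]
  rfl

theorem isGreatest_quantum :
    IsGreatest {v : ℝ | ∃ (m n : ℕ) (S : Strategy (Fin m) (Fin n)), S.value = v} omegaQ := by
  constructor
  · obtain ⟨ψ, hψ, h⟩ := exists_eigenvector (θ := alphaOpt) rfl
    exact ⟨2, 2, qubitStrategy alphaOpt alphaOpt ψ hψ, qubitStrategy_value hψ h⟩
  · rintro v ⟨m, n, S, rfl⟩
    exact S.value_le

end

end NonlocalGame

namespace NonlocalGame

open Matrix
open scoped Kronecker ComplexOrder

noncomputable section

/-! ### Expectation values of density matrices -/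

section Expectation

variable {n : Type*} [Fintype n] [DecidableEq n]

theorem trace_mul_re_nonneg {σ M : Matrix n n ℂ} (hσ : σ.PosSemidef) (hM : M.PosSemidef) :
    0 ≤ (σ * M).trace.re := by
  obtain ⟨R, hR, rfl⟩ := exists_hermitian_sqrt hσ
  have := (Complex.le_def.1 (hM.conjTranspose_mul_mul_same R).trace_nonneg).1
  rwa [hR.eq, Matrix.trace_mul_comm, ← Matrix.mul_assoc] at this

theorem mul_eq_zero_of_trace_mul_re_eq_zero {σ M : Matrix n n ℂ} (hσ : σ.PosSemidef)
    (hM : M.PosSemidef) (h : (σ * M).trace.re = 0) : M * σ = 0 := by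
  obtain ⟨R, hR, rfl⟩ := exists_hermitian_sqrt hσ
  obtain ⟨K, hK, rfl⟩ := exists_hermitian_sqrt hM
  have : K * R = 0 := by
    apply eq_zero_of_traceForm_self
    rw [traceForm_apply, ← h, conjTranspose_mul, hK.eq, hR.eq, Matrix.mul_assoc R R,
      Matrix.trace_mul_comm R (R * _)]
    simp only [Matrix.mul_assoc]
  rw [Matrix.mul_assoc, ← Matrix.mul_assoc K R, this, Matrix.zero_mul, Matrix.mul_zero]

theorem IsDensity.smul_of_posSemidef {X : Matrix n n ℂ} (hX : X.PosSemidef)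
    (h : 0 < X.trace.re) : IsDensity (((X.trace.re : ℂ)⁻¹) • X) := by
  have hc : (X.trace.re : ℂ) = X.trace := by
    have := (Complex.le_def.1 hX.trace_nonneg).2
    apply Complex.ext <;> simp_all
  refine ⟨?_, ?_⟩
  · rw [← Complex.ofReal_inv]
    exact hX.smul (by exact_mod_cast (inv_nonneg.2 h.le))
  · rw [Matrix.trace_smul, smul_eq_mul, hc, inv_mul_cancel₀]
    rw [← hc]
    exact_mod_cast h.ne'

theorem trace_mul_re_le_of_density {N : Matrix n n ℂ} {ν : ℝ}
    (h : ∀ τ : Matrix n n ℂ, IsDensity τ → (τ * N).trace.re ≤ ν) {X : Matrix n n ℂ}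
    (hX : X.PosSemidef) : (X * N).trace.re ≤ ν * X.trace.re := by
  rcases (Complex.le_def.1 hX.trace_nonneg).1.eq_or_lt with h0 | h0
  · have := mul_eq_zero_of_trace_mul_re_eq_zero hX PosSemidef.one (by rw [mul_one]; exact h0.symm)
    rw [one_mul] at this
    simp [this]
  · have := h _ (IsDensity.smul_of_posSemidef hX h0)
    rw [Matrix.smul_mul, Matrix.trace_smul, smul_eq_mul, ← Complex.ofReal_inv,
      Complex.re_ofReal_mul, inv_mul_le_iff₀ h0] at this
    linarith

theorem posSemidef_sub_of_density {N : Matrix n n ℂ} (hN : N.IsHermitian) {ν : ℝ}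
    (h : ∀ τ : Matrix n n ℂ, IsDensity τ → (τ * N).trace.re ≤ ν) :
    ((ν : ℂ) • (1 : Matrix n n ℂ) - N).PosSemidef := by
  have hH : ((ν : ℂ) • (1 : Matrix n n ℂ) - N).IsHermitian := by
    rw [IsHermitian, conjTranspose_sub, hN.eq, conjTranspose_smul, conjTranspose_one]
    simp
  refine PosSemidef.of_dotProduct_mulVec_nonneg hH fun x => ?_
  have hx := trace_mul_re_le_of_density h (posSemidef_vecMulVec_self_star x)
  have hd : star x ⬝ᵥ ((ν : ℂ) • (1 : Matrix n n ℂ) - N) *ᵥ x =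
      (vecMulVec x (star x) * ((ν : ℂ) • (1 : Matrix n n ℂ) - N)).trace := by
    rw [Matrix.trace_mul_comm, Matrix.mul_vecMulVec, trace_vecMulVec, dotProduct_comm]
  have him := hH.im_star_dotProduct_mulVec_self x
  rw [Complex.le_def]
  refine ⟨?_, him.symm⟩
  rw [hd, Matrix.mul_sub, Matrix.trace_sub, Matrix.mul_smul, mul_one, Matrix.trace_smul, smul_eq_mul,
    Complex.sub_re, Complex.re_ofReal_mul, Complex.zero_re]
  linarith

/-- A state in which an observable has nonzero variance does not maximise its expectation value. -/
theorem exists_density_gt {N σ : Matrix n n ℂ} (hN : N.IsHermitian) (hσ : IsDensity σ)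
    (h : (σ * (N * N)).trace.re ≠ (σ * N).trace.re ^ 2) :
    ∃ τ : Matrix n n ℂ, IsDensity τ ∧ (σ * N).trace.re < (τ * N).trace.re := by
  by_contra! hcon
  set ν := (σ * N).trace.re with hν
  -- If `ν` is the maximum, `ν - N` is positive with expectation zero in `σ`, so `N σ = ν σ` and the
  -- variance vanishes.
  have h0 := mul_eq_zero_of_trace_mul_re_eq_zero hσ.1 (posSemidef_sub_of_density hN hcon) (by
    rw [Matrix.mul_sub, Matrix.trace_sub, Matrix.mul_smul, mul_one, Matrix.trace_smul, hσ.2,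
      smul_eq_mul, mul_one, Complex.sub_re, Complex.ofReal_re, ← hν, sub_self])
  rw [Matrix.sub_mul, Matrix.smul_mul, one_mul, sub_eq_zero] at h0
  apply h
  rw [Matrix.trace_mul_comm, Matrix.mul_assoc, ← h0, Matrix.mul_smul, ← h0, Matrix.trace_smul,
    Matrix.trace_smul, hσ.2, smul_eq_mul, smul_eq_mul, mul_one, ← Complex.ofReal_mul,
    Complex.ofReal_re, sq]

/-- The eigenvalues are `±ν`, and the normalised spectral projection `(ν + N)/(2ν)` attains the
maximum. -/
theorem isGreatest_expectation {N : Matrix (Fin 2) (Fin 2) ℂ} (hN : N.IsHermitian)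
    (htr : N.trace = 0) {ν : ℝ} (hν : 0 < ν) (hsq : N * N = ((ν ^ 2 : ℝ) : ℂ) • 1) :
    IsGreatest {v : ℝ | ∃ σ : Matrix (Fin 2) (Fin 2) ℂ, IsDensity σ ∧ (σ * N).trace.re = v} ν := by
  have hνc : (ν : ℂ) ≠ 0 := by exact_mod_cast hν.ne'
  have hpos : ∀ M : Matrix (Fin 2) (Fin 2) ℂ, M.IsHermitian → M * M = ((ν ^ 2 : ℝ) : ℂ) • 1 →
      ((ν : ℂ) • 1 + M).PosSemidef := fun M hM hMM => by
    have hH : ((ν : ℂ) • 1 + M).IsHermitian := by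
      rw [IsHermitian, conjTranspose_add, hM.eq, conjTranspose_smul, conjTranspose_one]
      simp
    have : (ν : ℂ) • 1 + M = (((2 * ν)⁻¹ : ℝ) : ℂ) • (((ν : ℂ) • 1 + M)ᴴ * ((ν : ℂ) • 1 + M)) := by
      rw [hH.eq, Matrix.mul_add, Matrix.add_mul, Matrix.add_mul, hMM]
      simp only [Matrix.smul_mul, Matrix.mul_smul, one_mul, mul_one]
      push_cast
      match_scalars <;> field_simp <;> ring
    rw [this]
    exact (posSemidef_conjTranspose_mul_self _).smul (by
      exact_mod_cast (inv_nonneg.2 (by positivity : (0 : ℝ) ≤ 2 * ν)))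
  constructor
  · refine ⟨(((2 * ν)⁻¹ : ℝ) : ℂ) • ((ν : ℂ) • 1 + N), ⟨(hpos N hN hsq).smul (by
      exact_mod_cast (inv_nonneg.2 (by positivity : (0 : ℝ) ≤ 2 * ν))), ?_⟩, ?_⟩
    · rw [Matrix.trace_smul, Matrix.trace_add, htr, Matrix.trace_smul, Matrix.trace_one]
      simp
      field_simp
    · rw [Matrix.smul_mul, Matrix.add_mul, Matrix.smul_mul, one_mul, hsq, Matrix.trace_smul,
        Matrix.trace_add, Matrix.trace_smul, Matrix.trace_smul, htr, Matrix.trace_one]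
      simp only [smul_eq_mul, mul_zero, zero_add, Fintype.card_fin, Complex.re_ofReal_mul]
      simp
      field_simp
  · rintro v ⟨σ, hσ, rfl⟩
    have h := trace_mul_re_nonneg hσ.1 (hpos (-N) hN.neg (by rw [neg_mul_neg, hsq]))
    rw [Matrix.mul_add, Matrix.mul_smul, mul_one, Matrix.mul_neg, Matrix.trace_add, Matrix.trace_neg,
      Matrix.trace_smul, hσ.2, smul_eq_mul, mul_one, Complex.add_re, Complex.neg_re,
      Complex.ofReal_re] at h
    linarith

end Expectation

end

end NonlocalGame

namespace NonlocalGame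

open Matrix
open scoped Kronecker ComplexOrder

noncomputable section

namespace Strategy

variable {ι κ : Type*} [Fintype ι] [Fintype κ] [DecidableEq ι] [DecidableEq κ] (S : Strategy ι κ)

/-! ### Steered states -/

theorem trace_assemblageBob_mul (x a : Fin 2) (M : Matrix κ κ ℂ) :
    (S.assemblageBob x a * M).trace.re = S.corr (S.A x a) M := by
  rw [Matrix.trace_mul_comm, assemblageBob, ← traceA_one_kronecker_mul, trace_traceA,
    ← Matrix.mul_assoc, ← Matrix.mul_kronecker_mul, one_mul, mul_one, corr, Matrix.trace_mul_comm]

theorem probAlice_eq_corr (x a : Fin 2) : S.probAlice x a = S.corr (S.A x a) 1 := by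
  rw [← trace_assemblageBob_mul, mul_one, probAlice]

theorem trace_steeredBob_mul (x a : Fin 2) (M : Matrix κ κ ℂ) :
    (S.steeredBob x a * M).trace.re = S.corr (S.A x a) M / S.probAlice x a := by
  rw [steeredBob, Matrix.smul_mul, Matrix.trace_smul, smul_eq_mul, ← Complex.ofReal_inv,
    Complex.re_ofReal_mul, trace_assemblageBob_mul, inv_mul_eq_div]

theorem traceA_mul_kronecker_one (K : Matrix ι ι ℂ) (X : Matrix (ι × κ) (ι × κ) ℂ) :
    traceA ((K ⊗ₖ (1 : Matrix κ κ ℂ)) * X) = traceA (X * (K ⊗ₖ (1 : Matrix κ κ ℂ))) := by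
  ext j j'
  simp only [traceA, Matrix.of_apply, Matrix.mul_apply, Fintype.sum_prod_type, kroneckerMap_apply,
    Matrix.one_apply, mul_ite, mul_one, mul_zero, ite_mul, zero_mul, Finset.sum_ite_eq,
    Finset.sum_ite_eq', Finset.mem_univ, if_true]
  rw [Finset.sum_comm]
  exact Finset.sum_congr rfl fun i _ => Finset.sum_congr rfl fun i' _ => mul_comm _ _

theorem traceA_posSemidef {X : Matrix (ι × κ) (ι × κ) ℂ} (hX : X.PosSemidef) :
    (traceA X).PosSemidef := by
  have : traceA X = ∑ i, X.submatrix (fun j => (i, j)) (fun j => (i, j)) := by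
    ext j j'
    simp [traceA, Matrix.sum_apply]
  rw [this]
  exact posSemidef_sum _ fun i _ => hX.submatrix _

/-- With `K = √(A x a)`, partial cyclicity rewrites the conditional state as the partial trace of
`(K ⊗ 1) ρ (K ⊗ 1)`. -/
theorem assemblageBob_posSemidef (x a : Fin 2) : (S.assemblageBob x a).PosSemidef := by
  obtain ⟨K, hK, hKK⟩ := exists_hermitian_sqrt (S.A_pos x a)
  have hK' : (K ⊗ₖ (1 : Matrix κ κ ℂ))ᴴ = K ⊗ₖ (1 : Matrix κ κ ℂ) := by
    rw [conjTranspose_kronecker, hK.eq, conjTranspose_one]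
  have h := traceA_posSemidef (S.density.1.mul_mul_conjTranspose_same (K ⊗ₖ (1 : Matrix κ κ ℂ)))
  rw [hK', Matrix.mul_assoc, traceA_mul_kronecker_one, Matrix.mul_assoc, ← Matrix.mul_kronecker_mul,
    hKK, mul_one, ← traceA_mul_kronecker_one] at h
  exact h

theorem steeredBob_density {x a : Fin 2} (h : 0 < S.probAlice x a) :
    IsDensity (S.steeredBob x a) :=
  IsDensity.smul_of_posSemidef (S.assemblageBob_posSemidef x a) h

/-! ### The uncertainty expressions -/

theorem uncertBob_le_one (x a : Fin 2) {σ : Matrix κ κ ℂ} (hσ : IsDensity σ) :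
    S.uncertBob x a σ ≤ 1 := by
  have hV : ∀ b y, V a b x y ≤ 1 := fun b y => by
    unfold V
    split_ifs <;> norm_num
  have hs : ∀ y, ∑ b, (σ * S.B y b).trace.re = 1 := fun y => by
    rw [← Complex.re_sum, ← Matrix.trace_sum, ← Matrix.mul_sum, S.B_sum, mul_one, hσ.2,
      Complex.one_re]
  calc S.uncertBob x a σ ≤ ∑ y : Fin 2, ∑ b, 1 / 2 * (σ * S.B y b).trace.re := by
        refine Finset.sum_le_sum fun y _ => Finset.sum_le_sum fun b _ => ?_
        have h0 := trace_mul_re_nonneg hσ.1 (S.B_pos y b)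
        exact mul_le_mul_of_nonneg_right (by linarith [hV b y]) h0
    _ = 1 := by
        simp only [← Finset.mul_sum, hs]
        norm_num

theorem uncertBob_le_xiBob (x a : Fin 2) {σ : Matrix κ κ ℂ} (hσ : IsDensity σ) :
    S.uncertBob x a σ ≤ S.xiBob x a :=
  le_csSup ⟨1, by rintro v ⟨τ, hτ, rfl⟩; exact S.uncertBob_le_one x a hτ⟩ ⟨σ, hσ, rfl⟩

theorem value_eq_sum_uncertBob (h : ∀ x a, 0 < S.probAlice x a) :
    S.value = ∑ x, ∑ a, 1 / 2 * S.probAlice x a * S.uncertBob x a (S.steeredBob x a) := by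
  have hu : ∀ x a, S.probAlice x a * S.uncertBob x a (S.steeredBob x a) =
      ∑ y, ∑ b, 1 / 2 * V a b x y * S.box a b x y := fun x a => by
    rw [uncertBob, Finset.mul_sum]
    refine Finset.sum_congr rfl fun y _ => ?_
    rw [Finset.mul_sum]
    refine Finset.sum_congr rfl fun b _ => ?_
    rw [trace_steeredBob_mul, box_eq_corr]
    field_simp [(h x a).ne']
  simp only [mul_assoc, hu]
  simp only [value, gameValue, Fin.sum_univ_two]
  ring

/-- The observable whose expectation value determines the uncertainty expression for `(x, a)`. -/
def certObs (x a : Fin 2) : Matrix κ κ ℂ :=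
  ![![S.obsB 0 + S.obsB 1, -(S.obsB 0 + S.obsB 1)], ![S.obsB 1 - S.obsB 0, S.obsB 0]] x a

/-- For `(x, a) = (1, 1)` no output wins on `y = 1`, so that input contributes nothing; hence the
smaller constant. -/
theorem uncertBob_eq {σ : Matrix κ κ ℂ} (hσ : σ.trace = 1) (x a : Fin 2) :
    S.uncertBob x a σ = if (x, a) = (1, 1) then 1 / 4 + 1 / 4 * (σ * S.certObs x a).trace.re
      else 1 / 2 + 1 / 4 * (σ * S.certObs x a).trace.re := by
  have h11 : (1 + 1 : Fin 2) = 0 := rfl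
  have hh : ∀ M : Matrix κ κ ℂ, (σ * ((1 / 2 : ℂ) • M)).trace.re = 1 / 2 * (σ * M).trace.re :=
    fun M => by
      have : (1 / 2 : ℂ) = ((1 / 2 : ℝ) : ℂ) := by push_cast; rfl
      rw [this, Matrix.mul_smul, Matrix.trace_smul, smul_eq_mul, Complex.re_ofReal_mul]
  have h1 : (σ * 1).trace.re = 1 := by rw [mul_one, hσ, Complex.one_re]
  have ha : ∀ M N : Matrix κ κ ℂ, (σ * (M + N)).trace.re = (σ * M).trace.re + (σ * N).trace.re :=
    fun M N => by rw [Matrix.mul_add, Matrix.trace_add, Complex.add_re]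
  have hs : ∀ M N : Matrix κ κ ℂ, (σ * (M - N)).trace.re = (σ * M).trace.re - (σ * N).trace.re :=
    fun M N => by rw [Matrix.mul_sub, Matrix.trace_sub, Complex.sub_re]
  have hn : ∀ M : Matrix κ κ ℂ, (σ * -M).trace.re = -(σ * M).trace.re :=
    fun M => by rw [Matrix.mul_neg, Matrix.trace_neg, Complex.neg_re]
  fin_cases x <;> fin_cases a <;>
  · simp only [uncertBob, certObs, V, Fin.sum_univ_two, B_zero_zero, B_zero_one, B_one_zero,
      B_one_one, hh, h1, ha, hs, hn, h11, Fin.zero_eta, Fin.mk_one, Matrix.cons_val_zero,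
      Matrix.cons_val_one, Prod.mk.injEq, one_ne_zero, zero_ne_one, add_zero, zero_add,
      and_self, and_true, and_false, false_and, true_and, if_true, if_false]
    ring

theorem certObs_isHermitian (x a : Fin 2) : (S.certObs x a).IsHermitian := by
  have h0 := S.obsB_isHermitian 0
  have h1 := S.obsB_isHermitian 1
  fin_cases x <;> fin_cases a
  · exact h0.add h1
  · exact (h0.add h1).neg
  · exact h1.sub h0
  · exact h0

/-- Divided by `P(a|x)²`, the hypothesis says that `certObs x a` has positive variance in the
steered state, which therefore cannot maximise its expectation. -/
theorem not_isMaxCertainBob_of_variance {x a : Fin 2} (hp : 0 < S.probAlice x a)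
    (h : S.corr (S.A x a) (S.certObs x a) ^ 2 <
      S.corr (S.A x a) (S.certObs x a * S.certObs x a) * S.probAlice x a) :
    ¬ S.IsMaxCertainBob x a (S.steeredBob x a) ∧
      S.uncertBob x a (S.steeredBob x a) < S.xiBob x a := by
  have hd := S.steeredBob_density hp
  obtain ⟨σ, hσ, hlt⟩ := exists_density_gt (S.certObs_isHermitian x a) hd (by
    rw [trace_steeredBob_mul, trace_steeredBob_mul, div_pow, Ne, div_eq_div_iff hp.ne'
      (pow_pos hp 2).ne']
    intro he
    have : S.corr (S.A x a) (S.certObs x a * S.certObs x a) * S.probAlice x a =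
        S.corr (S.A x a) (S.certObs x a) ^ 2 := by
      apply mul_right_cancel₀ hp.ne'
      linarith
    linarith)
  have hlt' : S.uncertBob x a (S.steeredBob x a) < S.uncertBob x a σ := by
    rw [S.uncertBob_eq hd.2, S.uncertBob_eq hσ.2]
    split_ifs <;> linarith
  exact ⟨fun hc => absurd (hc.2 σ hσ) (not_le.2 hlt'), hlt'.trans_le (S.uncertBob_le_xiBob x a hσ)⟩

end Strategy

end

end NonlocalGame

namespace NonlocalGame

open Matrix
open scoped Kronecker ComplexOrder

noncomputable section

local notation "τ" => tanSq

namespace Strategy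

variable {ι κ : Type*} [Fintype ι] [Fintype κ] [DecidableEq ι] [DecidableEq κ] (S : Strategy ι κ)

/-! ### Steering in optimal strategies -/

theorem corr_eq_trace_act (M : Matrix ι ι ℂ) (N : Matrix κ κ ℂ) :
    S.corr M N = (actA κ M (actB ι N S.ρ)).trace.re := by
  rw [actA_actB, corr, Matrix.trace_mul_comm]

theorem corr_neg_right (M : Matrix ι ι ℂ) (N : Matrix κ κ ℂ) : S.corr M (-N) = -S.corr M N := by
  rw [corr_eq_trace_act, corr_eq_trace_act, actB_neg_apply, map_neg, Matrix.trace_neg,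
    Complex.neg_re]

theorem corr_obsB_mul_self (hS : S.value = omegaQ) (M : Matrix ι ι ℂ) (y : Fin 2) :
    S.corr M (S.obsB y * S.obsB y) = S.corr M 1 := by
  have h := (S.optimalRelations hS).sq_b y
  rw [actB_actB] at h
  rw [corr_eq_trace_act, corr_eq_trace_act, h, actB_one_apply]

theorem corr_obsB_anticomm (hS : S.value = omegaQ) (M : Matrix ι ι ℂ) :
    S.corr M (S.obsB 0 * S.obsB 1) + S.corr M (S.obsB 1 * S.obsB 0) =
      -(2 * Real.cos alphaOpt * S.corr M 1) := by
  simp only [corr_eq_trace_act, actB_one_apply]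
  rw [← Complex.add_re, ← Matrix.trace_add, ← map_add, S.anticomm_obsB hS, map_neg, map_smul,
    Matrix.trace_neg, Matrix.trace_smul, Complex.neg_re, Complex.smul_re, smul_eq_mul]

theorem corr_obsB_add_sq (hS : S.value = omegaQ) (M : Matrix ι ι ℂ) :
    S.corr M ((S.obsB 0 + S.obsB 1) * (S.obsB 0 + S.obsB 1)) =
      (2 - 2 * Real.cos alphaOpt) * S.corr M 1 := by
  have h := S.corr_obsB_anticomm hS M
  rw [Matrix.mul_add, Matrix.add_mul, Matrix.add_mul, corr_add_right, corr_add_right, corr_add_right,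
    S.corr_obsB_mul_self hS, S.corr_obsB_mul_self hS]
  linarith

theorem probAlice_pos (hS : S.value = omegaQ) (x a : Fin 2) : 0 < S.probAlice x a := by
  obtain ⟨h1, h2, -⟩ := S.corr_optimal hS
  have t1 := tanSq_gt
  have t2 := tanSq_lt
  rw [probAlice_eq_corr]
  fin_cases x <;> fin_cases a <;>
  · simp only [Fin.zero_eta, Fin.mk_one, A_zero, A_one, corr_half_left, corr_add_left,
      corr_sub_left, corr_one_one, h1, h2]
    nlinarith

theorem steering_fails (hS : S.value = omegaQ) (x a : Fin 2)
    (hxa : (x, a) = (0, 0) ∨ (x, a) = (0, 1) ∨ (x, a) = (1, 1)) :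
    0 < S.probAlice x a ∧ ¬ S.IsMaxCertainBob x a (S.steeredBob x a) ∧
      S.uncertBob x a (S.steeredBob x a) < S.xiBob x a := by
  have hp := S.probAlice_pos hS x a
  refine ⟨hp, S.not_isMaxCertainBob_of_variance hp ?_⟩
  obtain ⟨h1, h2, h3, h4, h5, h6, h7, h8⟩ := S.corr_optimal hS
  have t1 := tanSq_gt
  have t2 := tanSq_lt
  have s1 : 1.9394 < τ ^ 2 := by nlinarith
  have s2 : τ ^ 2 < 1.9395 := by nlinarith
  -- Reduces each variance inequality to rational bounds: `u` from above on the correlation, `v` and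
  -- `w` from below on the probability and on the value of the squared observable.
  have hlt : ∀ {x p μ u v w : ℝ}, 0 ≤ x → x ≤ u → 0 ≤ v → v ≤ p → 0 ≤ w → w ≤ μ →
      u ^ 2 < w * v ^ 2 → x ^ 2 < μ * p * p := fun hx hxu hv hvp hw hwμ h => by
    rw [mul_assoc, ← sq]
    exact ((pow_le_pow_left₀ hx hxu 2).trans_lt h).trans_le
      (mul_le_mul hwμ (pow_le_pow_left₀ hv hvp 2) (by positivity) (hw.trans hwμ))
  rcases hxa with h | h | h <;> obtain ⟨rfl, rfl⟩ := Prod.mk.inj h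
  · have hc : S.certObs 0 0 = S.obsB 0 + S.obsB 1 := rfl
    rw [hc, S.corr_obsB_add_sq hS, cos_alphaOpt, probAlice_eq_corr]
    simp only [A_zero, corr_half_left, corr_add_left, corr_add_right, corr_one_one, h1, h3, h4, h5,
      h6]
    exact hlt (u := 0.81) (v := 0.58) (w := 2.3) (by linarith) (by linarith) (by norm_num)
      (by linarith) (by norm_num) (by linarith) (by norm_num)
  · have hc : S.certObs 0 1 = -(S.obsB 0 + S.obsB 1) := rfl
    rw [hc, neg_mul_neg, S.corr_obsB_add_sq hS, cos_alphaOpt, probAlice_eq_corr]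
    simp only [A_one, corr_half_left, corr_sub_left, corr_neg_right, corr_add_right, corr_one_one,
      h1, h3, h4, h5, h6]
    exact hlt (u := 0.58) (v := 0.41) (w := 2.3) (by linarith) (by linarith) (by norm_num)
      (by linarith) (by norm_num) (by linarith) (by norm_num)
  · have hc : S.certObs 1 1 = S.obsB 0 := rfl
    rw [hc, S.corr_obsB_mul_self hS, probAlice_eq_corr]
    simp only [A_one, corr_half_left, corr_sub_left, corr_one_one, h2, h3, h7]
    have := hlt (μ := 1) (x := 1 / 2 * (1 / 3 - 2 / 3 * τ + 2 / 9 * τ ^ 2 -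
        -(59 / 261 - 82 / 261 * τ + 382 / 783 * τ ^ 2)))
      (p := 1 / 2 * (1 - (65 / 87 - 52 / 87 * τ + 64 / 261 * τ ^ 2))) (u := 0.29) (v := 0.3) (w := 1) (by linarith) (by linarith) (by norm_num)
      (by linarith) (by norm_num) le_rfl (by norm_num)
    rwa [one_mul] at this

theorem value_lt_upBoundBob (hS : S.value = omegaQ) : S.value < S.upBoundBob := by
  have hp := S.probAlice_pos hS
  have h00 := (S.steering_fails hS 0 0 (by simp)).2.2
  have h01 := (S.steering_fails hS 0 1 (by simp)).2.2
  have h11 := (S.steering_fails hS 1 1 (by simp)).2.2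
  have h10 := S.uncertBob_le_xiBob 1 0 (S.steeredBob_density (hp 1 0))
  rw [S.value_eq_sum_uncertBob hp, upBoundBob]
  simp only [Fin.sum_univ_two]
  have := mul_lt_mul_of_pos_left h00 (hp 0 0)
  have := mul_lt_mul_of_pos_left h01 (hp 0 1)
  have := mul_lt_mul_of_pos_left h11 (hp 1 1)
  have := mul_le_mul_of_nonneg_left h10 (hp 1 0).le
  linarith

/-- The conditional expectation of `obsB 1 - obsB 0` is exactly `2 cos (α*/2)`, the largest
eigenvalue of this observable in the qubit strategy; so this steering succeeds. -/
theorem uncertBob_steeredBob_one_zero (hS : S.value = omegaQ) :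
    S.uncertBob 1 0 (S.steeredBob 1 0) = (1 + Real.cos (alphaOpt / 2)) / 2 := by
  have hp := S.probAlice_pos hS 1 0
  obtain ⟨h1, h2, h3, h4, h5, h6, h7, h8⟩ := S.corr_optimal hS
  have hc : S.certObs 1 0 = S.obsB 1 - S.obsB 0 := rfl
  have hd : 1 - τ + τ ^ 2 ≠ 0 := by nlinarith [tanSq_gt]
  have key : S.corr (S.A 1 0) (S.obsB 1 - S.obsB 0) =
      2 * (1 / (1 - τ + τ ^ 2)) * S.probAlice 1 0 := by
    rw [probAlice_eq_corr]
    simp only [A_zero, corr_half_left, corr_add_left, corr_sub_right, corr_one_one, h2, h3, h4, h7,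
      h8]
    field_simp
    grind [tanSq_cubic]
  rw [S.uncertBob_eq (S.steeredBob_density hp).2, if_neg (by simp), trace_steeredBob_mul, hc, key,
    cos_alphaOpt_half]
  field_simp
  ring

/-! ### Uncertainty relations of a qubit -/

theorem xiBob_eq (T : Strategy ι (Fin 2)) {x a : Fin 2} {ν : ℝ} (hν : 0 < ν)
    (htr : (T.certObs x a).trace = 0)
    (hsq : T.certObs x a * T.certObs x a = ((ν ^ 2 : ℝ) : ℂ) • 1) :
    T.xiBob x a = if (x, a) = (1, 1) then 1 / 4 + 1 / 4 * ν else 1 / 2 + 1 / 4 * ν := by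
  obtain ⟨⟨σ, hσ, hmax⟩, hle⟩ := isGreatest_expectation (T.certObs_isHermitian x a) htr hν hsq
  refine IsGreatest.csSup_eq ⟨⟨σ, hσ, by rw [T.uncertBob_eq hσ.2, hmax]⟩, ?_⟩
  rintro v ⟨σ', hσ', rfl⟩
  have := hle ⟨σ', hσ', rfl⟩
  rw [T.uncertBob_eq hσ'.2]
  split_ifs <;> linarith

/-- The anticommutator makes the certainty observables square to `2 - 2 cos α* = (2 sin (α*/2))²`,
`2 + 2 cos α* = (2 cos (α*/2))²` and `1`. -/
theorem xiBob_values (T : Strategy ι (Fin 2)) (htr : ∀ y, (T.obsB y).trace = 0)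
    (hsq : ∀ y, T.obsB y * T.obsB y = 1)
    (hanti : T.obsB 0 * T.obsB 1 + T.obsB 1 * T.obsB 0 = -((2 * Real.cos alphaOpt : ℝ) : ℂ) • 1) :
    T.xiBob 0 0 = (1 + Real.sin (alphaOpt / 2)) / 2 ∧
    T.xiBob 0 1 = (1 + Real.sin (alphaOpt / 2)) / 2 ∧
    T.xiBob 1 0 = (1 + Real.cos (alphaOpt / 2)) / 2 ∧
    T.xiBob 1 1 = 1 / 2 := by
  have h2 : Real.cos alphaOpt = 2 * Real.cos (alphaOpt / 2) ^ 2 - 1 := by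
    rw [← Real.cos_two_mul]; congr 1; ring
  have hs := Real.sin_sq_add_cos_sq (alphaOpt / 2)
  have hadd : (T.obsB 0 + T.obsB 1) * (T.obsB 0 + T.obsB 1) =
      (((2 * Real.sin (alphaOpt / 2)) ^ 2 : ℝ) : ℂ) • 1 := by
    have e : (2 * Real.sin (alphaOpt / 2)) ^ 2 = 2 - 2 * Real.cos alphaOpt := by
      rw [h2]; linarith
    rw [e, Matrix.mul_add, Matrix.add_mul, Matrix.add_mul, hsq, hsq]
    linear_combination (norm := skip) hanti
    push_cast
    module
  have hsub : (T.obsB 1 - T.obsB 0) * (T.obsB 1 - T.obsB 0) =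
      (((2 * Real.cos (alphaOpt / 2)) ^ 2 : ℝ) : ℂ) • 1 := by
    have e : (2 * Real.cos (alphaOpt / 2)) ^ 2 = 2 + 2 * Real.cos alphaOpt := by
      rw [h2]; linarith
    rw [e, Matrix.mul_sub, Matrix.sub_mul, Matrix.sub_mul, hsq, hsq]
    linear_combination (norm := skip) (-1 : ℂ) • hanti
    push_cast
    module
  have p1 : 0 < 2 * Real.sin (alphaOpt / 2) := by linarith [sin_alphaOpt_half_pos]
  have p2 : 0 < 2 * Real.cos (alphaOpt / 2) := by linarith [cos_alphaOpt_half_pos]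
  have c00 : T.certObs 0 0 = T.obsB 0 + T.obsB 1 := rfl
  have c01 : T.certObs 0 1 = -(T.obsB 0 + T.obsB 1) := rfl
  have c10 : T.certObs 1 0 = T.obsB 1 - T.obsB 0 := rfl
  have c11 : T.certObs 1 1 = T.obsB 0 := rfl
  refine ⟨?_, ?_, ?_, ?_⟩
  · rw [T.xiBob_eq p1 (by rw [c00, Matrix.trace_add, htr, htr, add_zero]) (by rw [c00, hadd]),
      if_neg (by simp)]
    ring
  · rw [T.xiBob_eq p1 (by rw [c01, Matrix.trace_neg, Matrix.trace_add, htr, htr, add_zero, neg_zero])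
      (by rw [c01, neg_mul_neg, hadd]), if_neg (by simp)]
    ring
  · rw [T.xiBob_eq p2 (by rw [c10, Matrix.trace_sub, htr, htr, sub_zero]) (by rw [c10, hsub]),
      if_neg (by simp)]
    ring
  · rw [T.xiBob_eq one_pos (by rw [c11, htr]) (by rw [c11, hsq]; simp), if_pos rfl]
    ring

theorem isMaxCertainBob_one_zero (T : Strategy ι (Fin 2)) (hT : T.value = omegaQ)
    (hξ : T.xiBob 1 0 = (1 + Real.cos (alphaOpt / 2)) / 2) :
    T.IsMaxCertainBob 1 0 (T.steeredBob 1 0) :=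
  ⟨T.steeredBob_density (T.probAlice_pos hT 1 0), fun σ hσ => by
    rw [T.uncertBob_steeredBob_one_zero hT, ← hξ]
    exact T.uncertBob_le_xiBob 1 0 hσ⟩

end Strategy

end

end NonlocalGame

namespace NonlocalGame

open Matrix
open scoped Kronecker ComplexOrder

noncomputable section

/-! ### Exchanging the parties -/

/-- With the sign convention of `obsB`, this is the exchange `a₀ ↔ -b₀`, `a₁ ↔ b₁` of
`OptimalRelations.swap`. -/
theorem V_swap (a b x y : Fin 2) : V (1 - b) (1 - a) y x = V a b x y := by
  fin_cases a <;> fin_cases b <;> fin_cases x <;> fin_cases y <;> simp [V]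

theorem sum_one_sub {M : Type*} [AddCommMonoid M] (f : Fin 2 → M) :
    ∑ a, f (1 - a) = ∑ a, f a := by
  rw [Fin.sum_univ_two, Fin.sum_univ_two, add_comm]
  rfl

namespace Strategy

variable {ι κ : Type*} [Fintype ι] [Fintype κ] [DecidableEq ι] [DecidableEq κ] (S : Strategy ι κ)

/-- The strategy in which the parties exchange their roles and flip their outputs. -/
def swap : Strategy κ ι where
  ρ := S.ρ.submatrix Prod.swap Prod.swap
  A x a := S.B x (1 - a)
  B y b := S.A y (1 - b)
  density := by
    refine ⟨S.density.1.submatrix _, ?_⟩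
    rw [← S.density.2]
    exact Equiv.sum_comp (Equiv.prodComm κ ι) fun i => S.ρ i i
  A_pos _ _ := S.B_pos _ _
  A_sum x := by rw [sum_one_sub fun a => S.B x a, S.B_sum]
  B_pos _ _ := S.A_pos _ _
  B_sum y := by rw [sum_one_sub fun b => S.A y b, S.A_sum]

theorem kronecker_swap (M : Matrix ι ι ℂ) (N : Matrix κ κ ℂ) :
    N ⊗ₖ M = (M ⊗ₖ N).submatrix Prod.swap Prod.swap := by
  ext ⟨i, j⟩ ⟨i', j'⟩
  simp [mul_comm]

theorem kronecker_mul_swap (M : Matrix ι ι ℂ) (N : Matrix κ κ ℂ)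
    (X : Matrix (ι × κ) (ι × κ) ℂ) :
    (N ⊗ₖ M) * X.submatrix Prod.swap Prod.swap =
      ((M ⊗ₖ N) * X).submatrix Prod.swap Prod.swap := by
  rw [kronecker_swap]
  exact submatrix_mul_equiv _ _ _ (Equiv.prodComm κ ι) _

theorem swap_box (a b x y : Fin 2) : S.swap.box a b x y = S.box (1 - b) (1 - a) y x := by
  have h : (S.swap.ρ * (S.B x (1 - a) ⊗ₖ S.A y (1 - b))).trace =
      (S.ρ * (S.A y (1 - b) ⊗ₖ S.B x (1 - a))).trace := by
    rw [Matrix.trace_mul_comm, Matrix.trace_mul_comm S.ρ]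
    change ((S.B x (1 - a) ⊗ₖ S.A y (1 - b)) * S.ρ.submatrix Prod.swap Prod.swap).trace = _
    rw [kronecker_mul_swap]
    exact Equiv.sum_comp (Equiv.prodComm κ ι)
      fun i => ((S.A y (1 - b) ⊗ₖ S.B x (1 - a)) * S.ρ) i i
  exact congrArg Complex.re h

theorem swap_value : S.swap.value = S.value := by
  simp only [value, gameValue, swap_box]
  rw [Finset.sum_comm]
  refine Finset.sum_congr rfl fun x _ => Finset.sum_congr rfl fun y _ => congrArg _ ?_
  rw [Finset.sum_comm, ← sum_one_sub]
  refine Finset.sum_congr rfl fun a _ => ?_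
  rw [← sum_one_sub]
  refine Finset.sum_congr rfl fun b _ => ?_
  rw [V_swap, sub_sub_cancel, sub_sub_cancel]

theorem swap_assemblageBob (x a : Fin 2) :
    S.swap.assemblageBob x a = S.assemblageAlice x (1 - a) := by
  change traceA ((S.B x (1 - a) ⊗ₖ (1 : Matrix ι ι ℂ)) * S.ρ.submatrix Prod.swap Prod.swap) = _
  rw [kronecker_mul_swap]
  rfl

theorem swap_probAlice (x a : Fin 2) : S.swap.probAlice x a = S.probBob x (1 - a) := by
  rw [probAlice, swap_assemblageBob, probBob]

theorem swap_steeredBob (x a : Fin 2) : S.swap.steeredBob x a = S.steeredAlice x (1 - a) := by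
  rw [steeredBob, swap_assemblageBob, swap_probAlice, steeredAlice]

theorem swap_uncertBob (x a : Fin 2) (σ : Matrix ι ι ℂ) :
    S.swap.uncertBob x a σ = S.uncertAlice x (1 - a) σ := by
  rw [uncertBob, uncertAlice]
  refine Finset.sum_congr rfl fun y _ => ?_
  rw [← sum_one_sub]
  refine Finset.sum_congr rfl fun b _ => ?_
  have : S.swap.B y (1 - b) = S.A y b := congrArg (S.A y) (sub_sub_cancel 1 b)
  rw [this, ← V_swap, sub_sub_cancel]

theorem swap_xiBob (x a : Fin 2) : S.swap.xiBob x a = S.xiAlice x (1 - a) := by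
  simp only [xiBob, xiAlice, swap_uncertBob]

theorem swap_isMaxCertainBob (x a : Fin 2) (σ : Matrix ι ι ℂ) :
    S.swap.IsMaxCertainBob x a σ ↔ S.IsMaxCertainAlice x (1 - a) σ := by
  simp only [IsMaxCertainBob, IsMaxCertainAlice, swap_uncertBob]

theorem swap_upBoundBob : S.swap.upBoundBob = S.upBoundAlice := by
  simp only [upBoundBob, upBoundAlice, swap_probAlice, swap_xiBob]
  exact Finset.sum_congr rfl fun x _ => sum_one_sub fun a => 1 / 2 * S.probBob x a * S.xiAlice x a

theorem steering_fails_alice (hS : S.value = omegaQ) (y b : Fin 2)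
    (hyb : (y, b) = (0, 0) ∨ (y, b) = (0, 1) ∨ (y, b) = (1, 0)) :
    0 < S.probBob y b ∧ ¬ S.IsMaxCertainAlice y b (S.steeredAlice y b) ∧
      S.uncertAlice y b (S.steeredAlice y b) < S.xiAlice y b := by
  have h := S.swap.steering_fails (S.swap_value.trans hS) y (1 - b) (by
    rcases hyb with h | h | h <;> obtain ⟨rfl, rfl⟩ := Prod.mk.inj h <;> simp)
  rwa [swap_probAlice, swap_isMaxCertainBob, swap_uncertBob, swap_xiBob, swap_steeredBob,
    sub_sub_cancel] at h

theorem value_lt_upBoundAlice (hS : S.value = omegaQ) : S.value < S.upBoundAlice := by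
  rw [← swap_upBoundBob, ← swap_value]
  exact S.swap.value_lt_upBoundBob (S.swap_value.trans hS)

end Strategy

/-! ### The optimal qubit strategies -/

theorem proj_zero_sub_proj_one (θ : ℝ) : proj θ 0 - proj θ 1 = observable θ := by
  simp only [proj, Fin.coe_ofNat_eq_mod, Nat.zero_mod, Nat.one_mod, pow_zero, pow_one]
  module

theorem trace_observable (θ : ℝ) : (observable θ).trace = 0 := by
  simp [observable, Matrix.trace_fin_two]

theorem observable_mul_self (θ : ℝ) : observable θ * observable θ = 1 := by
  have h : Complex.exp (Complex.I * θ) * Complex.exp (-(Complex.I * θ)) = 1 := by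
    rw [← Complex.exp_add]; simp
  ext i j
  fin_cases i <;> fin_cases j <;> simp [observable, Matrix.mul_apply, h, mul_comm]

theorem observable_anticomm (θ : ℝ) : observable 0 * observable θ + observable θ * observable 0 =
    ((2 * Real.cos θ : ℝ) : ℂ) • 1 := by
  have h := exp_add_exp_neg θ
  push_cast at h
  ext i j
  fin_cases i <;> fin_cases j <;> simp [observable, Matrix.mul_apply, ← h, add_comm]

section QubitStrategy

variable {θ : ℝ} {ψ : Fin 2 × Fin 2 → ℂ} (hψ : ∑ p, ‖ψ p‖ ^ 2 = 1)

theorem qubitStrategy_obsB_zero : (qubitStrategy θ θ ψ hψ).obsB 0 = observable 0 :=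
  proj_zero_sub_proj_one _

theorem qubitStrategy_obsB_one : (qubitStrategy θ θ ψ hψ).obsB 1 = -observable θ := by
  rw [← proj_zero_sub_proj_one, neg_sub]
  rfl

theorem qubitStrategy_swap_obsB_zero : (qubitStrategy θ θ ψ hψ).swap.obsB 0 = -observable 0 := by
  rw [← proj_zero_sub_proj_one, neg_sub]
  rfl

theorem qubitStrategy_swap_obsB_one : (qubitStrategy θ θ ψ hψ).swap.obsB 1 = observable θ :=
  proj_zero_sub_proj_one _

theorem qubitStrategy_xiBob (hθ : Real.cos θ = Real.cos alphaOpt) :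
    (qubitStrategy θ θ ψ hψ).xiBob 0 0 = (1 + Real.sin (alphaOpt / 2)) / 2 ∧
    (qubitStrategy θ θ ψ hψ).xiBob 0 1 = (1 + Real.sin (alphaOpt / 2)) / 2 ∧
    (qubitStrategy θ θ ψ hψ).xiBob 1 0 = (1 + Real.cos (alphaOpt / 2)) / 2 ∧
    (qubitStrategy θ θ ψ hψ).xiBob 1 1 = 1 / 2 := by
  have h0 := qubitStrategy_obsB_zero (θ := θ) hψ
  have h1 := qubitStrategy_obsB_one (θ := θ) hψ
  refine Strategy.xiBob_values _ (Fin.forall_fin_two.2 ⟨?_, ?_⟩) (Fin.forall_fin_two.2 ⟨?_, ?_⟩) ?_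
  · rw [h0, trace_observable]
  · rw [h1, Matrix.trace_neg, trace_observable, neg_zero]
  · rw [h0, observable_mul_self]
  · rw [h1, neg_mul_neg, observable_mul_self]
  · rw [h0, h1, Matrix.mul_neg, Matrix.neg_mul, ← neg_add, observable_anticomm, hθ, neg_smul]

theorem qubitStrategy_xiAlice (hθ : Real.cos θ = Real.cos alphaOpt) :
    (qubitStrategy θ θ ψ hψ).xiAlice 0 1 = (1 + Real.sin (alphaOpt / 2)) / 2 ∧
    (qubitStrategy θ θ ψ hψ).xiAlice 0 0 = (1 + Real.sin (alphaOpt / 2)) / 2 ∧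
    (qubitStrategy θ θ ψ hψ).xiAlice 1 1 = (1 + Real.cos (alphaOpt / 2)) / 2 ∧
    (qubitStrategy θ θ ψ hψ).xiAlice 1 0 = 1 / 2 := by
  have h0 := qubitStrategy_swap_obsB_zero (θ := θ) hψ
  have h1 := qubitStrategy_swap_obsB_one (θ := θ) hψ
  have h := (qubitStrategy θ θ ψ hψ).swap.xiBob_values (Fin.forall_fin_two.2 ⟨?_, ?_⟩)
    (Fin.forall_fin_two.2 ⟨?_, ?_⟩) ?_
  · simpa only [Strategy.swap_xiBob, sub_zero, sub_self] using h
  · rw [h0, Matrix.trace_neg, trace_observable, neg_zero]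
  · rw [h1, trace_observable]
  · rw [h0, neg_mul_neg, observable_mul_self]
  · rw [h1, observable_mul_self]
  · rw [h0, h1, Matrix.mul_neg, Matrix.neg_mul, ← neg_add, observable_anticomm, hθ, neg_smul]

end QubitStrategy

end

end NonlocalGame

theorem proposition2 :
    -- the classical value is 3/4
    IsGreatest {v : ℝ | ∃ P : Box, IsClassicalBox P ∧ gameValue P = v} (3 / 4) ∧
    -- the quantum value is `omegaQ ≈ 0.7822`
    IsGreatest {v : ℝ | ∃ (m n : ℕ) (S : Strategy (Fin m) (Fin n)), S.value = v} omegaQ ∧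
    |omegaQ - 0.7822| < 0.00005 ∧
    -- the optimal qubit strategy and its uniqueness, for both signs of the angle
    (∀ θ : ℝ, θ = alphaOpt ∨ θ = -alphaOpt →
      (∃ ψ : Fin 2 × Fin 2 → ℂ, ∑ p, ‖ψ p‖ ^ 2 = 1 ∧
        (bellOperator θ θ).mulVec ψ = (omegaQ : ℂ) • ψ) ∧
      ∀ (ψ : Fin 2 × Fin 2 → ℂ) (hψ : ∑ p, ‖ψ p‖ ^ 2 = 1),
        (bellOperator θ θ).mulVec ψ = (omegaQ : ℂ) • ψ →
        ∀ R : Strategy (Fin 2) (Fin 2), R = qubitStrategy θ θ ψ hψ →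
        R.value = omegaQ ∧
        (∀ (m n : ℕ) (S : Strategy (Fin m) (Fin n)), S.value = omegaQ →
          S.IsLocallyIsometricTo R) ∧
        -- Bob's uncertainty relations: three non-trivial ones, and the trivial one
        -- `P(b=0|y=0) / 2 ≤ 1 / 2`
        R.xiBob 0 0 = (1 + Real.sin (alphaOpt / 2)) / 2 ∧
        R.xiBob 0 1 = (1 + Real.sin (alphaOpt / 2)) / 2 ∧
        R.xiBob 1 0 = (1 + Real.cos (alphaOpt / 2)) / 2 ∧
        R.xiBob 1 1 = 1 / 2 ∧
        -- Alice's uncertainty relations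
        R.xiAlice 0 0 = (1 + Real.sin (alphaOpt / 2)) / 2 ∧
        R.xiAlice 0 1 = (1 + Real.sin (alphaOpt / 2)) / 2 ∧
        R.xiAlice 1 1 = (1 + Real.cos (alphaOpt / 2)) / 2 ∧
        R.xiAlice 1 0 = 1 / 2 ∧
        -- the only pairs for which steering to a maximally certain state succeeds
        0 < R.probAlice 1 0 ∧
        R.IsMaxCertainBob 1 0 (R.steeredBob 1 0) ∧
        0 < R.probBob 1 1 ∧
        R.IsMaxCertainAlice 1 1 (R.steeredAlice 1 1)) ∧
    (1 + Real.sin (alphaOpt / 2)) / 2 < 1 ∧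
    (1 + Real.cos (alphaOpt / 2)) / 2 < 1 ∧
    -- steering fails for every optimal strategy, whose value is below the uncertainty bounds
    (∀ (m n : ℕ) (S : Strategy (Fin m) (Fin n)), S.value = omegaQ →
      (∀ x a : Fin 2, (x, a) = (0, 0) ∨ (x, a) = (0, 1) ∨ (x, a) = (1, 1) →
        0 < S.probAlice x a ∧ ¬ S.IsMaxCertainBob x a (S.steeredBob x a) ∧
        S.uncertBob x a (S.steeredBob x a) < S.xiBob x a) ∧
      (∀ y b : Fin 2, (y, b) = (0, 0) ∨ (y, b) = (0, 1) ∨ (y, b) = (1, 0) →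
        0 < S.probBob y b ∧ ¬ S.IsMaxCertainAlice y b (S.steeredAlice y b) ∧
        S.uncertAlice y b (S.steeredAlice y b) < S.xiAlice y b) ∧
      S.value < S.upBoundBob ∧ S.value < S.upBoundAlice) := by
  refine ⟨isGreatest_classical, isGreatest_quantum, omegaQ_approx, fun θ hθ => ?_,
    by linarith [sin_alphaOpt_half_lt], by linarith [cos_alphaOpt_half_lt],
    fun m n S hS => ⟨S.steering_fails hS, S.steering_fails_alice hS, S.value_lt_upBoundBob hS,
      S.value_lt_upBoundAlice hS⟩⟩
  -- The sign of `θ` matters no further: only `cos θ = cos α*` and `sin θ ≠ 0` are used.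
  have hcos : Real.cos θ = Real.cos alphaOpt := by
    rcases hθ with rfl | rfl
    · rfl
    · exact Real.cos_neg _
  have hsin : Real.sin θ ≠ 0 := by
    rcases hθ with rfl | rfl
    · exact sin_alphaOpt_pos.ne'
    · rw [Real.sin_neg]
      exact (neg_neg_of_pos sin_alphaOpt_pos).ne
  refine ⟨exists_eigenvector hcos, ?_⟩
  rintro ψ hψ hBell R rfl
  have hR := qubitStrategy_value hψ hBell
  have hR' := (Strategy.swap_value _).trans hR
  obtain ⟨hB00, hB01, hB10, hB11⟩ := qubitStrategy_xiBob hψ hcos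
  obtain ⟨hA01, hA00, hA11, hA10⟩ := qubitStrategy_xiAlice hψ hcos
  refine ⟨hR, fun m n S hS => S.isLocallyIsometricTo_qubitStrategy hS hcos hsin hψ hBell,
    hB00, hB01, hB10, hB11, hA00, hA01, hA11, hA10, Strategy.probAlice_pos _ hR 1 0,
    Strategy.isMaxCertainBob_one_zero _ hR hB10, ?_, ?_⟩
  · have := Strategy.probAlice_pos _ hR' 1 0
    rwa [Strategy.swap_probAlice, sub_zero] at this
  · have := Strategy.isMaxCertainBob_one_zero _ hR' (by rw [Strategy.swap_xiBob, sub_zero, hA11])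
    rwa [Strategy.swap_steeredBob, Strategy.swap_isMaxCertainBob, sub_zero] at this
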